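/- Let $K$ be a field of characteristic $0$. All vector spaces, algebras and tensor products are over $K$, and $\wedge^j$ is the $j$-th exterior power over $K$ of the space $A$. Write $A^i=A^{\otimes i}$. **Poisson algebras and modules.** A Poisson algebra is a unital associative, not necessarily commutative, $K$-algebra $A$ with a $K$-bilinear Lie bracket $\{-,-\}$ such that $\{ab,c\}=a\{b,c\}+\{a,c\}b$ for all $a,b,c\in A$. A Poisson module over $A$ is a ($K$-central) $A$-bimodule $M$ with a $K$-bilinear map $\{-,-\}_*:A\times M\to M$ such that $$\{\{a,b\},m\}_*=\{a,\{b,m\}_*\}_*-\{b,\{a,m\}_*\}_*,\quad \{a,bm\}_*=\{a,b\}m+b\{a,m\}_*,\quad \{a,mb\}_*=m\{a,b\}+\{a,m\}_*b,$$ $$\{ab,m\}_*=a\{b,m\}_*+\{a,m\}_*b .$$ **Enveloping algebras.** $\mathcal U(A)$ is the universal enveloping algebra of the Lie algebra $(A,\{-,-\})$; $K$ is its trivial module, and $M$ is a $\mathcal U(A)$-module through $\{-,-\}_*$. Let $A^e=A\otimes A^{op}$. The Lie algebra $A$ acts on $A^e$ by derivations through $\{-,-\}$ on both factors. The quasi-Poisson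 enveloping algebra is the smash product $\mathcal Q=A^e\#\mathcal U(A)$, i.e. $A^e\otimes\mathcal U(A)$ with $(p\# u)(q\# v)=\sum p\,(u_{1}\cdot q)\# u_{2}v$. The module $M$ is a $\mathcal Q$-module by $((a\otimes b)\# u)m=a(u m)b$. The space $A^4$ is a $\mathcal Q$-module: $A^e$ acts by multiplication on the two outer factors (on the left of the first and on the right of the last), and the Lie algebra $A$ acts diagonally through $\{-,-\}$. Let $\Omega^2(A)$ be the quotient of $A^4$ by the $\mathcal Q$-submodule generated by the elements $$a\otimes b\otimes c\otimes 1-1\otimes ab\otimes c\otimes 1+1\otimes a\otimes bc\otimes 1-1\otimes a\otimes b\otimes c ,\qquad a,b,c\in A$$ (the second syzygy of the bimodule $A$ in its bar resolution). **Poisson cohomology.** Let $$PC^n=\bigoplus_{i+j=n,\ i\ge0,\ j\ge0,\ i\ne1}\mathrm{Hom}_K(A^{i}\otimes\wedge^j,M),$$ with the differential whose components are: * for $i\ge2$, the Hochschild differential $\delta_V:\mathrm{Hom}(A^i\otimes\wedge^j,M)\to\mathrm{Hom}(A^{i+1}\otimes\wedge^j,M)$ in the $A$-variables, with $\wedge^j$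 as parameters; * for $i\ne1$, the map $(-1)^i\delta_H:\mathrm{Hom}(A^i\otimes\wedge^j,M)\to\mathrm{Hom}(A^i\otimes\wedge^{j+1},M)$, where $\delta_H$ is the Chevalley–Eilenberg differential of the Lie algebra $A$ with values in its module $\mathrm{Hom}(A^i,M)$; * for $j\ge 0$, the map $\delta_v:\mathrm{Hom}(\wedge^{j+1},M)\to\mathrm{Hom}(A^2\otimes\wedge^{j},M)$, $$(\delta_vf)(a\otimes b\otimes\omega)=a\,f(b\wedge\omega)-f(ab\wedge\omega)+f(a\wedge\omega)\,b .$$ This is a cochain complex $PC^\bullet$, and $HP^n(A,M):=H^n(PC^\bullet)$ is the $n$-th Poisson cohomology group. Let $CE^\bullet$, $CE^n=\mathrm{Hom}_K(\wedge^n,M)$, be the Chevalley–Eilenberg complex, and let $T^\bullet\subseteq PC^\bullet$ be the subcomplex formed by the summands with $i\ge2$. Inclusion and projection form a short exact sequence of complexes $$0\to T^\bullet\to PC^\bullet\to CE^\bullet\to0. \qquad(*)$$ **Theorem.** Let $A$ be a Poisson algebra over $K$ and $M$ a Poisson module over $A$. There are $K$-linear isomorphisms, for all $n\ge0$, $$H^n(CE^\bullet)\cong\mathrm{Ext}^n_{\mathcal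 U(A)}(K,M),\qquad H^{n+2}(T^\bullet)\cong\mathrm{Ext}^n_{\mathcal Q}(\Omega^2(A),M),$$ under which the long exact cohomology sequence of $(*)$ becomes a long exact sequence $$0\to HP^0(A,M)\to\mathrm{Hom}_{\mathcal U(A)}(K,M)\to0\to HP^1(A,M)\to\mathrm{Ext}^1_{\mathcal U(A)}(K,M)\to\mathrm{Hom}_{\mathcal Q}(\Omega^2(A),M)\to HP^2(A,M)\to\mathrm{Ext}^2_{\mathcal U(A)}(K,M)\to\cdots$$ $$\cdots\to\mathrm{Ext}^{n-2}_{\mathcal Q}(\Omega^2(A),M)\to HP^n(A,M)\to\mathrm{Ext}^n_{\mathcal U(A)}(K,M)\to\mathrm{Ext}^{n-1}_{\mathcal Q}(\Omega^2(A),M)\to\cdots$$ -/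

import Mathlib

universe u

namespace FGVPoisson

open MulOpposite CategoryTheory
open scoped TensorProduct

set_option linter.unusedSectionVars false

section LieCochains

variable {K L V N N' : Type*} [CommRing K] [LieRing L] [LieAlgebra K L]
  [AddCommGroup V] [Module K V] [LieRingModule L V] [LieModule K L V]
  [AddCommGroup N] [Module K N] [LieRingModule L N] [LieModule K L N]
  [AddCommGroup N'] [Module K N'] [LieRingModule L N'] [LieModule K L N']

/-- The action of `x` on multilinear maps `V × ⋯ × V → N`:
`(x · f)(v) = ⁅x, f v⁆ - ∑ t, f (v₁, …, ⁅x, v_t⁆, …, v_n)`. -/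
def multilinearLie (n : ℕ) (x : L) :
    MultilinearMap K (fun _ : Fin n => V) N →ₗ[K] MultilinearMap K (fun _ : Fin n => V) N where
  toFun f := (LieModule.toEnd K L N x).compMultilinearMap f -
    ∑ t : Fin n, f.compLinearMap
      (Function.update (fun _ => LinearMap.id) t (LieModule.toEnd K L V x))
  map_add' f g := by
    ext v
    simp [Finset.sum_add_distrib]
    abel
  map_smul' c f := by
    ext v
    simp [Finset.smul_sum, smul_sub]

theorem multilinearLie_apply (n : ℕ) (x : L) (f : MultilinearMap K (fun _ : Fin n => V) N)
    (v : Fin n → V) :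
    multilinearLie n x f v = ⁅x, f v⁆ - ∑ t, f (Function.update v t ⁅x, v t⁆) := by
  have h : ∀ t : Fin n, (fun s => (Function.update (fun _ : Fin n => (LinearMap.id : V →ₗ[K] V)) t
      (LieModule.toEnd K L V x)) s (v s)) = Function.update v t ⁅x, v t⁆ := by
    intro t
    funext s
    by_cases hs : s = t
    · subst hs; simp
    · simp [hs]
  simp [multilinearLie, h]

theorem multilinearLie_curryLeft (n : ℕ) (x : L)
    (f : MultilinearMap K (fun _ : Fin (n + 1) => V) N) (a : V) :
    (multilinearLie (n + 1) x f).curryLeft a =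
      multilinearLie n x (f.curryLeft a) - f.curryLeft ⁅x, a⁆ := by
  ext v
  simp only [MultilinearMap.curryLeft_apply, multilinearLie_apply, sub_apply,
    Fin.sum_univ_succ, Fin.cons_zero, Fin.cons_succ, Fin.update_cons_zero, Fin.cons_update]
  abel

theorem multilinear_ext_curryLeft {n : ℕ}
    {f g : MultilinearMap K (fun _ : Fin (n + 1) => V) N}
    (h : ∀ a, f.curryLeft a = g.curryLeft a) : f = g := by
  ext v
  rw [← Fin.cons_self_tail v]
  exact congrArg (fun F => F (Fin.tail v)) (h (v 0))

theorem multilinearLie_lie (n : ℕ) (x y : L) (f : MultilinearMap K (fun _ : Fin n => V) N) :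
    multilinearLie n ⁅x, y⁆ f =
      multilinearLie n x (multilinearLie n y f) - multilinearLie n y (multilinearLie n x f) := by
  induction n with
  | zero =>
    ext v
    simp [multilinearLie_apply]
  | succ n ih =>
    apply multilinear_ext_curryLeft
    intro a
    have hsub : ∀ (f g : MultilinearMap K (fun _ : Fin (n + 1) => V) N),
        (f - g).curryLeft a = f.curryLeft a - g.curryLeft a := fun _ _ => rfl
    simp only [hsub, multilinearLie_curryLeft, map_sub, ih, lie_lie]
    abel

instance multilinearLieRingModule (n : ℕ) :
    LieRingModule L (MultilinearMap K (fun _ : Fin n => V) N) where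
  bracket x f := multilinearLie n x f
  add_lie x y f := by
    ext v
    simp [multilinearLie_apply, MultilinearMap.map_update_add, Finset.sum_add_distrib]
    abel
  lie_add x f g := map_add _ _ _
  leibniz_lie x y f := by
    change multilinearLie n x (multilinearLie n y f) =
      multilinearLie n ⁅x, y⁆ f + multilinearLie n y (multilinearLie n x f)
    rw [multilinearLie_lie]
    abel

theorem lie_multilinear (n : ℕ) (x : L) (f : MultilinearMap K (fun _ : Fin n => V) N) :
    ⁅x, f⁆ = multilinearLie n x f := rfl

instance multilinearLieModule (n : ℕ) :
    LieModule K L (MultilinearMap K (fun _ : Fin n => V) N) where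
  smul_lie c x f := by
    ext v
    simp [lie_multilinear, multilinearLie_apply, MultilinearMap.map_update_smul,
      Finset.smul_sum, smul_sub]
  lie_smul c x f := by
    simp [lie_multilinear]

/-- The Lie derivative of an alternating cochain on `L`. -/
def lieDer (n : ℕ) : L →ₗ[K] (L [⋀^Fin n]→ₗ[K] N) →ₗ[K] (L [⋀^Fin n]→ₗ[K] N) :=
  LinearMap.mk₂ K
    (fun x f =>
      { (⁅x, f.toMultilinearMap⁆ : MultilinearMap K (fun _ : Fin n => L) N) with
        map_eq_zero_of_eq' := by
          intro v i j hv hij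
          change multilinearLie n x f.toMultilinearMap v = 0
          rw [multilinearLie_apply]
          have h0 : f.toMultilinearMap v = 0 := f.map_eq_zero_of_eq v hv hij
          rw [h0, lie_zero, zero_sub, neg_eq_zero]
          have hz : ∀ t, t ∉ ({i, j} : Finset (Fin n)) →
              f.toMultilinearMap (Function.update v t ⁅x, v t⁆) = 0 := by
            intro t ht
            simp only [Finset.mem_insert, Finset.mem_singleton, not_or] at ht
            refine f.map_eq_zero_of_eq _ ?_ hij
            rw [Function.update_of_ne (Ne.symm ht.1), Function.update_of_ne (Ne.symm ht.2), hv]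
          rw [← Finset.sum_subset (Finset.subset_univ ({i, j} : Finset (Fin n)))
            (fun t _ ht => hz t ht), Finset.sum_pair hij, hv]
          have hs := f.map_swap (Function.update v i ⁅x, v j⁆) hij
          have hc : (Function.update v i ⁅x, v j⁆) ∘ Equiv.swap i j =
              Function.update v j ⁅x, v j⁆ := by
            funext k
            by_cases hk : k = i
            · subst hk
              simp [Function.update_of_ne (Ne.symm hij), Function.update_of_ne hij, hv]
            · by_cases hk' : k = j
              · subst hk'; simp
              · simp [Equiv.swap_apply_of_ne_of_ne hk hk', Function.update_of_ne hk,
                  Function.update_of_ne hk']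
          rw [hc] at hs
          change f _ + f _ = 0
          rw [hs]
          abel })
    (by intro x y f; ext v; exact congrArg (fun F => F v) (add_lie x y f.toMultilinearMap))
    (by intro c x f; ext v; exact congrArg (fun F => F v) (smul_lie c x f.toMultilinearMap))
    (by intro x f g; ext v
        exact congrArg (fun F => F v) (lie_add x f.toMultilinearMap g.toMultilinearMap))
    (by intro c x f; ext v; exact congrArg (fun F => F v) (lie_smul c x f.toMultilinearMap))

theorem lieDer_apply (n : ℕ) (x : L) (f : L [⋀^Fin n]→ₗ[K] N) (v : Fin n → L) :
    lieDer n x f v = ⁅x, f v⁆ - ∑ t, f (Function.update v t ⁅x, v t⁆) :=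
  multilinearLie_apply n x f.toMultilinearMap v

theorem lieDer_curryLeft (n : ℕ) (x a : L) (f : L [⋀^Fin (n + 1)]→ₗ[K] N) :
    (lieDer (n + 1) x f).curryLeft a = lieDer n x (f.curryLeft a) - f.curryLeft ⁅x, a⁆ := by
  ext v
  exact congrArg (fun F => F v) (multilinearLie_curryLeft n x f.toMultilinearMap a)

theorem alternating_ext_curryLeft {n : ℕ} {f g : L [⋀^Fin (n + 1)]→ₗ[K] N}
    (h : ∀ a, f.curryLeft a = g.curryLeft a) : f = g := by
  ext v
  rw [← Fin.cons_self_tail v]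
  exact congrArg (fun F => F (Fin.tail v)) (h (v 0))

theorem lieDer_lie (n : ℕ) (x y : L) (f : L [⋀^Fin n]→ₗ[K] N) :
    lieDer n ⁅x, y⁆ f = lieDer n x (lieDer n y f) - lieDer n y (lieDer n x f) := by
  ext v
  exact congrArg (fun F => F v) (multilinearLie_lie n x y f.toMultilinearMap)

/-- If `f` is alternating and vanishes as soon as its first entry is `x`, then it vanishes
as soon as one entry is `x`. -/
theorem alternating_eq_zero_of_mem {n : ℕ} (f : L [⋀^Fin n]→ₗ[K] N) (x : L)
    (h : ∀ m (e : n = m + 1) (w : Fin m → L), f (fun k => Fin.cons (α := fun _ => L) x w (Fin.cast e k)) = 0)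
    (v : Fin n → L) (i : Fin n) (hv : v i = x) : f v = 0 := by
  cases n with
  | zero => exact i.elim0
  | succ m =>
    have h' : ∀ w : Fin m → L, f (Fin.cons (α := fun _ => L) x w) = 0 := fun w => h m rfl w
    by_cases hi : i = 0
    · subst hi
      rw [← Fin.cons_self_tail v, hv]
      exact h' _
    · have hs := f.map_swap v (Ne.symm hi)
      have : (v ∘ Equiv.swap 0 i) 0 = x := by simp [hv]
      rw [← Fin.cons_self_tail (v ∘ Equiv.swap 0 i), this, h' _] at hs
      exact neg_eq_zero.mp hs.symm

/-- Build an alternating map from its curried form. -/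
def uncurryAlt {n : ℕ} (g : L →ₗ[K] (L [⋀^Fin n]→ₗ[K] N))
    (h : ∀ (x : L) (v : Fin n → L) (i : Fin n), v i = x → g x v = 0) :
    L [⋀^Fin (n + 1)]→ₗ[K] N where
  toMultilinearMap := LinearMap.uncurryLeft (M := fun _ => L)
    { toFun := fun x => (g x).toMultilinearMap
      map_add' := fun x y => by rw [map_add]; rfl
      map_smul' := fun c x => by rw [map_smul]; rfl }
  map_eq_zero_of_eq' := by
    intro v i j hv hij
    change g (v 0) (Fin.tail v) = 0
    by_cases hi : i = 0
    · subst hi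
      obtain ⟨j', rfl⟩ := Fin.exists_succ_eq.mpr (Ne.symm hij)
      exact h _ _ j' hv.symm
    · obtain ⟨i', rfl⟩ := Fin.exists_succ_eq.mpr hi
      by_cases hj : j = 0
      · subst hj
        exact h _ _ i' hv
      · obtain ⟨j', rfl⟩ := Fin.exists_succ_eq.mpr hj
        exact (g (v 0)).map_eq_zero_of_eq _ hv (fun e => hij (by rw [e]))

/-- The Chevalley-Eilenberg coboundary, built by recursion from Cartan's formula
`ι_x (d f) = L_x f - d (ι_x f)`. -/
def ceRec : (n : ℕ) →
    { d : (L [⋀^Fin n]→ₗ[K] N) →ₗ[K] (L [⋀^Fin (n + 1)]→ₗ[K] N) //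
      ∀ (f : L [⋀^Fin n]→ₗ[K] N) (x : L),
        (∀ (v : Fin n → L) (i : Fin n), v i = x → f v = 0) →
        (d f).curryLeft x = lieDer n x f }
  | 0 => ⟨{ toFun := fun f => uncurryAlt ((lieDer 0).flip f) (fun _ _ i => i.elim0)
            map_add' := fun f g => by
              apply alternating_ext_curryLeft; intro a
              ext v; exact congrArg (fun F => F v) (map_add (lieDer 0 a) f g)
            map_smul' := fun c f => by
              apply alternating_ext_curryLeft; intro a
              ext v; exact congrArg (fun F => F v) (map_smul (lieDer 0 a) c f) },
          fun _ _ _ => rfl⟩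
  | n + 1 => ⟨{ toFun := fun f =>
                  uncurryAlt ((lieDer (n + 1)).flip f - (ceRec n).1 ∘ₗ f.curryLeft) (by
                    intro x v i hv
                    refine alternating_eq_zero_of_mem _ x ?_ v i hv
                    intro m e w
                    obtain rfl : n = m := by omega
                    have h1 := congrArg (fun F => F w) ((ceRec n).2 (f.curryLeft x) x (by
                      intro u k hk
                      exact f.map_eq_zero_of_eq (Matrix.vecCons x u) (i := 0) (j := k.succ)
                        (by simp [hk]) (Fin.succ_ne_zero k).symm))
                    have h2 := congrArg (fun F => F w) (lieDer_curryLeft n x x f)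
                    simp only [lie_self, map_zero, sub_zero] at h2
                    change lieDer (n + 1) x f (Fin.cons (α := fun _ => L) x w) -
                      (ceRec n).1 (f.curryLeft x) (Fin.cons (α := fun _ => L) x w) = 0
                    rw [sub_eq_zero]
                    exact h2.trans h1.symm)
                map_add' := fun f g => by
                  apply alternating_ext_curryLeft; intro a
                  ext v
                  change (lieDer (n + 1) a (f + g) - (ceRec n).1 ((f + g).curryLeft a)) v =
                    (lieDer (n + 1) a f - (ceRec n).1 (f.curryLeft a)) v +
                    (lieDer (n + 1) a g - (ceRec n).1 (g.curryLeft a)) v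
                  rw [map_add, AlternatingMap.curryLeft_add, LinearMap.add_apply, map_add]
                  simp only [AlternatingMap.sub_apply, AlternatingMap.add_apply]
                  abel
                map_smul' := fun c f => by
                  apply alternating_ext_curryLeft; intro a
                  ext v
                  change (lieDer (n + 1) a (c • f) - (ceRec n).1 ((c • f).curryLeft a)) v =
                    c • (lieDer (n + 1) a f - (ceRec n).1 (f.curryLeft a)) v
                  rw [map_smul, AlternatingMap.curryLeft_smul, LinearMap.smul_apply, map_smul,
                    ← smul_sub]
                  rfl },
              fun f x hf => by
                have h0 : f.curryLeft x = 0 := by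
                  ext w
                  exact hf (Matrix.vecCons x w) 0 rfl
                ext w
                change lieDer (n + 1) x f w - (ceRec n).1 (f.curryLeft x) w = _
                rw [h0, map_zero]
                simp⟩

theorem ceRec_zero_curryLeft (f : L [⋀^Fin 0]→ₗ[K] N) (x : L) :
    ((ceRec 0).1 f).curryLeft x = lieDer 0 x f := rfl

theorem ceRec_succ_curryLeft (n : ℕ) (f : L [⋀^Fin (n + 1)]→ₗ[K] N) (x : L) :
    ((ceRec (n + 1)).1 f).curryLeft x = lieDer (n + 1) x f - (ceRec n).1 (f.curryLeft x) := rfl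

theorem ceRec_apply (n : ℕ) (f : L [⋀^Fin n]→ₗ[K] N) (x : Fin (n + 1) → L) :
    (ceRec n).1 f x =
      ∑ i : Fin (n + 1), (-1 : ℤ) ^ (i : ℕ) • ⁅x i, f (i.removeNth x)⁆ +
      ∑ p : Fin (n + 1), ∑ q : Fin (n + 1), if p < q then
        (-1 : ℤ) ^ ((p : ℕ) + 1) • f (p.removeNth (Function.update x q ⁅x p, x q⁆)) else 0 := by
  induction n with
  | zero =>
    rw [← Fin.cons_self_tail x]
    change lieDer 0 (x 0) f _ = _
    rw [lieDer_apply]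
    simp
  | succ n ih =>
    rw [← Fin.cons_self_tail x]
    generalize x 0 = y
    generalize Fin.tail x = v
    change lieDer (n + 1) y f v - (ceRec n).1 (f.curryLeft y) v = _
    rw [ih, lieDer_apply]
    have hr : ∀ (i : Fin (n + 1)) (u : Fin (n + 1) → L),
        i.succ.removeNth (Fin.cons (α := fun _ => L) y u) = Fin.cons (α := fun _ => L) y (i.removeNth u) := by
      intro i u
      funext k
      refine Fin.cases ?_ (fun k => ?_) k <;> simp [Fin.removeNth]
    rw [Fin.sum_univ_succ (n := n + 1), Fin.sum_univ_succ (n := n + 1)]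
    have hq : ∀ p : Fin (n + 1), (∑ q : Fin (n + 2), if p.succ < q then
        (-1 : ℤ) ^ ((p.succ : ℕ) + 1) • f (p.succ.removeNth (Function.update (Fin.cons (α := fun _ => L) y v) q
          ⁅(Fin.cons y v : Fin (n + 2) → L) p.succ, (Fin.cons y v : Fin (n + 2) → L) q⁆)) else 0) =
        - ∑ q : Fin (n + 1), if p < q then
        (-1 : ℤ) ^ ((p : ℕ) + 1) • f.curryLeft y (p.removeNth (Function.update v q ⁅v p, v q⁆)) else 0 := by
      intro p
      rw [Fin.sum_univ_succ, if_neg (by simp), zero_add, ← Finset.sum_neg_distrib]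
      refine Finset.sum_congr rfl fun q _ => ?_
      simp only [Fin.succ_lt_succ_iff, Fin.cons_succ]
      split_ifs with hpq
      · rw [← Fin.cons_update, hr, Fin.val_succ, pow_succ]
        rw [AlternatingMap.curryLeft_apply_apply]
        simp
        rfl
      · simp
    have h0 : (∑ q : Fin (n + 2), if (0 : Fin (n + 2)) < q then
        (-1 : ℤ) ^ (((0 : Fin (n + 2)) : ℕ) + 1) • f ((0 : Fin (n + 2)).removeNth
          (Function.update (Fin.cons (α := fun _ => L) y v) q
          ⁅(Fin.cons y v : Fin (n + 2) → L) 0, (Fin.cons y v : Fin (n + 2) → L) q⁆)) else 0) =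
        - ∑ t, f (Function.update v t ⁅y, v t⁆) := by
      rw [Fin.sum_univ_succ, if_neg (by simp), zero_add, ← Finset.sum_neg_distrib]
      refine Finset.sum_congr rfl fun q _ => ?_
      rw [if_pos (Fin.succ_pos q)]
      simp only [Fin.cons_succ, Fin.cons_zero, ← Fin.cons_update, Fin.removeNth_zero,
        Fin.tail_cons]
      simp
    rw [h0]
    simp only [hq, hr, Finset.sum_neg_distrib]
    have h1 : ∑ i : Fin (n + 1), (-1 : ℤ) ^ (i.succ : ℕ) • ⁅(Fin.cons y v : Fin (n + 2) → L) i.succ,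
        f (Fin.cons (α := fun _ => L) y (i.removeNth v))⁆ = - ∑ i : Fin (n + 1), (-1 : ℤ) ^ (i : ℕ) • ⁅v i,
        f.curryLeft y (i.removeNth v)⁆ := by
      rw [← Finset.sum_neg_distrib]
      refine Finset.sum_congr rfl fun i _ => ?_
      rw [Fin.val_succ, pow_succ]
      simp
      rfl
    rw [h1]
    simp only [Fin.cons_zero, Fin.removeNth_zero, Fin.tail_cons, Fin.val_zero, pow_zero, one_smul]
    abel

/-- The Chevalley-Eilenberg coboundary
`(d f)(x₀, …, x_n) = ∑ i, (-1)^i ⁅x_i, f(x₀, …, x̂_i, …, x_n)⁆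
  + ∑_{p < q} (-1)^(p+1) f(x₀, …, x̂_p, …, ⁅x_p, x_q⁆, …, x_n)`,
where `⁅x_p, x_q⁆` stands in the place of `x_q`; moving it to the front turns `(-1)^(p+1)` into
the usual `(-1)^(p+q)`. -/
def ceD (n : ℕ) : (L [⋀^Fin n]→ₗ[K] N) →ₗ[K] (L [⋀^Fin (n + 1)]→ₗ[K] N) where
  toFun f :=
    { toFun := fun x =>
        ∑ i : Fin (n + 1), (-1 : ℤ) ^ (i : ℕ) • ⁅x i, f (i.removeNth x)⁆ +
        ∑ p : Fin (n + 1), ∑ q : Fin (n + 1), if p < q then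
          (-1 : ℤ) ^ ((p : ℕ) + 1) • f (p.removeNth (Function.update x q ⁅x p, x q⁆)) else 0
      map_update_add' := by
        intro _ m i x y
        obtain rfl := Subsingleton.elim ‹DecidableEq (Fin (n + 1))› (instDecidableEqFin (n + 1))
        simp only [← ceRec_apply]
        exact ((ceRec n).1 f).map_update_add m i x y
      map_update_smul' := by
        intro _ m i c x
        obtain rfl := Subsingleton.elim ‹DecidableEq (Fin (n + 1))› (instDecidableEqFin (n + 1))
        simp only [← ceRec_apply]
        exact ((ceRec n).1 f).map_update_smul m i c x
      map_eq_zero_of_eq' := by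
        intro v i j hv hij
        simp only [← ceRec_apply]
        exact ((ceRec n).1 f).map_eq_zero_of_eq v hv hij }
  map_add' f g := by
    ext x
    exact (ceRec_apply n (f + g) x).symm.trans
      ((congrArg (fun F => F x) (map_add (ceRec n).1 f g)).trans
        (congrArg₂ (· + ·) (ceRec_apply n f x) (ceRec_apply n g x)))
  map_smul' c f := by
    ext x
    exact (ceRec_apply n (c • f) x).symm.trans
      ((congrArg (fun F => F x) (map_smul (ceRec n).1 c f)).trans
        (congrArg (c • ·) (ceRec_apply n f x)))

theorem ceD_eq_ceRec (n : ℕ) : (ceD n : (L [⋀^Fin n]→ₗ[K] N) →ₗ[K] _) = (ceRec n).1 := by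
  ext f x
  exact (ceRec_apply n f x).symm

theorem ceD_zero_curryLeft (f : L [⋀^Fin 0]→ₗ[K] N) (x : L) :
    (ceD 0 f).curryLeft x = lieDer 0 x f := by
  rw [ceD_eq_ceRec]; rfl

/-- Cartan's formula. -/
theorem ceD_succ_curryLeft (n : ℕ) (f : L [⋀^Fin (n + 1)]→ₗ[K] N) (x : L) :
    (ceD (n + 1) f).curryLeft x = lieDer (n + 1) x f - ceD n (f.curryLeft x) := by
  rw [ceD_eq_ceRec, ceD_eq_ceRec]; rfl

theorem curryLeft_sub' {n : ℕ} (f g : L [⋀^Fin (n + 1)]→ₗ[K] N) (a : L) :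
    (f - g).curryLeft a = f.curryLeft a - g.curryLeft a := rfl

theorem lieDer_ceD (n : ℕ) (x : L) (f : L [⋀^Fin n]→ₗ[K] N) :
    lieDer (n + 1) x (ceD n f) = ceD n (lieDer n x f) := by
  induction n with
  | zero =>
    apply alternating_ext_curryLeft
    intro a
    rw [lieDer_curryLeft, ceD_zero_curryLeft, ceD_zero_curryLeft, ceD_zero_curryLeft, lieDer_lie]
    abel
  | succ n ih =>
    apply alternating_ext_curryLeft
    intro a
    rw [lieDer_curryLeft, ceD_succ_curryLeft, ceD_succ_curryLeft, ceD_succ_curryLeft, lieDer_lie,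
      lieDer_curryLeft, map_sub, map_sub, ih]
    abel

theorem ceD_ceD (n : ℕ) (f : L [⋀^Fin n]→ₗ[K] N) : ceD (n + 1) (ceD n f) = 0 := by
  induction n with
  | zero =>
    apply alternating_ext_curryLeft
    intro a
    rw [ceD_succ_curryLeft, lieDer_ceD, ceD_zero_curryLeft, sub_self]
    rfl
  | succ n ih =>
    apply alternating_ext_curryLeft
    intro a
    rw [ceD_succ_curryLeft, lieDer_ceD, ceD_succ_curryLeft, map_sub, ih, sub_zero, sub_self]
    rfl

/-- Moving the bracket `z = ⁅x_p, x_q⁆` from the place of `x_q`, `q = j + 1`, to the front. -/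
theorem neg_one_pow_smul_removeNth_update (m : ℕ) (f : L [⋀^Fin (m + 1)]→ₗ[K] N)
    (x : Fin (m + 2) → L) (p : Fin (m + 2)) (j : Fin (m + 1)) (h : p < j.succ) (z : L) :
    (-1 : ℤ) ^ ((p : ℕ) + 1) • f (p.removeNth (Function.update x j.succ z)) =
      (-1 : ℤ) ^ ((p : ℕ) + (j.succ : ℕ)) •
        f (Matrix.vecCons z (j.removeNth (p.removeNth x))) := by
  have hj : p.succAbove j = j.succ := Fin.succAbove_of_le_castSucc p j (Fin.le_castSucc_iff.mpr h)
  have h1 : p.removeNth (Function.update x j.succ z) =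
      j.insertNth z (j.removeNth (p.removeNth x)) := by
    rw [← hj, Fin.removeNth_update_succAbove, Fin.insertNth_removeNth]
  rw [h1, AlternatingMap.map_insertNth, smul_smul, Fin.val_succ, ← add_assoc, pow_succ, pow_succ,
    pow_add]
  congr 1
  ring

/-- The Chevalley-Eilenberg coboundary is natural in the coefficients. -/
theorem ceD_comp (n : ℕ) (φ : N →ₗ[K] N') (hφ : ∀ (x : L) (m : N), φ ⁅x, m⁆ = ⁅x, φ m⁆)
    (f : L [⋀^Fin n]→ₗ[K] N) :
    ceD n (φ.compAlternatingMap f) = φ.compAlternatingMap (ceD n f) := by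
  ext x
  simp only [ceD, LinearMap.coe_mk, AddHom.coe_mk, AlternatingMap.coe_mk, MultilinearMap.coe_mk,
    LinearMap.compAlternatingMap_apply, map_add, map_sum, map_zsmul, hφ]
  congr 1
  refine Finset.sum_congr rfl fun p _ => Finset.sum_congr rfl fun q _ => ?_
  split_ifs <;> simp

end LieCochains

section Poisson

/-- A (not necessarily commutative) Poisson algebra structure on the `K`-algebra `A`. -/
class PoissonAlgebra (K A : Type*) [Field K] [Ring A] [Algebra K A] where
  /-- The Lie bracket `{a, b}`. -/
  bracket : A →ₗ[K] A →ₗ[K] A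
  bracket_self : ∀ a, bracket a a = 0
  jacobi : ∀ a b c,
    bracket a (bracket b c) + bracket b (bracket c a) + bracket c (bracket a b) = 0
  leibniz : ∀ a b c, bracket (a * b) c = a * bracket b c + bracket a c * b

/-- A quasi-Poisson module structure on the `K`-central `A`-bimodule `M`; the right action of
`b` on `m` is written `op b • m`. -/
class QuasiPoissonModule (K A M : Type*) [Field K] [Ring A] [Algebra K A] [PoissonAlgebra K A]
    [AddCommGroup M] [Module K M] [Module A M] [Module Aᵐᵒᵖ M] [SMulCommClass A Aᵐᵒᵖ M]
    [IsScalarTower K A M] [IsScalarTower K Aᵐᵒᵖ M] where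
  /-- The Lie action `{a, m}_*`. -/
  act : A →ₗ[K] M →ₗ[K] M
  act_bracket : ∀ (a b : A) (m : M),
    act (PoissonAlgebra.bracket (K := K) a b) m = act a (act b m) - act b (act a m)
  act_smul : ∀ (a b : A) (m : M),
    act a (b • m) = PoissonAlgebra.bracket (K := K) a b • m + b • act a m
  act_op_smul : ∀ (a b : A) (m : M),
    act a (op b • m) = op (PoissonAlgebra.bracket (K := K) a b) • m + op b • act a m

/-- A Poisson module: a quasi-Poisson module with `{ab, m}_* = a {b, m}_* + {a, m}_* b`. -/
class PoissonModule (K A M : Type*) [Field K] [Ring A] [Algebra K A] [PoissonAlgebra K A]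
    [AddCommGroup M] [Module K M] [Module A M] [Module Aᵐᵒᵖ M] [SMulCommClass A Aᵐᵒᵖ M]
    [IsScalarTower K A M] [IsScalarTower K Aᵐᵒᵖ M] extends QuasiPoissonModule K A M where
  mul_act : ∀ (a b : A) (m : M), act (a * b) m = a • act b m + op b • act a m

/-- The Lie algebra `(A, {-,-})` underlying the Poisson algebra `A`. -/
def PoissonLie (_K A : Type*) : Type _ := A

variable {K A : Type*} [Field K] [Ring A] [Algebra K A]

instance : AddCommGroup (PoissonLie K A) := inferInstanceAs (AddCommGroup A)

instance : Module K (PoissonLie K A) := inferInstanceAs (Module K A)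

variable (K) in
/-- The identity map from `A` to its underlying Lie algebra. -/
def toLie : A ≃ₗ[K] PoissonLie K A := LinearEquiv.refl K A

variable [PoissonAlgebra K A]

theorem bracket_skew (a b : A) :
    PoissonAlgebra.bracket (K := K) a b = - PoissonAlgebra.bracket (K := K) b a := by
  have h := PoissonAlgebra.bracket_self (K := K) (a + b)
  simp only [map_add, LinearMap.add_apply, PoissonAlgebra.bracket_self, zero_add, add_zero] at h
  rw [add_comm] at h
  exact eq_neg_of_add_eq_zero_left h

theorem bracket_mul (x a b : A) :
    PoissonAlgebra.bracket (K := K) x (a * b) =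
      PoissonAlgebra.bracket (K := K) x a * b + a * PoissonAlgebra.bracket (K := K) x b := by
  rw [bracket_skew, PoissonAlgebra.leibniz, bracket_skew b x, bracket_skew a x]
  noncomm_ring

theorem bracket_bracket (x y z : A) :
    PoissonAlgebra.bracket (K := K) (PoissonAlgebra.bracket (K := K) x y) z =
      PoissonAlgebra.bracket (K := K) x (PoissonAlgebra.bracket (K := K) y z) -
        PoissonAlgebra.bracket (K := K) y (PoissonAlgebra.bracket (K := K) x z) := by
  have h := PoissonAlgebra.jacobi (K := K) x y z
  rw [bracket_skew (PoissonAlgebra.bracket (K := K) x y) z, bracket_skew x z, map_neg]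
  rw [← sub_eq_zero, ← neg_eq_zero, ← h]
  abel

instance : LieRing (PoissonLie K A) where
  __ := (inferInstance : AddCommGroup (PoissonLie K A))
  bracket x y := toLie K (PoissonAlgebra.bracket (K := K) ((toLie K).symm x) ((toLie K).symm y))
  add_lie x y z := by simp
  lie_add x y z := by simp
  lie_self x := by
    rw [PoissonAlgebra.bracket_self, map_zero]
  leibniz_lie x y z := by
    change toLie K (PoissonAlgebra.bracket (K := K) _ (PoissonAlgebra.bracket (K := K) _ _)) =
      toLie K (PoissonAlgebra.bracket (K := K) (PoissonAlgebra.bracket (K := K) _ _) _) +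
        toLie K (PoissonAlgebra.bracket (K := K) _ (PoissonAlgebra.bracket (K := K) _ _))
    rw [bracket_bracket, map_sub]
    abel

theorem lie_toLie (a b : A) :
    ⁅toLie K a, toLie K b⁆ = toLie K (PoissonAlgebra.bracket (K := K) a b) := rfl

instance : LieAlgebra K (PoissonLie K A) where
  lie_smul c x y := by
    change toLie K (PoissonAlgebra.bracket (K := K) _ _) = c • toLie K (PoissonAlgebra.bracket (K := K) _ _)
    simp

/-- The adjoint action of the Lie algebra on `A`. -/
instance : LieRingModule (PoissonLie K A) A where
  bracket x a := PoissonAlgebra.bracket (K := K) ((toLie K).symm x) a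
  add_lie x y a := by simp
  lie_add x a b := by simp
  leibniz_lie x y a := by
    change PoissonAlgebra.bracket (K := K) _ (PoissonAlgebra.bracket (K := K) _ _) =
      PoissonAlgebra.bracket (K := K) (PoissonAlgebra.bracket (K := K) _ _) _ +
        PoissonAlgebra.bracket (K := K) _ (PoissonAlgebra.bracket (K := K) _ _)
    rw [bracket_bracket]
    abel

theorem lie_alg (x : PoissonLie K A) (a : A) :
    ⁅x, a⁆ = PoissonAlgebra.bracket (K := K) ((toLie K).symm x) a := rfl

instance : LieModule K (PoissonLie K A) A where
  smul_lie c x a := by simp [lie_alg]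
  lie_smul c x a := by simp [lie_alg]

theorem lie_alg_mul (x : PoissonLie K A) (a b : A) : ⁅x, a * b⁆ = ⁅x, a⁆ * b + a * ⁅x, b⁆ :=
  bracket_mul _ _ _

instance : LieRingModule (PoissonLie K A) Aᵐᵒᵖ where
  bracket x a := op ⁅x, unop a⁆
  add_lie x y a := by simp
  lie_add x a b := by simp
  leibniz_lie x y a := by simp

theorem lie_op (x : PoissonLie K A) (a : A) : ⁅x, op a⁆ = op ⁅x, a⁆ := rfl

instance : LieModule K (PoissonLie K A) Aᵐᵒᵖ where
  smul_lie c x a := by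
    induction a using MulOpposite.rec' with
    | _ a => rw [lie_op, lie_op, smul_lie, op_smul]
  lie_smul c x a := by
    induction a using MulOpposite.rec' with
    | _ a => rw [← op_smul, lie_op, lie_op, lie_smul, op_smul]

variable {M : Type*} [AddCommGroup M] [Module K M] [Module A M] [Module Aᵐᵒᵖ M]
  [SMulCommClass A Aᵐᵒᵖ M] [IsScalarTower K A M] [IsScalarTower K Aᵐᵒᵖ M]

section Quasi

variable [QuasiPoissonModule K A M]

/-- The Lie module underlying a quasi-Poisson module. -/
instance : LieRingModule (PoissonLie K A) M where
  bracket x m := QuasiPoissonModule.act (K := K) ((toLie K).symm x) m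
  add_lie x y m := by simp
  lie_add x m n := by simp
  leibniz_lie x y m := by
    change QuasiPoissonModule.act (K := K) _ (QuasiPoissonModule.act (K := K) _ m) =
      QuasiPoissonModule.act (K := K) (PoissonAlgebra.bracket (K := K) _ _) m +
        QuasiPoissonModule.act (K := K) _ (QuasiPoissonModule.act (K := K) _ m)
    rw [QuasiPoissonModule.act_bracket]
    abel

theorem lie_mod (x : PoissonLie K A) (m : M) :
    ⁅x, m⁆ = QuasiPoissonModule.act (K := K) ((toLie K).symm x) m := rfl

instance : LieModule K (PoissonLie K A) M where
  smul_lie c x m := by simp [lie_mod]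
  lie_smul c x m := by simp [lie_mod]

theorem lie_mod_smul (x : PoissonLie K A) (a : A) (m : M) :
    ⁅x, a • m⁆ = ⁅x, a⁆ • m + a • ⁅x, m⁆ :=
  QuasiPoissonModule.act_smul (K := K) _ _ _

theorem lie_mod_op_smul (x : PoissonLie K A) (a : A) (m : M) :
    ⁅x, op a • m⁆ = op ⁅x, a⁆ • m + op a • ⁅x, m⁆ :=
  QuasiPoissonModule.act_op_smul (K := K) _ _ _

end Quasi

end Poisson

section Hochschild

variable {K A M : Type*} [Field K] [Ring A] [Algebra K A]
  [AddCommGroup M] [Module K M] [Module A M] [Module Aᵐᵒᵖ M]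
  [SMulCommClass A Aᵐᵒᵖ M] [IsScalarTower K A M] [IsScalarTower K Aᵐᵒᵖ M]

/-- `(R_a f)(v₀, v₁, …) = f(a v₀, v₁, …)`, and `R_a m = m a` in degree zero. -/
def hochR : (n : ℕ) → A →ₗ[K] MultilinearMap K (fun _ : Fin n => A) M →ₗ[K]
    MultilinearMap K (fun _ : Fin n => A) M
  | 0 => LinearMap.mk₂ K
      (fun a f => (Algebra.lsmul K K M (op a)).compMultilinearMap f)
      (by intro a b f; ext v; simp [add_smul])
      (by intro c a f; ext v; simp)
      (by intro a f g; ext v; simp)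
      (by intro c a f; ext v; exact smul_comm (op a) c (f v))
  | n + 1 => LinearMap.mk₂ K
      (fun a f => LinearMap.uncurryLeft (M := fun _ => A)
        ((f.curryLeft : A →ₗ[K] _) ∘ₗ LinearMap.mulLeft K a))
      (by intro a b f; apply multilinear_ext_curryLeft; intro e
          ext v; simp [add_mul])
      (by intro c a f; apply multilinear_ext_curryLeft; intro e
          ext v; simp)
      (by intro a f g; ext v; simp)
      (by intro c a f; ext v; simp)

theorem hochR_curryLeft (n : ℕ) (a e : A) (f : MultilinearMap K (fun _ : Fin (n + 1) => A) M) :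
    (hochR (n + 1) a f).curryLeft e = f.curryLeft (a * e) := rfl

theorem hochR_zero_apply (a : A) (f : MultilinearMap K (fun _ : Fin 0 => A) M) (v : Fin 0 → A) :
    hochR 0 a f v = op a • f v := rfl

/-- The Hochschild coboundary without its first term. -/
def hochT : (n : ℕ) → MultilinearMap K (fun _ : Fin n => A) M →ₗ[K]
    MultilinearMap K (fun _ : Fin (n + 1) => A) M
  | 0 =>
    { toFun := fun f => LinearMap.uncurryLeft (M := fun _ => A) (-(hochR 0).flip f)
      map_add' := fun f g => by ext v; simp; abel
      map_smul' := fun c f => by ext v; simp }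
  | n + 1 =>
    { toFun := fun f => LinearMap.uncurryLeft (M := fun _ => A)
        (-(hochR (n + 1)).flip f - hochT n ∘ₗ f.curryLeft)
      map_add' := fun f g => by
        have h : ∀ a : A, (f + g).curryLeft a = f.curryLeft a + g.curryLeft a := fun _ => rfl
        ext v; simp [h]; abel
      map_smul' := fun c f => by
        have h : ∀ a : A, (c • f).curryLeft a = c • f.curryLeft a := fun _ => rfl
        ext v; simp [h, smul_sub] }

theorem hochT_zero_curryLeft (f : MultilinearMap K (fun _ : Fin 0 => A) M) (a : A) :
    (hochT 0 f).curryLeft a = -hochR 0 a f := rfl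

theorem hochT_succ_curryLeft (n : ℕ) (f : MultilinearMap K (fun _ : Fin (n + 1) => A) M) (a : A) :
    (hochT (n + 1) f).curryLeft a = -hochR (n + 1) a f - hochT n (f.curryLeft a) := rfl

/-- `(l f)(v₀, v₁, …) = v₀ f(v₁, …)`. -/
def hochL (n : ℕ) : MultilinearMap K (fun _ : Fin n => A) M →ₗ[K]
    MultilinearMap K (fun _ : Fin (n + 1) => A) M where
  toFun f := LinearMap.uncurryLeft (M := fun _ => A)
    { toFun := fun a => (Algebra.lsmul K K M a).compMultilinearMap f
      map_add' := fun a b => by ext v; simp [add_smul]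
      map_smul' := fun c a => by ext v; simp }
  map_add' f g := by ext v; simp
  map_smul' c f := by ext v; exact smul_comm (v 0) c (f (Fin.tail v))

theorem hochL_curryLeft (n : ℕ) (f : MultilinearMap K (fun _ : Fin n => A) M) (a : A) :
    (hochL n f).curryLeft a = (Algebra.lsmul K K M a).compMultilinearMap f := rfl

theorem hoch_apply_aux (n : ℕ) (f : MultilinearMap K (fun _ : Fin n => A) M)
    (a : Fin (n + 1) → A) :
    (hochL n f + hochT n f) a = a 0 • f (Fin.tail a) +
      ∑ k : Fin n, (-1 : ℤ) ^ ((k : ℕ) + 1) • f (Fin.contractNth k.castSucc (· * ·) a) +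
      (-1 : ℤ) ^ (n + 1) • op (a (Fin.last n)) • f (Fin.init a) := by
  have hT : hochT n f a =
      ∑ k : Fin n, (-1 : ℤ) ^ ((k : ℕ) + 1) • f (Fin.contractNth k.castSucc (· * ·) a) +
      (-1 : ℤ) ^ (n + 1) • op (a (Fin.last n)) • f (Fin.init a) := by
    induction n with
    | zero =>
      change -(op (a 0) • f (Fin.tail a)) = _
      rw [Subsingleton.elim (Fin.tail a) (Fin.init a)]
      simp
    | succ n ih =>
      rw [← Fin.cons_self_tail a]
      generalize a 0 = y
      generalize Fin.tail a = v
      change -(f (Fin.cons (α := fun _ => A) (y * v 0) (Fin.tail v))) - hochT n (f.curryLeft y) v = _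
      rw [ih, Fin.sum_univ_succ]
      have h0 : Fin.contractNth (Fin.castSucc (0 : Fin (n + 1))) (· * ·)
          (Fin.cons y v : Fin (n + 2) → A) = Fin.cons (α := fun _ => A) (y * v 0) (Fin.tail v) := by
        funext k
        refine Fin.cases ?_ (fun k => ?_) k <;> simp [Fin.contractNth, Fin.tail]
      have h1 : ∀ k : Fin n, Fin.contractNth (Fin.castSucc k.succ) (· * ·)
          (Fin.cons y v : Fin (n + 2) → A) =
            Fin.cons (α := fun _ => A) y (Fin.contractNth k.castSucc (· * ·) v) := by
        intro k
        funext j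
        refine Fin.cases ?_ (fun j => ?_) j <;> simp [Fin.contractNth, ← Fin.succ_castSucc]
      have h2 : Fin.init (Fin.cons y v : Fin (n + 2) → A) =
          Fin.cons (α := fun _ => A) y (Fin.init v) := by
        funext j
        refine Fin.cases ?_ (fun j => ?_) j <;> simp [Fin.init, ← Fin.succ_castSucc]
      have h3 : (Fin.cons y v : Fin (n + 2) → A) (Fin.last (n + 1)) = v (Fin.last n) := by
        rw [← Fin.succ_last, Fin.cons_succ]
      simp only [h0, h1, h2, h3, MultilinearMap.curryLeft_apply, Fin.val_succ, pow_succ,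
        Fin.val_zero, pow_zero, mul_neg, mul_one, one_smul, neg_smul, neg_neg,
        Finset.sum_neg_distrib]
      abel
  have hL : hochL n f a = a 0 • f (Fin.tail a) := rfl
  rw [add_apply, hT, hL, add_assoc]

/-- The Hochschild coboundary
`(b f)(a₀, …, a_n) = a₀ f(a₁, …, a_n) + ∑ k, (-1)^(k+1) f(a₀, …, a_k a_{k+1}, …, a_n)
  + (-1)^(n+1) f(a₀, …, a_{n-1}) a_n`. -/
def hochD (n : ℕ) : MultilinearMap K (fun _ : Fin n => A) M →ₗ[K]
    MultilinearMap K (fun _ : Fin (n + 1) => A) M where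
  toFun f :=
    { toFun := fun a => a 0 • f (Fin.tail a) +
        ∑ k : Fin n, (-1 : ℤ) ^ ((k : ℕ) + 1) • f (Fin.contractNth k.castSucc (· * ·) a) +
        (-1 : ℤ) ^ (n + 1) • op (a (Fin.last n)) • f (Fin.init a)
      map_update_add' := by
        intro _ m i x y
        simp only [← hoch_apply_aux]
        exact (hochL n f + hochT n f).map_update_add m i x y
      map_update_smul' := by
        intro _ m i c x
        simp only [← hoch_apply_aux]
        exact (hochL n f + hochT n f).map_update_smul m i c x }
  map_add' f g := by
    ext a
    exact (hoch_apply_aux n (f + g) a).symm.trans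
      ((congrArg (fun F => F a) (map_add (hochL n + hochT n) f g)).trans
        (congrArg₂ (· + ·) (hoch_apply_aux n f a) (hoch_apply_aux n g a)))
  map_smul' c f := by
    ext a
    exact (hoch_apply_aux n (c • f) a).symm.trans
      ((congrArg (fun F => F a) (map_smul (hochL n + hochT n) c f)).trans
        (congrArg (c • ·) (hoch_apply_aux n f a)))

theorem hochD_eq (n : ℕ) (f : MultilinearMap K (fun _ : Fin n => A) M) :
    hochD n f = hochL n f + hochT n f := by
  ext a
  exact (hoch_apply_aux n f a).symm

theorem hochR_hochR (n : ℕ) (a c : A) (f : MultilinearMap K (fun _ : Fin n => A) M) :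
    hochR n c (hochR n a f) = hochR n (a * c) f := by
  cases n with
  | zero => ext v; simp [hochR_zero_apply, mul_smul]
  | succ n =>
    apply multilinear_ext_curryLeft
    intro e
    rw [hochR_curryLeft, hochR_curryLeft, hochR_curryLeft, mul_assoc]

theorem hochT_hochR (n : ℕ) (a : A) (f : MultilinearMap K (fun _ : Fin n => A) M) :
    hochT n (hochR n a f) = hochR (n + 1) a (hochT n f) := by
  cases n with
  | zero =>
    apply multilinear_ext_curryLeft
    intro e
    rw [hochT_zero_curryLeft, hochR_curryLeft, hochT_zero_curryLeft, hochR_hochR]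
  | succ n =>
    apply multilinear_ext_curryLeft
    intro e
    rw [hochT_succ_curryLeft, hochR_curryLeft, hochR_curryLeft, hochT_succ_curryLeft, hochR_hochR]

theorem hochT_hochT (n : ℕ) (f : MultilinearMap K (fun _ : Fin n => A) M) :
    hochT (n + 1) (hochT n f) = 0 := by
  induction n with
  | zero =>
    apply multilinear_ext_curryLeft
    intro e
    rw [hochT_succ_curryLeft, hochT_zero_curryLeft, map_neg, hochT_hochR]
    simp
    rfl
  | succ n ih =>
    apply multilinear_ext_curryLeft
    intro e
    rw [hochT_succ_curryLeft, hochT_succ_curryLeft, map_sub, map_neg, hochT_hochR, ih]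
    simp
    rfl

theorem hochR_lsmul (n : ℕ) (a c : A) (f : MultilinearMap K (fun _ : Fin n => A) M) :
    hochR n c ((Algebra.lsmul K K M a).compMultilinearMap f) =
      (Algebra.lsmul K K M a).compMultilinearMap (hochR n c f) := by
  cases n with
  | zero => ext v; exact (smul_comm a (op c) (f v)).symm
  | succ n => rfl

theorem hochT_lsmul (n : ℕ) (a : A) (f : MultilinearMap K (fun _ : Fin n => A) M) :
    hochT n ((Algebra.lsmul K K M a).compMultilinearMap f) =
      (Algebra.lsmul K K M a).compMultilinearMap (hochT n f) := by
  have hc : ∀ (m : ℕ) (g : MultilinearMap K (fun _ : Fin (m + 1) => A) M) (e : A),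
      ((Algebra.lsmul K K M a).compMultilinearMap g).curryLeft e =
        (Algebra.lsmul K K M a).compMultilinearMap (g.curryLeft e) := fun _ _ _ => rfl
  induction n with
  | zero =>
    apply multilinear_ext_curryLeft
    intro e
    rw [hc, hochT_zero_curryLeft, hochT_zero_curryLeft, hochR_lsmul]
    ext v; simp
  | succ n ih =>
    apply multilinear_ext_curryLeft
    intro e
    rw [hc, hochT_succ_curryLeft, hochT_succ_curryLeft, hochR_lsmul, hc, ih]
    ext v; simp [smul_sub]

theorem hochD_hochD (n : ℕ) (f : MultilinearMap K (fun _ : Fin n => A) M) :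
    hochD (n + 1) (hochD n f) = 0 := by
  rw [hochD_eq, hochD_eq, map_add, map_add, hochT_hochT, add_zero]
  apply multilinear_ext_curryLeft
  intro a
  have hadd : ∀ (g h : MultilinearMap K (fun _ : Fin (n + 2) => A) M),
      (g + h).curryLeft a = g.curryLeft a + h.curryLeft a := fun _ _ => rfl
  rw [hadd, hadd, hochL_curryLeft, hochL_curryLeft, hochT_succ_curryLeft, hochL_curryLeft,
    hochT_lsmul]
  apply multilinear_ext_curryLeft
  intro e
  ext v
  have h1 : hochR (n + 1) a (hochL n f) (Fin.cons e v) = (a * e) • f v := rfl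
  have h2 : hochL n f (Fin.cons e v) = e • f v := rfl
  have h3 : (0 : MultilinearMap K (fun _ : Fin (n + 2) => A) M) (Fin.cons a (Fin.cons e v)) = 0 := rfl
  simp [h1, h2, h3, mul_smul]

variable [PoissonAlgebra K A] [QuasiPoissonModule K A M]

theorem lie_curryLeft (n : ℕ) (x : PoissonLie K A)
    (f : MultilinearMap K (fun _ : Fin (n + 1) => A) M) (a : A) :
    (⁅x, f⁆ : MultilinearMap K (fun _ : Fin (n + 1) => A) M).curryLeft a =
      ⁅x, f.curryLeft a⁆ - f.curryLeft ⁅x, a⁆ :=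
  multilinearLie_curryLeft n x f a

theorem lie_hochR (n : ℕ) (x : PoissonLie K A) (c : A)
    (f : MultilinearMap K (fun _ : Fin n => A) M) :
    ⁅x, hochR n c f⁆ = hochR n c ⁅x, f⁆ + hochR n ⁅x, c⁆ f := by
  cases n with
  | zero =>
    ext v
    simp [lie_multilinear, multilinearLie_apply, hochR_zero_apply, lie_mod_op_smul, add_comm]
  | succ n =>
    apply multilinear_ext_curryLeft
    intro e
    have hadd : ∀ (g h : MultilinearMap K (fun _ : Fin (n + 1) => A) M),
      (g + h).curryLeft e = g.curryLeft e + h.curryLeft e := fun _ _ => rfl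
    rw [hadd, lie_curryLeft, hochR_curryLeft, hochR_curryLeft, hochR_curryLeft, hochR_curryLeft,
      lie_curryLeft, lie_alg_mul, map_add]
    abel

theorem lie_hochT (n : ℕ) (x : PoissonLie K A) (f : MultilinearMap K (fun _ : Fin n => A) M) :
    hochT n ⁅x, f⁆ = ⁅x, hochT n f⁆ := by
  induction n with
  | zero =>
    apply multilinear_ext_curryLeft
    intro e
    rw [lie_curryLeft, hochT_zero_curryLeft, hochT_zero_curryLeft, hochT_zero_curryLeft, lie_neg,
      lie_hochR]
    abel
  | succ n ih =>
    apply multilinear_ext_curryLeft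
    intro e
    rw [lie_curryLeft, hochT_succ_curryLeft, hochT_succ_curryLeft, hochT_succ_curryLeft, lie_sub,
      lie_neg, lie_hochR, lie_curryLeft, map_sub, ih]
    abel

theorem lie_hochL (n : ℕ) (x : PoissonLie K A) (f : MultilinearMap K (fun _ : Fin n => A) M) :
    hochL n ⁅x, f⁆ = ⁅x, hochL n f⁆ := by
  apply multilinear_ext_curryLeft
  intro e
  rw [lie_curryLeft, hochL_curryLeft, hochL_curryLeft, hochL_curryLeft]
  ext v
  simp [lie_multilinear, multilinearLie_apply, lie_mod_smul, smul_sub, Finset.smul_sum]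
  abel

/-- The Hochschild coboundary is a map of Lie modules. -/
theorem lie_hochD (n : ℕ) (x : PoissonLie K A) (f : MultilinearMap K (fun _ : Fin n => A) M) :
    hochD n ⁅x, f⁆ = ⁅x, hochD n f⁆ := by
  rw [hochD_eq, hochD_eq, lie_add, lie_hochL, lie_hochT]

end Hochschild

section Cochains

variable (K A M : Type*) [Field K] [Ring A] [Algebra K A] [PoissonAlgebra K A]
  [AddCommGroup M] [Module K M] [Module A M] [Module Aᵐᵒᵖ M]
  [SMulCommClass A Aᵐᵒᵖ M] [IsScalarTower K A M] [IsScalarTower K Aᵐᵒᵖ M]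

/-- `Hom(⋀^n, M)`. -/
abbrev LieCochain (n : ℕ) : Type _ := (PoissonLie K A) [⋀^Fin n]→ₗ[K] M

/-- `Hom(A^i ⊗ ⋀^j, M)`, written as `Hom(⋀^j, Hom(A^i, M))`. -/
abbrev BiCochain (i j : ℕ) : Type _ :=
  (PoissonLie K A) [⋀^Fin j]→ₗ[K] MultilinearMap K (fun _ : Fin i => A) M

/-- `⊕ Hom(A^(i+2) ⊗ ⋀^j, M)` over `i, j ≥ 0` with `(i + 2) + j = n`. -/
abbrev TailCochain (n : ℕ) : Type _ :=
  ∀ p : {p : ℕ × ℕ // p.1 + 2 + p.2 = n}, BiCochain K A M (p.1.1 + 2) p.1.2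

/-- `⊕ Hom(A^i ⊗ ⋀^j, M)` over `i + j = n`, `i ≠ 1`, the summand `i = 0` written first. -/
abbrev PoissonCochain (n : ℕ) : Type _ := LieCochain K A M n × TailCochain K A M n

variable {K A M}

/-- The Hochschild coboundary `Hom(A^i ⊗ ⋀^j, M) → Hom(A^(i+1) ⊗ ⋀^j, M)`. -/
def vertD (i j : ℕ) : BiCochain K A M i j →ₗ[K] BiCochain K A M (i + 1) j :=
  LinearMap.compAlternatingMapₗ K (hochD i)

/-- The natural embedding `Hom(⋀^(j+1), M) → Hom(A ⊗ ⋀^j, M)`, `f ↦ (a ⊗ ω ↦ f(a ∧ ω))`. -/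
def wedgeEmb (j : ℕ) : LieCochain K A M (j + 1) →ₗ[K] BiCochain K A M 1 j where
  toFun f :=
    { toFun := fun w =>
        { toFun := fun a => f (Matrix.vecCons (toLie K (a 0)) w)
          map_update_add' := by
            intro _ a i x y
            obtain rfl := Subsingleton.elim i 0
            simp only [Function.update_self, map_add]
            exact f.map_vecCons_add w _ _
          map_update_smul' := by
            intro _ a i c x
            obtain rfl := Subsingleton.elim i 0
            simp only [Function.update_self, map_smul]
            exact f.map_vecCons_smul w _ _ }
      map_update_add' := by
        intro _ w i x y
        ext a
        exact (f.curryLeft (toLie K (a 0))).map_update_add w i x y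
      map_update_smul' := by
        intro _ w i c x
        ext a
        exact (f.curryLeft (toLie K (a 0))).map_update_smul w i c x
      map_eq_zero_of_eq' := by
        intro w i k hw hik
        ext a
        exact (f.curryLeft (toLie K (a 0))).map_eq_zero_of_eq w hw hik }
  map_add' f g := rfl
  map_smul' c f := rfl

/-- The composition `Hom(⋀^(j+1), M) → Hom(A ⊗ ⋀^j, M) → Hom(A^2 ⊗ ⋀^j, M)`. -/
def bottomD (j : ℕ) : LieCochain K A M (j + 1) →ₗ[K] BiCochain K A M 2 j :=
  vertD 1 j ∘ₗ wedgeEmb j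

theorem vertD_apply (i j : ℕ) (f : BiCochain K A M i j) (w : Fin j → PoissonLie K A) :
    vertD i j f w = hochD i (f w) := rfl

theorem wedgeEmb_apply (j : ℕ) (f : LieCochain K A M (j + 1)) (w : Fin j → PoissonLie K A)
    (a : Fin 1 → A) : wedgeEmb j f w a = f (Matrix.vecCons (toLie K (a 0)) w) := rfl

/-- `(δ_v f)(a ⊗ b ⊗ ω) = a f(b ∧ ω) - f(ab ∧ ω) + f(a ∧ ω) b`. -/
theorem bottomD_apply (j : ℕ) (f : LieCochain K A M (j + 1)) (w : Fin j → PoissonLie K A)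
    (a b : A) : bottomD j f w ![a, b] =
      a • f (Matrix.vecCons (toLie K b) w) - f (Matrix.vecCons (toLie K (a * b)) w) +
        op b • f (Matrix.vecCons (toLie K a) w) := by
  change hochD 1 (wedgeEmb j f w) ![a, b] = _
  simp [hochD, wedgeEmb_apply, Fin.contractNth, Fin.tail, Fin.init, sub_eq_add_neg]

theorem vertD_vertD (i j : ℕ) (f : BiCochain K A M i j) : vertD (i + 1) j (vertD i j f) = 0 := by
  ext w : 1
  exact hochD_hochD i (f w)

theorem vertD_bottomD (j : ℕ) (f : LieCochain K A M (j + 1)) :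
    vertD 2 j (bottomD j f) = 0 := vertD_vertD 1 j _

section Quasi

variable [QuasiPoissonModule K A M]

theorem ceD_vertD (i j : ℕ) (f : BiCochain K A M i j) :
    ceD j (vertD i j f) = vertD i (j + 1) (ceD j f) :=
  ceD_comp j (hochD i) (fun x m => lie_hochD i x m) f

theorem ceD_wedgeEmb (j : ℕ) (f : LieCochain K A M (j + 1)) (w : Fin (j + 1) → PoissonLie K A)
    (a : Fin 1 → A) :
    ceD j (wedgeEmb j f) w a + wedgeEmb (j + 1) (ceD (j + 1) f) w a = ⁅toLie K (a 0), f w⁆ := by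
  have h1 : wedgeEmb (j + 1) (ceD (j + 1) f) w a =
      (ceD (j + 1) f).curryLeft (toLie K (a 0)) w := rfl
  have hb : ∀ (x : PoissonLie K A) (u : Fin j → PoissonLie K A),
      (⁅x, wedgeEmb j f u⁆ : MultilinearMap K (fun _ : Fin 1 => A) M) a =
        ⁅x, f.curryLeft (toLie K (a 0)) u⁆ + f (Matrix.vecCons ⁅toLie K (a 0), x⁆ u) := by
    intro x u
    have e : toLie K ⁅x, a 0⁆ = -⁅toLie K (a 0), x⁆ := by
      rw [lie_skew]; rfl
    have e2 : f (Matrix.vecCons (-⁅toLie K (a 0), x⁆) u) =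
        -f (Matrix.vecCons ⁅toLie K (a 0), x⁆ u) := by
      have := congrArg (fun F => F u) (map_neg f.curryLeft ⁅toLie K (a 0), x⁆)
      exact this
    rw [lie_multilinear, multilinearLie_apply]
    simp only [Finset.univ_unique, Fin.default_eq_zero, Finset.sum_singleton, wedgeEmb_apply,
      Function.update_self, e, e2, sub_neg_eq_add]
    rfl
  have hc : ceD j (wedgeEmb j f) w a = ceD j (f.curryLeft (toLie K (a 0))) w +
      ∑ i : Fin (j + 1), f (Function.update w i ⁅toLie K (a 0), w i⁆) := by
    have hi : ∀ i : Fin (j + 1), f (Function.update w i ⁅toLie K (a 0), w i⁆) =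
        (-1 : ℤ) ^ (i : ℕ) • f (Matrix.vecCons ⁅toLie K (a 0), w i⁆ (i.removeNth w)) := by
      intro i
      rw [← Fin.insertNth_removeNth, AlternatingMap.map_insertNth]
    simp only [hi]
    simp only [ceD, LinearMap.coe_mk, AddHom.coe_mk, AlternatingMap.coe_mk, MultilinearMap.coe_mk,
      add_apply, sum_apply, MultilinearMap.smul_apply, hb, smul_add, Finset.sum_add_distrib]
    have h3 : (∑ p : Fin (j + 1), ∑ q : Fin (j + 1), (if p < q then (-1 : ℤ) ^ ((p : ℕ) + 1) •
        wedgeEmb j f (p.removeNth (Function.update w q ⁅w p, w q⁆)) else 0) a) =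
        ∑ p : Fin (j + 1), ∑ q : Fin (j + 1), if p < q then (-1 : ℤ) ^ ((p : ℕ) + 1) •
        f.curryLeft (toLie K (a 0)) (p.removeNth (Function.update w q ⁅w p, w q⁆)) else 0 := by
      refine Finset.sum_congr rfl fun p _ => Finset.sum_congr rfl fun q _ => ?_
      split_ifs <;> rfl
    rw [h3]
    abel
  rw [h1, hc, ceD_succ_curryLeft]
  change _ + (lieDer (j + 1) (toLie K (a 0)) f w - ceD j (f.curryLeft (toLie K (a 0))) w) = _
  rw [lieDer_apply]
  abel

end Quasi

section Poiss

variable [PoissonModule K A M]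

theorem hochD_one_eq_zero (m : M) (g : MultilinearMap K (fun _ : Fin 1 => A) M)
    (hg : ∀ a, g a = ⁅toLie K (a 0), m⁆) : hochD 1 g = 0 := by
  ext a
  have h : ⁅toLie K (a 0 * a 1), m⁆ =
      a 0 • ⁅toLie K (a 1), m⁆ + op (a 1) • ⁅toLie K (a 0), m⁆ :=
    PoissonModule.mul_act (K := K) (a 0) (a 1) m
  simp [hochD, hg, Fin.contractNth, Fin.tail, Fin.init, h]

theorem ceD_bottomD (j : ℕ) (f : LieCochain K A M (j + 1)) :
    ceD j (bottomD j f) + bottomD (j + 1) (ceD (j + 1) f) = 0 := by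
  change ceD j (vertD 1 j (wedgeEmb j f)) + vertD 1 (j + 1) (wedgeEmb (j + 1) _) = 0
  rw [ceD_vertD, ← map_add]
  ext w : 1
  exact hochD_one_eq_zero (f w) _ (fun a => ceD_wedgeEmb j f w a)

theorem bottomD_ceD_zero (f : LieCochain K A M 0) : bottomD 0 (ceD 0 f) = 0 := by
  ext w : 1
  refine hochD_one_eq_zero (f w) _ (fun a => ?_)
  have h1 : wedgeEmb 0 (ceD 0 f) w a = (ceD 0 f).curryLeft (toLie K (a 0)) w := rfl
  refine h1.trans ?_
  rw [ceD_zero_curryLeft, lieDer_apply]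
  simp

end Poiss

section Totals

/-- The Hochschild part of the coboundary on `TailCochain`. -/
def tailVert (n : ℕ) (f : TailCochain K A M n) :
    (i j : ℕ) → i + 2 + j = n + 1 → BiCochain K A M (i + 2) j
  | 0, _, _ => 0
  | i + 1, j, h => vertD (i + 2) j (f ⟨(i, j), by omega⟩)

section Quasi

variable [QuasiPoissonModule K A M]

/-- The Chevalley-Eilenberg part of the coboundary on `TailCochain`, with the sign `(-1)^i`
on `Hom(A^i ⊗ ⋀^j, M)` that makes the total coboundary square to zero. -/
def tailHoriz (n : ℕ) (f : TailCochain K A M n) :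
    (i j : ℕ) → i + 2 + j = n + 1 → BiCochain K A M (i + 2) j
  | _, 0, _ => 0
  | i, j + 1, h => (-1 : ℤ) ^ (i + 2) • ceD j (f ⟨(i, j), by omega⟩)

/-- The coboundary of the total complex on `TailCochain`. -/
def tailD (n : ℕ) : TailCochain K A M n →ₗ[K] TailCochain K A M (n + 1) where
  toFun f := fun p => tailVert n f p.1.1 p.1.2 p.2 + tailHoriz n f p.1.1 p.1.2 p.2
  map_add' f g := by
    funext ⟨⟨i, j⟩, h⟩
    cases i <;> cases j <;> simp [tailVert, tailHoriz] <;> abel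
  map_smul' c f := by
    funext ⟨⟨i, j⟩, h⟩
    cases i <;> cases j <;> simp [tailVert, tailHoriz, smul_comm c]

theorem tailD_tailD (n : ℕ) (f : TailCochain K A M n) : tailD (n + 1) (tailD n f) = 0 := by
  funext ⟨⟨i, j⟩, h⟩
  change tailVert (n + 1) (tailD n f) i j h + tailHoriz (n + 1) (tailD n f) i j h = 0
  rcases i with _ | i <;> rcases j with _ | j
  · simp [tailVert, tailHoriz]
  · rcases j with _ | j <;> simp [tailVert, tailHoriz, tailD, ceD_ceD]
  · rcases i with _ | i <;> simp [tailVert, tailHoriz, tailD, vertD_vertD]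
  · rcases i with _ | i <;> rcases j with _ | j <;>
      simp [tailVert, tailHoriz, tailD, vertD_vertD, ceD_ceD, ceD_vertD, pow_succ]

/-- The part `Hom(⋀^n, M) → Hom(A^2 ⊗ ⋀^(n-1), M)` of the coboundary of the Poisson complex. -/
def bottomComp (n : ℕ) (c : LieCochain K A M n) :
    (i j : ℕ) → i + 2 + j = n + 1 → BiCochain K A M (i + 2) j
  | 0, j, h => bottomD j (c.domDomCongr (finCongr (by omega : n = j + 1)))
  | _ + 1, _, _ => 0

/-- The components of `bottomComp`, assembled. -/
def bottomTotal (n : ℕ) : LieCochain K A M n →ₗ[K] TailCochain K A M (n + 1) where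
  toFun c := fun p => bottomComp n c p.1.1 p.1.2 p.2
  map_add' f g := by
    funext ⟨⟨i, j⟩, h⟩
    cases i <;> simp [bottomComp]
  map_smul' c f := by
    funext ⟨⟨i, j⟩, h⟩
    cases i <;> simp [bottomComp]

/-- The coboundary of the Poisson complex. -/
def poissonD (n : ℕ) : PoissonCochain K A M n →ₗ[K] PoissonCochain K A M (n + 1) :=
  (ceD n ∘ₗ LinearMap.fst K _ _).prod
    (bottomTotal n ∘ₗ LinearMap.fst K _ _ + tailD n ∘ₗ LinearMap.snd K _ _)

theorem poissonD_apply (n : ℕ) (f : PoissonCochain K A M n) :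
    poissonD n f = (ceD n f.1, bottomTotal n f.1 + tailD n f.2) := rfl

end Quasi

variable [PoissonModule K A M]

theorem bottomTotal_ceD (n : ℕ) (f : LieCochain K A M n) :
    bottomTotal (n + 1) (ceD n f) + tailD (n + 1) (bottomTotal n f) = 0 := by
  funext ⟨⟨i, j⟩, h⟩
  change bottomComp (n + 1) (ceD n f) i j h + (tailVert (n + 1) (bottomTotal n f) i j h +
    tailHoriz (n + 1) (bottomTotal n f) i j h) = 0
  rcases i with _ | i
  · rcases j with _ | j
    · obtain rfl : n = 0 := by omega
      simp only [bottomComp, tailVert, tailHoriz, add_zero]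
      exact bottomD_ceD_zero f
    · obtain rfl : n = j + 1 := by omega
      have hs : (-1 : ℤ) ^ (0 + 2) = 1 := by norm_num
      simp only [tailVert, tailHoriz, zero_add, hs, one_smul]
      exact (add_comm _ _).trans (ceD_bottomD j f)
  · rcases i with _ | i
    · rcases j with _ | j <;> simp [bottomComp, bottomTotal, tailVert, tailHoriz, vertD_bottomD]
    · rcases j with _ | j <;> simp [bottomComp, bottomTotal, tailVert, tailHoriz]

theorem poissonD_poissonD (n : ℕ) (f : PoissonCochain K A M n) :
    poissonD (n + 1) (poissonD n f) = 0 := by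
  rw [poissonD_apply, poissonD_apply]
  dsimp only
  rw [ceD_ceD, map_add, tailD_tailD, add_zero, bottomTotal_ceD]
  rfl

end Totals

end Cochains

section Complexes

variable (K A M : Type u) [Field K] [Ring A] [Algebra K A] [PoissonAlgebra K A]
  [AddCommGroup M] [Module K M] [Module A M] [Module Aᵐᵒᵖ M]
  [SMulCommClass A Aᵐᵒᵖ M] [IsScalarTower K A M] [IsScalarTower K Aᵐᵒᵖ M]

section Quasi

variable [QuasiPoissonModule K A M]

/-- The Chevalley-Eilenberg complex of the Lie algebra `A` with coefficients in `M`. -/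
noncomputable def ceComplex : CochainComplex (ModuleCat.{u} K) ℕ :=
  CochainComplex.of (fun n => ModuleCat.of K (LieCochain K A M n))
    (fun n => ModuleCat.ofHom (ceD n))
    (fun n => by apply ModuleCat.hom_ext; refine LinearMap.ext fun f => ?_; exact ceD_ceD n f)

/-- The complex `⊕_{i+j=n, i≥2} Hom(A^i ⊗ ⋀^j, M)` in degree `n`: the complex computing
`Ext(Ω²(A), M)`, shifted by two places to the right. -/
noncomputable def tailComplex : CochainComplex (ModuleCat.{u} K) ℕ :=
  CochainComplex.of (fun n => ModuleCat.of K (TailCochain K A M n))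
    (fun n => ModuleCat.ofHom (tailD n))
    (fun n => by apply ModuleCat.hom_ext; refine LinearMap.ext fun f => ?_; exact tailD_tailD n f)

end Quasi

variable [PoissonModule K A M]

/-- The Poisson complex of `A` with coefficients in `M`. -/
noncomputable def poissonComplex : CochainComplex (ModuleCat.{u} K) ℕ :=
  CochainComplex.of (fun n => ModuleCat.of K (PoissonCochain K A M n))
    (fun n => ModuleCat.ofHom (poissonD n))
    (fun n => by apply ModuleCat.hom_ext; refine LinearMap.ext fun f => ?_; exact poissonD_poissonD n f)

/-- The `n`-th FGV-Poisson cohomology group of `A` with coefficients in `M`. -/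
noncomputable abbrev HP (n : ℕ) : ModuleCat.{u} K := (poissonComplex K A M).homology n

/-- The inclusion of the summands `Hom(A^i ⊗ ⋀^j, M)`, `i ≥ 2`, in the Poisson complex. -/
noncomputable def tailInclusion : tailComplex K A M ⟶ poissonComplex K A M :=
  CochainComplex.ofHom (fun n => ModuleCat.ofHom (LinearMap.inr K _ _)) (fun n => by
    simp only [tailComplex, poissonComplex, CochainComplex.of_d]
    apply ModuleCat.hom_ext; refine LinearMap.ext fun f => ?_
    change poissonD n (0, f) = (0, tailD n f)
    rw [poissonD_apply]
    simp)

/-- The projection of the Poisson complex onto the summands `Hom(⋀^n, M)`. -/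
noncomputable def ceProjection : poissonComplex K A M ⟶ ceComplex K A M :=
  CochainComplex.ofHom (fun n => ModuleCat.ofHom (LinearMap.fst K _ _)) (fun n => by
    simp only [ceComplex, poissonComplex, CochainComplex.of_d]
    rfl)

/-- The short exact sequence of complexes formed by the inclusion and the projection. -/
noncomputable def poissonSES : ShortComplex (CochainComplex (ModuleCat.{u} K) ℕ) :=
  ShortComplex.mk (tailInclusion K A M) (ceProjection K A M) (by
    ext n : 1
    apply ModuleCat.hom_ext
    rfl)

theorem poissonSES_shortExact : (poissonSES K A M).ShortExact := by
  apply HomologicalComplex.shortExact_of_degreewise_shortExact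
  intro n
  refine ShortComplex.ShortExact.mk' ?_ ?_ ?_
  · rw [ShortComplex.moduleCat_exact_iff]
    intro (x : PoissonCochain K A M n) (hx : x.1 = 0)
    exact ⟨x.2, Prod.ext hx.symm rfl⟩
  · rw [ModuleCat.mono_iff_injective]
    exact Prod.mk_right_injective (0 : LieCochain K A M n)
  · rw [ModuleCat.epi_iff_surjective]
    exact fun c => ⟨((c, 0) : PoissonCochain K A M n), rfl⟩

end Complexes

section UEA

variable {K L : Type*} [Field K] [LieRing L] [LieAlgebra K L]

theorem uea_induction {P : UniversalEnvelopingAlgebra K L → Prop}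
    (hι : ∀ x, P (UniversalEnvelopingAlgebra.ι K x)) (ha : ∀ c, P (algebraMap K _ c))
    (hadd : ∀ u v, P u → P v → P (u + v)) (hmul : ∀ u v, P u → P v → P (u * v))
    (u : UniversalEnvelopingAlgebra K L) : P u := by
  let S : Subalgebra K (UniversalEnvelopingAlgebra K L) :=
    { carrier := {u | P u}
      mul_mem' := fun {a b} => hmul a b
      add_mem' := fun {a b} => hadd a b
      algebraMap_mem' := ha }
  letI : LieRing S := LieRing.ofAssociativeRing
  letI : LieRing (UniversalEnvelopingAlgebra K L) := LieRing.ofAssociativeRing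
  let f : L →ₗ⁅K⁆ S :=
    { toFun := fun x => ⟨UniversalEnvelopingAlgebra.ι K x, hι x⟩
      map_add' := fun x y => Subtype.ext (map_add _ x y)
      map_smul' := fun c x => Subtype.ext (map_smul _ c x)
      map_lie' := fun {x y} => Subtype.ext (LieHom.map_lie _ x y) }
  have h : S.val.comp (UniversalEnvelopingAlgebra.lift K f) = AlgHom.id K _ := by
    apply UniversalEnvelopingAlgebra.hom_ext
    ext x
    change ((UniversalEnvelopingAlgebra.lift K f) (UniversalEnvelopingAlgebra.ι K x) :
      UniversalEnvelopingAlgebra K L) = UniversalEnvelopingAlgebra.ι K x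
    rw [UniversalEnvelopingAlgebra.lift_ι_apply]
    rfl
  have hu := congrArg (fun F => F u) h
  change ((UniversalEnvelopingAlgebra.lift K f u : S) : UniversalEnvelopingAlgebra K L) = u at hu
  rw [← hu]
  exact (UniversalEnvelopingAlgebra.lift K f u).2

variable (K L) in
/-- The action of the enveloping algebra on a Lie module. -/
def ueaAct (N : Type*) [AddCommGroup N] [Module K N] [LieRingModule L N] [LieModule K L N] :
    UniversalEnvelopingAlgebra K L →ₐ[K] Module.End K N :=
  UniversalEnvelopingAlgebra.lift K (LieModule.toEnd K L N)

theorem ueaAct_ι (N : Type*) [AddCommGroup N] [Module K N] [LieRingModule L N] [LieModule K L N]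
    (x : L) (n : N) : ueaAct K L N (UniversalEnvelopingAlgebra.ι K x) n = ⁅x, n⁆ := by
  rw [ueaAct, UniversalEnvelopingAlgebra.lift_ι_apply]
  rfl

/-- The Lie algebra acts on its enveloping algebra by left multiplication. -/
instance : LieRingModule L (UniversalEnvelopingAlgebra K L) where
  bracket x u := UniversalEnvelopingAlgebra.ι K x * u
  add_lie x y u := by simp [add_mul]
  lie_add x u v := by simp [mul_add]
  leibniz_lie x y u := by
    letI : LieRing (UniversalEnvelopingAlgebra K L) := LieRing.ofAssociativeRing
    change _ * (_ * u) = UniversalEnvelopingAlgebra.ι K ⁅x, y⁆ * u + _ * (_ * u)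
    rw [LieHom.map_lie, LieRing.of_associative_ring_bracket]
    noncomm_ring

theorem lie_uea (x : L) (u : UniversalEnvelopingAlgebra K L) :
    ⁅x, u⁆ = UniversalEnvelopingAlgebra.ι K x * u := rfl

instance : LieModule K L (UniversalEnvelopingAlgebra K L) where
  smul_lie c x u := by simp [lie_uea]
  lie_smul c x u := by simp [lie_uea]

end UEA

section Smash

/-- The Lie algebra `L` acts on the algebra `B` by derivations, that is, `B` is a module algebra
over the enveloping algebra of `L`. -/
class LieActsByDerivations (L B : Type*) [LieRing L] [Ring B] [LieRingModule L B] : Prop where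
  lie_mul : ∀ (x : L) (a b : B), ⁅x, a * b⁆ = ⁅x, a⁆ * b + a * ⁅x, b⁆

/-- The `B`-module `N` is also a Lie module over `L`, and the two actions are compatible. -/
class LieCompatible (L B N : Type*) [LieRing L] [Ring B] [LieRingModule L B] [AddCommGroup N]
    [Module B N] [LieRingModule L N] : Prop where
  lie_smul' : ∀ (x : L) (b : B) (n : N), ⁅x, b • n⁆ = ⁅x, b⁆ • n + b • ⁅x, n⁆

variable (K L B : Type*) [Field K] [LieRing L] [LieAlgebra K L] [Ring B] [Algebra K B]
  [LieRingModule L B] [LieModule K L B]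

/-- The smash product `B # U(L)`: the vector space `B ⊗ U(L)` with the multiplication
`(a # u)(b # v) = ∑ a (u₁ b) # u₂ v`. -/
def Smash : Type _ := B ⊗[K] UniversalEnvelopingAlgebra K L

noncomputable instance : AddCommGroup (Smash K L B) :=
  inferInstanceAs (AddCommGroup (B ⊗[K] UniversalEnvelopingAlgebra K L))

noncomputable instance : Module K (Smash K L B) :=
  inferInstanceAs (Module K (B ⊗[K] UniversalEnvelopingAlgebra K L))

/-- `b ⊗ u` acts on a compatible module by `n ↦ b (u n)`. -/
noncomputable def smashAct (N : Type*) [AddCommGroup N] [Module K N] [Module B N]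
    [IsScalarTower K B N] [LieRingModule L N] [LieModule K L N] :
    B ⊗[K] UniversalEnvelopingAlgebra K L →ₗ[K] Module.End K N :=
  TensorProduct.lift
    ((LinearMap.mul K (Module.End K N)).compl₁₂
      (Algebra.lsmul K K N).toLinearMap (ueaAct K L N).toLinearMap)

variable {K L B}

theorem smashAct_tmul {N : Type*} [AddCommGroup N] [Module K N] [Module B N]
    [IsScalarTower K B N] [LieRingModule L N] [LieModule K L N] (b : B)
    (u : UniversalEnvelopingAlgebra K L) (n : N) :
    smashAct K L B N (b ⊗ₜ u) n = b • ueaAct K L N u n := rfl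

theorem ueaAct_tmul_uea [LieActsByDerivations L B] (u v : UniversalEnvelopingAlgebra K L) :
    ueaAct K L (B ⊗[K] UniversalEnvelopingAlgebra K L) u ((1 : B) ⊗ₜ v) = 1 ⊗ₜ (u * v) := by
  induction u using uea_induction generalizing v with
  | hι x =>
    have h1 : ⁅x, (1 : B)⁆ = 0 := by
      have := LieActsByDerivations.lie_mul x (1 : B) 1
      simpa using this
    rw [ueaAct_ι, TensorProduct.LieModule.lie_tmul_right, h1, TensorProduct.zero_tmul, zero_add]
    rfl
  | ha c => simp [Algebra.algebraMap_eq_smul_one]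
  | hadd u u' h h' => rw [map_add, LinearMap.add_apply, h, h', add_mul, TensorProduct.tmul_add]
  | hmul u u' h h' => rw [map_mul, Module.End.mul_apply, h', h, mul_assoc]

section Act

variable [LieActsByDerivations L B] (N : Type*) [AddCommGroup N] [Module K N] [Module B N]
    [IsScalarTower K B N] [LieRingModule L N] [LieModule K L N] [LieCompatible L B N]

theorem smashAct_smul (b : B) (q : B ⊗[K] UniversalEnvelopingAlgebra K L) (n : N) :
    smashAct K L B N (b • q) n = b • smashAct K L B N q n := by
  induction q with
  | zero => simp
  | tmul c v => rw [TensorProduct.smul_tmul', smashAct_tmul, smashAct_tmul, smul_eq_mul, mul_smul]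
  | add p q hp hq => simp [hp, hq]

theorem smashAct_lie (x : L) (q : B ⊗[K] UniversalEnvelopingAlgebra K L) (n : N) :
    smashAct K L B N ⁅x, q⁆ n = ⁅x, smashAct K L B N q n⁆ := by
  induction q with
  | zero => simp
  | tmul c v =>
    rw [TensorProduct.LieModule.lie_tmul_right, map_add, LinearMap.add_apply, smashAct_tmul,
      smashAct_tmul, smashAct_tmul, LieCompatible.lie_smul', lie_uea, map_mul,
      Module.End.mul_apply, ueaAct_ι]
  | add p q hp hq => simp [hp, hq]

theorem smashAct_uea (u : UniversalEnvelopingAlgebra K L)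
    (q : B ⊗[K] UniversalEnvelopingAlgebra K L) (n : N) :
    smashAct K L B N (ueaAct K L (B ⊗[K] UniversalEnvelopingAlgebra K L) u q) n =
      ueaAct K L N u (smashAct K L B N q n) := by
  induction u using uea_induction generalizing q n with
  | hι x => rw [ueaAct_ι, ueaAct_ι, smashAct_lie]
  | ha c => simp [Algebra.algebraMap_eq_smul_one]
  | hadd u u' h h' => simp [h, h']
  | hmul u u' h h' => rw [map_mul, map_mul, Module.End.mul_apply, Module.End.mul_apply, h, h']

theorem smashAct_smashAct (p q : B ⊗[K] UniversalEnvelopingAlgebra K L) (n : N) :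
    smashAct K L B N (smashAct K L B (B ⊗[K] UniversalEnvelopingAlgebra K L) p q) n =
      smashAct K L B N p (smashAct K L B N q n) := by
  induction p with
  | zero => simp
  | tmul b u => rw [smashAct_tmul, smashAct_tmul, smashAct_smul, smashAct_uea]
  | add p p' hp hp' => simp [hp, hp']

theorem smashAct_one (n : N) : smashAct K L B N (1 ⊗ₜ 1) n = n := by
  rw [smashAct_tmul, map_one, one_smul, Module.End.one_apply]

end Act

variable [LieActsByDerivations L B]

instance : LieCompatible L B (B ⊗[K] UniversalEnvelopingAlgebra K L) where
  lie_smul' x b q := by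
    induction q with
    | zero => simp
    | tmul c v =>
      simp only [TensorProduct.smul_tmul', TensorProduct.LieModule.lie_tmul_right, smul_eq_mul,
        LieActsByDerivations.lie_mul, TensorProduct.add_tmul, smul_add]
      abel
    | add p q hp hq =>
      simp only [smul_add, lie_add, hp, hq]
      abel

theorem smashAct_mul_one (q : B ⊗[K] UniversalEnvelopingAlgebra K L) :
    smashAct K L B (B ⊗[K] UniversalEnvelopingAlgebra K L) q (1 ⊗ₜ 1) = q := by
  induction q with
  | zero => simp
  | tmul b u => rw [smashAct_tmul, ueaAct_tmul_uea, TensorProduct.smul_tmul', mul_one, smul_eq_mul,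
      mul_one]
  | add p q hp hq => simp [hp, hq]

noncomputable instance : Ring (Smash K L B) where
  __ := (inferInstance : AddCommGroup (Smash K L B))
  mul p q := smashAct K L B (B ⊗[K] UniversalEnvelopingAlgebra K L) p q
  one := (1 : B) ⊗ₜ[K] (1 : UniversalEnvelopingAlgebra K L)
  left_distrib p q r := map_add (smashAct K L B (B ⊗[K] UniversalEnvelopingAlgebra K L) p) q r
  right_distrib p q r := congrArg (fun F => F r)
    (map_add (smashAct K L B (B ⊗[K] UniversalEnvelopingAlgebra K L)) p q)
  zero_mul p := congrArg (fun F => F p)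
    (map_zero (smashAct K L B (B ⊗[K] UniversalEnvelopingAlgebra K L)))
  mul_zero p := map_zero (smashAct K L B (B ⊗[K] UniversalEnvelopingAlgebra K L) p)
  mul_assoc p q r := smashAct_smashAct (B ⊗[K] UniversalEnvelopingAlgebra K L) p q r
  one_mul p := smashAct_one (B ⊗[K] UniversalEnvelopingAlgebra K L) p
  mul_one p := smashAct_mul_one p

noncomputable instance : Algebra K (Smash K L B) :=
  Algebra.ofModule
    (fun c p q => congrArg (fun F => F q)
      (map_smul (smashAct K L B (B ⊗[K] UniversalEnvelopingAlgebra K L)) c p))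
    (fun c p q => map_smul (smashAct K L B (B ⊗[K] UniversalEnvelopingAlgebra K L) p) c q)

variable (K L) in
/-- The element `b # u` of the smash product. -/
noncomputable def smk (b : B) (u : UniversalEnvelopingAlgebra K L) : Smash K L B := b ⊗ₜ u

theorem smk_one_mul_smk (b : B) (u v : UniversalEnvelopingAlgebra K L) :
    smk K L b u * smk K L 1 v = smk K L b (u * v) := by
  change b • ueaAct K L (B ⊗[K] UniversalEnvelopingAlgebra K L) u ((1 : B) ⊗ₜ v) = b ⊗ₜ (u * v)
  rw [ueaAct_tmul_uea, TensorProduct.smul_tmul', smul_eq_mul, mul_one]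

theorem smk_mul_smk_one (a b : B) (v : UniversalEnvelopingAlgebra K L) :
    smk K L a 1 * smk K L b v = smk K L (a * b) v := by
  change a • ueaAct K L (B ⊗[K] UniversalEnvelopingAlgebra K L) 1 (b ⊗ₜ v) = (a * b) ⊗ₜ v
  rw [map_one, Module.End.one_apply, TensorProduct.smul_tmul', smul_eq_mul]

/-- Elements of `L` are primitive: `(1 # x)(b # v) = {x, b} # v + b # x v`. -/
theorem smk_ι_mul_smk (x : L) (b : B) (v : UniversalEnvelopingAlgebra K L) :
    smk K L 1 (UniversalEnvelopingAlgebra.ι K x) * smk K L b v =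
      smk K L ⁅x, b⁆ v + smk K L b (UniversalEnvelopingAlgebra.ι K x * v) := by
  change (1 : B) • ueaAct K L (B ⊗[K] UniversalEnvelopingAlgebra K L) _ (b ⊗ₜ v) =
    ⁅x, b⁆ ⊗ₜ v + b ⊗ₜ (UniversalEnvelopingAlgebra.ι K x * v)
  rw [ueaAct_ι, one_smul, TensorProduct.LieModule.lie_tmul_right]
  rfl

variable (K L B) in
/-- A compatible `B`-module and Lie module over `L` is a module over the smash product, through
`(b # u) n = b (u n)`. -/
noncomputable def smashHom (N : Type*) [AddCommGroup N] [Module K N] [Module B N]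
    [IsScalarTower K B N] [LieRingModule L N] [LieModule K L N] [LieCompatible L B N] :
    Smash K L B →+* Module.End K N where
  toFun := smashAct K L B N
  map_one' := LinearMap.ext (smashAct_one N)
  map_mul' p q := LinearMap.ext (smashAct_smashAct N p q)
  map_zero' := map_zero (smashAct K L B N)
  map_add' := map_add (smashAct K L B N)

section Free

variable (K L B)
variable (V : Type*) [AddCommGroup V] [Module K V] [LieRingModule L V] [LieModule K L V]

/-- The module `B ⊗ V` over the smash product, for a Lie module `V`: `B` acts on the left factor
and `L` acts diagonally. -/
def SmashTensor : Type _ := B ⊗[K] V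

noncomputable instance : AddCommGroup (SmashTensor K B V) :=
  inferInstanceAs (AddCommGroup (B ⊗[K] V))

noncomputable instance : Module K (SmashTensor K B V) :=
  inferInstanceAs (Module K (B ⊗[K] V))

instance : LieCompatible L B (B ⊗[K] V) where
  lie_smul' x b q := by
    induction q with
    | zero => simp
    | tmul c v =>
      simp only [TensorProduct.smul_tmul', TensorProduct.LieModule.lie_tmul_right, smul_eq_mul,
        LieActsByDerivations.lie_mul, TensorProduct.add_tmul, smul_add]
      abel
    | add p q hp hq =>
      simp only [smul_add, lie_add, hp, hq]
      abel

noncomputable instance : Module (Smash K L B) (SmashTensor K B V) :=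
  Module.compHom (B ⊗[K] V) (smashHom K L B (B ⊗[K] V))

variable {B V}

/-- The element `b ⊗ v`. -/
def stmul (b : B) (v : V) : SmashTensor K B V := b ⊗ₜ v

theorem smk_one_smul_stmul (b c : B) (v : V) :
    smk K L b 1 • stmul K c v = stmul K (b * c) v := by
  change b • ueaAct K L (B ⊗[K] V) 1 (c ⊗ₜ v) = (b * c) ⊗ₜ v
  rw [map_one, Module.End.one_apply, TensorProduct.smul_tmul', smul_eq_mul]

theorem smk_ι_smul_stmul (x : L) (c : B) (v : V) :
    smk K L (1 : B) (UniversalEnvelopingAlgebra.ι K x) • stmul K c v =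
      stmul K ⁅x, c⁆ v + stmul K c ⁅x, v⁆ := by
  change (1 : B) • ueaAct K L (B ⊗[K] V) _ (c ⊗ₜ v) = ⁅x, c⁆ ⊗ₜ v + c ⊗ₜ ⁅x, v⁆
  rw [ueaAct_ι, one_smul, TensorProduct.LieModule.lie_tmul_right]
  rfl

end Free

end Smash

section Enveloping

variable (K A : Type*) [Field K] [Ring A] [Algebra K A] [PoissonAlgebra K A]

instance : LieActsByDerivations (PoissonLie K A) (A ⊗[K] Aᵐᵒᵖ) where
  lie_mul x p q := by
    induction p with
    | zero => simp
    | add p p' h h' => simp only [add_mul, lie_add, h, h']; abel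
    | tmul a b =>
      induction q with
      | zero => simp
      | add q q' h h' => simp only [mul_add, lie_add, h, h']; abel
      | tmul c d =>
        induction b using MulOpposite.rec' with
        | _ b =>
        induction d using MulOpposite.rec' with
        | _ d =>
        simp only [Algebra.TensorProduct.tmul_mul_tmul, TensorProduct.LieModule.lie_tmul_right,
          lie_alg_mul, ← op_mul, lie_op, TensorProduct.add_tmul, add_mul, mul_add]
        rw [MulOpposite.op_add, TensorProduct.tmul_add]
        abel

/-- The quasi-Poisson enveloping algebra `A^e # U(A)`, where `A^e = A ⊗ A^op`. -/
abbrev QuasiEnv : Type _ := Smash K (PoissonLie K A) (A ⊗[K] Aᵐᵒᵖ)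

/-- The module `A^4` over the quasi-Poisson enveloping algebra; the tensor
`a₀ ⊗ a₁ ⊗ a₂ ⊗ a₃` is stored as `(a₀ ⊗ a₃') ⊗ (a₁ ⊗ a₂)` in `A^e ⊗ A^2`, so that the outer
bimodule structure of `A^4` is the left action of `A^e`; the Lie algebra acts diagonally. -/
abbrev AFour : Type _ := SmashTensor K (A ⊗[K] Aᵐᵒᵖ) (A ⊗[K] A)

variable {A} in
/-- The tensor `a₀ ⊗ a₁ ⊗ a₂ ⊗ a₃`. -/
def four (a₀ a₁ a₂ a₃ : A) : AFour K A :=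
  stmul K (a₀ ⊗ₜ[K] op a₃) (a₁ ⊗ₜ[K] a₂)

/-- The submodule of `A^4` generated by the elements
`a ⊗ b ⊗ c ⊗ 1 - 1 ⊗ ab ⊗ c ⊗ 1 + 1 ⊗ a ⊗ bc ⊗ 1 - 1 ⊗ a ⊗ b ⊗ c`. -/
noncomputable def barRelations : Submodule (QuasiEnv K A) (AFour K A) :=
  Submodule.span (QuasiEnv K A) (Set.range fun t : A × A × A =>
    four K t.1 t.2.1 t.2.2 1 - four K 1 (t.1 * t.2.1) t.2.2 1 +
      four K 1 t.1 (t.2.1 * t.2.2) 1 - four K 1 t.1 t.2.1 t.2.2)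

/-- `Ω²(A)`, the second syzygy of the bimodule `A`. -/
abbrev OmegaTwo : Type _ := AFour K A ⧸ barRelations K A

variable (M : Type*) [AddCommGroup M] [Module K M] [Module A M] [Module Aᵐᵒᵖ M]
  [SMulCommClass A Aᵐᵒᵖ M] [IsScalarTower K A M] [IsScalarTower K Aᵐᵒᵖ M]
  [QuasiPoissonModule K A M]

/-- The `A^e # U(A)`-module structure of a quasi-Poisson module:
`(a ⊗ b' # u) m = a (u m) b`. -/
noncomputable def quasiHom : QuasiEnv K A →+* Module.End K M :=
  letI : Module (A ⊗[K] Aᵐᵒᵖ) M := TensorProduct.Algebra.module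
  haveI ht : ∀ (a : A) (b : Aᵐᵒᵖ) (m : M), (a ⊗ₜ[K] b : A ⊗[K] Aᵐᵒᵖ) • m = a • b • m :=
    fun _ _ _ => rfl
  haveI : IsScalarTower K (A ⊗[K] Aᵐᵒᵖ) M :=
    ⟨fun c q m => congrArg (fun F => F m)
      (map_smul (TensorProduct.Algebra.moduleAux : A ⊗[K] Aᵐᵒᵖ →ₗ[K] M →ₗ[K] M) c q)⟩
  haveI : LieCompatible (PoissonLie K A) (A ⊗[K] Aᵐᵒᵖ) M :=
    ⟨fun x q m => by
      let T : A ⊗[K] Aᵐᵒᵖ →ₗ[K] M →ₗ[K] M := TensorProduct.Algebra.moduleAux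
      have h : LieModule.toEnd K (PoissonLie K A) M x ∘ₗ T.flip m =
          T.flip m ∘ₗ LieModule.toEnd K (PoissonLie K A) (A ⊗[K] Aᵐᵒᵖ) x + T.flip ⁅x, m⁆ := by
        apply TensorProduct.ext'
        intro a b
        induction b using MulOpposite.rec' with
        | _ b =>
        change ⁅x, a • op b • m⁆ = T ⁅x, a ⊗ₜ[K] op b⁆ m + a • op b • ⁅x, m⁆
        rw [TensorProduct.LieModule.lie_tmul_right, map_add, lie_mod_smul, lie_mod_op_smul]
        change _ = ⁅x, a⁆ • op b • m + a • op ⁅x, b⁆ • m + _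
        rw [smul_add, add_assoc]
      exact congrArg (fun F => F q) h⟩
  smashHom K (PoissonLie K A) (A ⊗[K] Aᵐᵒᵖ) M

theorem quasiHom_smk (a b : A) (u : UniversalEnvelopingAlgebra K (PoissonLie K A)) (m : M) :
    quasiHom K A M (smk K (PoissonLie K A) (a ⊗ₜ[K] op b) u) m =
      a • op b • ueaAct K (PoissonLie K A) M u m := rfl

end Enveloping

section Modules

variable (K A M : Type u) [Field K] [Ring A] [Algebra K A] [PoissonAlgebra K A]
  [AddCommGroup M] [Module K M] [Module A M] [Module Aᵐᵒᵖ M]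
  [SMulCommClass A Aᵐᵒᵖ M] [IsScalarTower K A M] [IsScalarTower K Aᵐᵒᵖ M]
  [QuasiPoissonModule K A M]

/-- The enveloping algebra `U(A)` of the Lie algebra `A`. -/
abbrev LieEnv : Type u := UniversalEnvelopingAlgebra K (PoissonLie K A)

/-- The trivial `U(A)`-module `K`. -/
noncomputable def trivialMod : ModuleCat.{u} (LieEnv K A) :=
  letI : LieRing K := LieRing.ofAssociativeRing
  letI : Module (LieEnv K A) K := Module.compHom K
    (UniversalEnvelopingAlgebra.lift K (0 : PoissonLie K A →ₗ⁅K⁆ K)).toRingHom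
  ModuleCat.of (LieEnv K A) K

/-- `M` as a `U(A)`-module. -/
noncomputable def lieMod : ModuleCat.{u} (LieEnv K A) :=
  letI : Module (LieEnv K A) M := Module.compHom M (ueaAct K (PoissonLie K A) M).toRingHom
  ModuleCat.of (LieEnv K A) M

/-- `M` as a module over the quasi-Poisson enveloping algebra. -/
noncomputable def quasiMod : ModuleCat.{u} (QuasiEnv K A) :=
  letI : Module (QuasiEnv K A) M := Module.compHom M (quasiHom K A M)
  ModuleCat.of (QuasiEnv K A) M

/-- `Ω²(A)` as a module over the quasi-Poisson enveloping algebra. -/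
noncomputable def omegaMod : ModuleCat.{u} (QuasiEnv K A) :=
  ModuleCat.of (QuasiEnv K A) (OmegaTwo K A)

end Modules

end FGVPoisson

universe v w' u'

namespace FGVPoisson

open MulOpposite CategoryTheory
open scoped TensorProduct

set_option linter.unusedSectionVars false

/-! ### Dimension shifting: recognising `Ext` from a functor to cochain complexes -/

section ExtComparison

/-! The long exact sequence is the cohomology sequence of (*). Its first terms simplify because the
tail complex T has no cochains in degrees 0 and 1. Exactness survives transport along arbitrary
linear isomorphisms, so all the work lies in identifying the cohomology of the two outer complexes
with `Ext`.

Both identifications come from one dimension-shifting principle, `nonempty_homology_equiv_ext`. Let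
F be an exact functor to cochain complexes with zero differential into degree k, whose cohomology in
degree k is naturally Hom(X, -), and whose cohomology above degree k vanishes on injective objects.
Then H^(k+n)(F N) is isomorphic to Ext^n(X, N). The Chevalley-Eilenberg complex and the tail complex
are functors of the coefficient module, over U(A) and over A^e # U(A) respectively. They are exact
because exact sequences split over the field K. In lowest degree, the cocycles of the first (k = 0)
are the invariant elements, that is, the maps from the trivial module. Those of the second (k = 2)
are the invariant Hochschild two-cocycles, that is, the maps from Ω²(A), since the relations of
Ω²(A) spell out the cocycle identity.

It remains to show vanishing on injectives. An injective module is a direct summand of every module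
into which it embeds, so one acyclic module containing it is enough.

For a Lie algebra L that module is Hom(S, N), where S is the space of polynomials in a basis of L
with the Poincaré-Birkhoff-Witt action (`pbw_lie`). Up to terms of lower degree, S behaves like the
symmetric algebra, with a de Rham differential S → L ⊗ S and an Euler field (`EulerFiltration`).
Contracting a cocycle of exterior degree n + 1 with the Euler field and then applying the
differential multiplies it by -(q + n + 1) on its leading part in polynomial degree q
(`ceD_eulerContract`). In characteristic zero this number is invertible, so the cocycle can be
corrected one degree at a time. The corrections add up because every element of S lies in a finite
step of the filtration (`exists_ceD_eq`). The constant term of a polynomial embeds N in Hom(S, N).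

For the tail complex the module is Hom(A, Hom(S, M)). Evaluation at 1 ∈ A gives a Hochschild
contracting homotopy, which is equivariant because {x, 1} = 0. The Lie direction is acyclic as
before. The homotopy first moves a cocycle into the row of Hochschild degree two, where Lie
acyclicity makes it a coboundary (`exists_tailD_eq_coMod`).

Characteristic zero enters only through the division by q + n + 1. The identity {ab, m} = a{b, m} +
{a, m}b enters only in making the Poisson complex a complex; both comparisons with `Ext` hold for
quasi-Poisson modules. -/

/-- Two surjections with corresponding kernels have isomorphic targets. -/
theorem nonempty_linearEquiv_of_surjective {K V W V' W' : Type*} [Ring K] [AddCommGroup V]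
    [Module K V] [AddCommGroup W] [Module K W] [AddCommGroup V'] [Module K V'] [AddCommGroup W']
    [Module K W'] (g : V →ₗ[K] W) (g' : V' →ₗ[K] W') (e : V ≃ₗ[K] V')
    (hg : Function.Surjective g) (hg' : Function.Surjective g')
    (h : ∀ x, g x = 0 ↔ g' (e x) = 0) : Nonempty (W ≃ₗ[K] W') := by
  have hk : (LinearMap.ker g).map (e : V →ₗ[K] V') = LinearMap.ker g' := by
    ext y
    constructor
    · rintro ⟨x, hx, rfl⟩
      exact (h x).1 hx
    · intro hy
      refine ⟨e.symm y, (h _).2 ?_, e.apply_symm_apply y⟩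
      rw [e.apply_symm_apply]
      exact hy
  exact ⟨(g.quotKerEquivOfSurjective hg).symm ≪≫ₗ Submodule.Quotient.equiv _ _ e hk ≪≫ₗ
    g'.quotKerEquivOfSurjective hg'⟩

variable {K : Type u} [Field K]

theorem eq_zero_of_isZero {V : ModuleCat.{v} K} (h : Limits.IsZero V) (x : V) : x = 0 := by
  have := ModuleCat.subsingleton_of_isZero h
  exact Subsingleton.elim _ _

section Degree

variable {H : Type v} [AddCommGroup H] [Module K H] (P : CochainComplex (ModuleCat.{v} K) ℕ)
  (k : ℕ) (ι : H →ₗ[K] P.X k) (hι : ∀ x, P.d k (k + 1) (ι x) = 0)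

/-- The map to homology defined by a family of cocycles. -/
noncomputable def toHomology : ModuleCat.of K H ⟶ P.homology k :=
  P.liftCycles (ModuleCat.ofHom ι) (k + 1) (by simp)
    (by apply ModuleCat.hom_ext; exact LinearMap.ext hι) ≫ P.homologyπ k

theorem toHomology_naturality {H' : Type v} [AddCommGroup H'] [Module K H']
    (P' : CochainComplex (ModuleCat.{v} K) ℕ) (ι' : H' →ₗ[K] P'.X k)
    (hι' : ∀ x, P'.d k (k + 1) (ι' x) = 0) (φ : P ⟶ P') (t : H →ₗ[K] H')
    (h : ∀ x, φ.f k (ι x) = ι' (t x)) (x : H) :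
    HomologicalComplex.homologyMap φ k (toHomology P k ι hι x) =
      toHomology P' k ι' hι' (t x) := by
  have : toHomology P k ι hι ≫ HomologicalComplex.homologyMap φ k =
      ModuleCat.ofHom t ≫ toHomology P' k ι' hι' := by
    rw [toHomology, toHomology, Category.assoc, HomologicalComplex.homologyπ_naturality,
      ← Category.assoc, ← Category.assoc, HomologicalComplex.liftCycles_comp_cyclesMap]
    congr 1
    rw [HomologicalComplex.comp_liftCycles]
    congr 1
    apply ModuleCat.hom_ext
    exact LinearMap.ext h
  exact ConcreteCategory.congr_hom this x

/-- No nonzero coboundary lands in degree `k`, so homology there is the kernel of the outgoing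
differential; `hinj` and `hker` identify that kernel with `H`. -/
theorem toHomology_bijective (hd : ∀ i, P.d i k = 0) (hinj : Function.Injective ι)
    (hker : ∀ f : P.X k, P.d k (k + 1) f = 0 → ∃ x, ι x = f) :
    Function.Bijective (toHomology P k ι hι) := by
  have h1 : IsIso (P.homologyπ k) := P.isIso_homologyπ _ k rfl (hd _)
  have h2 : Function.Bijective (P.homologyπ k) := ConcreteCategory.bijective_of_isIso _
  have hi : Function.Injective (P.iCycles k) :=
    (ModuleCat.mono_iff_injective _).1 inferInstance
  set l := P.liftCycles (ModuleCat.ofHom ι) (k + 1) (by simp)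
    (by apply ModuleCat.hom_ext; exact LinearMap.ext hι) with hl
  have hli : ∀ x, P.iCycles k (l x) = ι x := fun x => by
    have := P.liftCycles_i (ModuleCat.ofHom ι) (k + 1) (by simp)
      (by apply ModuleCat.hom_ext; exact LinearMap.ext hι)
    exact ConcreteCategory.congr_hom this x
  have h3 : Function.Bijective l := by
    constructor
    · intro x y hxy
      apply hinj
      rw [← hli, ← hli, hxy]
    · intro z
      obtain ⟨x, hx⟩ := hker (P.iCycles k z) (ConcreteCategory.congr_hom (P.iCycles_d k (k + 1)) z)
      exact ⟨x, hi (by rw [hli, hx])⟩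
  have : (toHomology P k ι hι : H → P.homology k) = P.homologyπ k ∘ l := by
    funext x; rfl
  rw [this]
  exact h2.comp h3

/-- Homology vanishes where every cocycle is a coboundary. -/
theorem isZero_homology (h : ∀ f : P.X (k + 1), P.d (k + 1) (k + 2) f = 0 →
    ∃ g : P.X k, P.d k (k + 1) g = f) : Limits.IsZero (P.homology (k + 1)) := by
  rw [← HomologicalComplex.exactAt_iff_isZero_homology,
    HomologicalComplex.exactAt_iff' P k (k + 1) (k + 2) (by simp) (by simp),
    ShortComplex.moduleCat_exact_iff]
  exact h

end Degree

variable {C : Type u'} [Category.{v} C] [Abelian C] [Linear K C] [HasExt.{w'} C]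
  [EnoughInjectives C]

open Abelian in
/-- An exact functor to cochain complexes whose cohomology starts with `Hom(X, -)` and vanishes
on injective objects in positive degrees computes `Ext(X, -)`. -/
theorem nonempty_homology_equiv_ext (F : C ⥤ CochainComplex (ModuleCat.{v} K) ℕ)
    [F.PreservesZeroMorphisms]
    (hF : ∀ S : ShortComplex C, S.ShortExact → (S.map F).ShortExact) (X : C) (k : ℕ)
    (hd : ∀ N i, (F.obj N).d i k = 0) (ι : ∀ N, (X ⟶ N) →ₗ[K] (F.obj N).X k)
    (hι : ∀ N x, (F.obj N).d k (k + 1) (ι N x) = 0)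
    (hnat : ∀ {N N' : C} (φ : N ⟶ N') (x : X ⟶ N), (F.map φ).f k (ι N x) = ι N' (x ≫ φ))
    (hinj : ∀ N, Function.Injective (ι N))
    (hker : ∀ N (f : (F.obj N).X k), (F.obj N).d k (k + 1) f = 0 → ∃ x, ι N x = f)
    (hvan : ∀ (J : C) [Injective J] (n : ℕ), Limits.IsZero ((F.obj J).homology (k + n + 1)))
    (n : ℕ) (N : C) : Nonempty ((F.obj N).homology (k + n) ≃ₗ[K] Ext X N n) := by
  -- This identification is natural in `N` (`hθ`). The isomorphisms in higher degrees are merely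
  -- chosen, with no naturality recorded.
  let θ : ∀ N, (X ⟶ N) ≃ₗ[K] (F.obj N).homology k := fun N =>
    LinearEquiv.ofBijective (toHomology (F.obj N) k (ι N) (hι N)).hom
      (toHomology_bijective _ k (ι N) (hι N) (hd N) (hinj N) (hker N))
  have hθ : ∀ {N N' : C} (φ : N ⟶ N') (x : X ⟶ N),
      HomologicalComplex.homologyMap (F.map φ) k (θ N x) = θ N' (x ≫ φ) := fun {N N'} φ x =>
    toHomology_naturality (F.obj N) k (ι N) (hι N) (F.obj N') (ι N') (hι N') (F.map φ)
      (Linear.rightComp K X φ) (hnat φ) x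
  -- One dimension shift. With `S.X₂` injective, both connecting maps onto the degree `n + 1` groups
  -- of `S.X₁` are surjective. Their kernels are the images of the groups of `S.X₂`, so it is enough
  -- that `e` matches these images.
  have step : ∀ (S : ShortComplex C) (hS : S.ShortExact) [Injective S.X₂] (n : ℕ)
      (e : (F.obj S.X₃).homology (k + n) ≃ₗ[K] Ext X S.X₃ n),
      (∀ x, (∃ y, HomologicalComplex.homologyMap (F.map S.g) (k + n) y = x) ↔
        ∃ y : Ext X S.X₂ n, y.comp (Ext.mk₀ S.g) (add_zero n) = e x) →
      Nonempty ((F.obj S.X₁).homology (k + n + 1) ≃ₗ[K] Ext X S.X₁ (n + 1)) := by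
    intro S hS _ n e he
    have hFS := hF S hS
    have e1 := (ShortComplex.moduleCat_exact_iff _).1
      (hFS.homology_exact₁ (k + n) (k + n + 1) rfl)
    have e3 := (ShortComplex.moduleCat_exact_iff _).1
      (hFS.homology_exact₃ (k + n) (k + n + 1) rfl)
    refine nonempty_linearEquiv_of_surjective (hFS.δ (k + n) (k + n + 1) rfl).hom
      (Ext.postcompOfLinear hS.extClass K X rfl) e ?_ ?_ ?_
    · intro y
      exact e1 y (eq_zero_of_isZero (hvan S.X₂ n) _)
    · intro y
      exact Ext.covariant_sequence_exact₁ X hS y (Ext.eq_zero_of_injective _) rfl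
    · intro x
      have hA : (hFS.δ (k + n) (k + n + 1) rfl).hom x = 0 ↔
          ∃ y, HomologicalComplex.homologyMap (F.map S.g) (k + n) y = x := by
        constructor
        · intro hx
          exact e3 x hx
        · rintro ⟨y, rfl⟩
          exact ConcreteCategory.congr_hom (hFS.comp_δ (k + n) (k + n + 1) rfl) y
      have hB : Ext.postcompOfLinear hS.extClass K X rfl (e x) = 0 ↔
          ∃ y : Ext X S.X₂ n, y.comp (Ext.mk₀ S.g) (add_zero n) = e x := by
        constructor
        · intro hx
          exact Ext.covariant_sequence_exact₃ X hS (e x) rfl hx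
        · rintro ⟨y, hy⟩
          rw [← hy]
          change (y.comp (Ext.mk₀ S.g) (add_zero n)).comp hS.extClass rfl = 0
          rw [Ext.comp_assoc_of_second_deg_zero, ShortComplex.ShortExact.comp_extClass,
            Ext.comp_zero]
      exact hA.trans ((he x).trans hB.symm)
  induction n generalizing N with
  | zero =>
    exact ⟨(θ N).symm ≪≫ₗ Ext.linearEquiv₀.symm⟩
  | succ n ih =>
    have hS : (ShortComplex.mk (Injective.ι N) (Limits.cokernel.π (Injective.ι N))
        (by simp)).ShortExact :=
      { exact := ShortComplex.exact_of_g_is_cokernel _ (Limits.cokernelIsCokernel _) }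
    set S := ShortComplex.mk (Injective.ι N) (Limits.cokernel.π (Injective.ι N)) (by simp) with hSdef
    have : Injective S.X₂ := inferInstanceAs (Injective (Injective.under N))
    cases n with
    | zero =>
      -- From degree 0 to degree 1 the group of the injective term is Hom(X, S.X₂), which need not
      -- vanish; naturality of `θ` matches the two images.
      refine step S hS 0 ((θ S.X₃).symm ≪≫ₗ Ext.linearEquiv₀.symm) (fun x => ?_)
      obtain ⟨x, rfl⟩ := (θ S.X₃).surjective x
      have hx : ((θ S.X₃).symm ≪≫ₗ Ext.linearEquiv₀.symm) (θ S.X₃ x) = Ext.mk₀ x := by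
        rw [LinearEquiv.trans_apply, LinearEquiv.symm_apply_apply, Ext.linearEquiv₀_symm_apply]
      constructor
      · rintro ⟨y, hy⟩
        obtain ⟨y, rfl⟩ := (θ S.X₂).surjective y
        refine ⟨Ext.mk₀ y, ?_⟩
        rw [Ext.mk₀_comp_mk₀]
        exact (congrArg Ext.mk₀ ((θ S.X₃).injective ((hθ S.g y).symm.trans hy))).trans hx.symm
      · rintro ⟨y, hy⟩
        refine ⟨θ S.X₂ (Ext.linearEquiv₀ (R := K) y), (hθ S.g _).trans (congrArg _ ?_)⟩
        apply (Ext.mk₀_bijective X S.X₃).1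
        rw [← Ext.mk₀_comp_mk₀, Ext.mk₀_linearEquiv₀_apply]
        exact hy.trans hx
    | succ n =>
      -- In positive degrees both groups of the injective term vanish. Both images are then zero,
      -- and any linear isomorphism `e` matches them.
      obtain ⟨e⟩ := ih S.X₃
      refine step S hS (n + 1) e (fun x => ?_)
      constructor
      · rintro ⟨y, rfl⟩
        rw [eq_zero_of_isZero (hvan S.X₂ n) y]
        exact ⟨0, by rw [Ext.zero_comp, map_zero, map_zero]⟩
      · rintro ⟨y, hy⟩
        rw [Ext.eq_zero_of_injective y, Ext.zero_comp] at hy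
        exact ⟨0, by rw [map_zero, e.map_eq_zero_iff.1 hy.symm]⟩

end ExtComparison

/-! ### The Poincaré-Birkhoff-Witt action of a Lie algebra on polynomials -/

section PBW

variable {K L ι : Type*} [Field K] [LieRing L] [LieAlgebra K L] [LinearOrder ι]

variable (K) in
/-- The monomial with the given multiset of variables. -/
noncomputable def mono (m : Multiset ι) : Multiset ι →₀ K := Finsupp.single m 1

variable (K ι) in
/-- The span of the monomials of degree less than `p`. -/
def degLT (p : ℕ) : Submodule K (Multiset ι →₀ K) :=
  Finsupp.supported K K {m : Multiset ι | Multiset.card m < p}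

theorem mono_mem_degLT {m : Multiset ι} {p : ℕ} (h : Multiset.card m < p) :
    mono K m ∈ degLT K ι p :=
  Finsupp.single_mem_supported K 1 h

theorem degLT_mono {p q : ℕ} (h : p ≤ q) : degLT K ι p ≤ degLT K ι q :=
  Finsupp.supported_mono fun _ hm => lt_of_lt_of_le hm h

theorem degLT_zero : degLT K ι 0 = ⊥ := by
  have : {m : Multiset ι | Multiset.card m < 0} = ∅ := by ext; simp
  rw [degLT, this, Finsupp.supported_empty]

theorem exists_mem_degLT (v : Multiset ι →₀ K) : ∃ p, v ∈ degLT K ι p := by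
  refine ⟨v.support.sup Multiset.card + 1, fun m hm => ?_⟩
  exact Nat.lt_succ_of_le (Finset.le_sup (f := Multiset.card) hm)

theorem degLT_le_comap {W : Type*} [AddCommGroup W] [Module K W] (f : (Multiset ι →₀ K) →ₗ[K] W)
    (U : Submodule K W) (p : ℕ) (h : ∀ m : Multiset ι, Multiset.card m < p → f (mono K m) ∈ U)
    {v : Multiset ι →₀ K} (hv : v ∈ degLT K ι p) : f v ∈ U := by
  have : degLT K ι p ≤ U.comap f := by
    rw [degLT, Finsupp.supported_eq_span_single, Submodule.span_le]
    rintro _ ⟨m, hm, rfl⟩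
    exact h m hm
  exact this hv

variable (b : Module.Basis ι K L)

theorem mem_of_basis {W : Type*} [AddCommGroup W] [Module K W] (f : L →ₗ[K] W)
    (U : Submodule K W) (h : ∀ i, f (b i) ∈ U) (x : L) : f x ∈ U := by
  have : (⊤ : Submodule K L) ≤ U.comap f := by
    rw [← b.span_eq, Submodule.span_le]
    rintro _ ⟨i, rfl⟩
    exact h i
  exact this trivial

theorem bilin_mem {W : Type*} [AddCommGroup W] [Module K W]
    (f : L →ₗ[K] (Multiset ι →₀ K) →ₗ[K] W) (U : Submodule K W) (p : ℕ)
    (h : ∀ i (m : Multiset ι), Multiset.card m < p → f (b i) (mono K m) ∈ U) (x : L)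
    {v : Multiset ι →₀ K} (hv : v ∈ degLT K ι p) : f x v ∈ U :=
  mem_of_basis b (f.flip v) U (fun i => degLT_le_comap (f (b i)) U p (h i) hv) x

theorem bilin_eq {W : Type*} [AddCommGroup W] [Module K W]
    (f g : L →ₗ[K] (Multiset ι →₀ K) →ₗ[K] W) (p : ℕ)
    (h : ∀ i (m : Multiset ι), Multiset.card m < p → f (b i) (mono K m) = g (b i) (mono K m))
    (x : L) {v : Multiset ι →₀ K} (hv : v ∈ degLT K ι p) : f x v = g x v := by
  have := bilin_mem b (f - g) ⊥ p (fun i m hm => by simp [h i m hm]) x hv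
  exact sub_eq_zero.1 ((Submodule.mem_bot K).1 this)

/-- The bilinear map with given values on basis elements and monomials. -/
noncomputable def ofBasis (f : ι → Multiset ι → (Multiset ι →₀ K)) :
    L →ₗ[K] (Multiset ι →₀ K) →ₗ[K] (Multiset ι →₀ K) :=
  b.constr K fun i => Finsupp.linearCombination K (f i)

theorem ofBasis_apply (f : ι → Multiset ι → (Multiset ι →₀ K)) (i : ι) (m : Multiset ι) :
    ofBasis b f (b i) (mono K m) = f i m := by
  rw [ofBasis, Module.Basis.constr_basis, mono, Finsupp.linearCombination_single, one_smul]

open Classical in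
/-- Approximations to the action of `L` on polynomials, correct in degrees `≤ n`. -/
noncomputable def pbwAux : ℕ → L →ₗ[K] (Multiset ι →₀ K) →ₗ[K] (Multiset ι →₀ K)
  | 0 => ofBasis b fun i m => mono K (i ::ₘ m)
  | n + 1 => ofBasis b fun i m =>
      -- If the least variable j of m = j m' lies below i, the rule is forced by x_i x_j m' = x_j
      -- x_i m' + [x_i, x_j] m'. The part of x_i m' equal to the monomial i m' contributes the
      -- leading monomial i m. Only the lower-degree remainder is acted on by x_j through the
      -- previous approximation.
      if h : ∃ j ∈ m, j < i ∧ ∀ k ∈ m, j ≤ k then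
        mono K (i ::ₘ m) + pbwAux n (b h.choose) (pbwAux n (b i) (mono K (m.erase h.choose)) -
          mono K (i ::ₘ m.erase h.choose)) + pbwAux n ⁅b i, b h.choose⁆ (mono K (m.erase h.choose))
      else mono K (i ::ₘ m)

theorem pbwAux_succ_of_lt (n : ℕ) {i j : ι} (m : Multiset ι) (hij : j < i) (hj : ∀ k ∈ m, j ≤ k) :
    pbwAux b (n + 1) (b i) (mono K (j ::ₘ m)) = mono K (i ::ₘ j ::ₘ m) +
      pbwAux b n (b j) (pbwAux b n (b i) (mono K m) - mono K (i ::ₘ m)) +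
      pbwAux b n ⁅b i, b j⁆ (mono K m) := by
  have h : ∃ j' ∈ j ::ₘ m, j' < i ∧ ∀ k ∈ j ::ₘ m, j' ≤ k :=
    ⟨j, Multiset.mem_cons_self j m, hij, fun k hk => by
      rcases Multiset.mem_cons.1 hk with rfl | hk
      · exact le_rfl
      · exact hj k hk⟩
  have hc : h.choose = j := by
    obtain ⟨h1, h2, h3⟩ := h.choose_spec
    refine le_antisymm (h3 j (Multiset.mem_cons_self j m)) ?_
    rcases Multiset.mem_cons.1 h1 with h1 | h1
    · exact h1.ge
    · exact hj _ h1
  rw [pbwAux, ofBasis_apply, dif_pos h, hc, Multiset.erase_cons_head]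

theorem pbwAux_of_le (n : ℕ) {i : ι} (m : Multiset ι) (hi : ∀ k ∈ m, i ≤ k) :
    pbwAux b n (b i) (mono K m) = mono K (i ::ₘ m) := by
  cases n with
  | zero => rw [pbwAux, ofBasis_apply]
  | succ n =>
    rw [pbwAux, ofBasis_apply, dif_neg]
    rintro ⟨j, hj, hji, -⟩
    exact absurd (hi j hj) (not_le.2 hji)

theorem le_or_exists_cons (i : ι) (m : Multiset ι) :
    (∀ k ∈ m, i ≤ k) ∨ ∃ j m', m = j ::ₘ m' ∧ j < i ∧ ∀ k ∈ m', j ≤ k := by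
  by_cases h : ∀ k ∈ m, i ≤ k
  · exact Or.inl h
  · push Not at h
    obtain ⟨k, hk, hki⟩ := h
    obtain ⟨j, hj, hmin⟩ := m.toFinset.exists_min_image id ⟨k, Multiset.mem_toFinset.2 hk⟩
    have hj' := Multiset.mem_toFinset.1 hj
    refine Or.inr ⟨j, m.erase j, (Multiset.cons_erase hj').symm,
      lt_of_le_of_lt (hmin k (Multiset.mem_toFinset.2 hk)) hki, fun k' hk' =>
        hmin k' (Multiset.mem_toFinset.2 (Multiset.mem_of_mem_erase hk'))⟩

theorem mem_degLT_of_sub {f : L →ₗ[K] (Multiset ι →₀ K) →ₗ[K] (Multiset ι →₀ K)}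
    (h : ∀ i (m : Multiset ι), f (b i) (mono K m) - mono K (i ::ₘ m) ∈
      degLT K ι (Multiset.card m + 1)) (x : L) {p : ℕ} {v : Multiset ι →₀ K}
    (hv : v ∈ degLT K ι p) : f x v ∈ degLT K ι (p + 1) := by
  refine bilin_mem b f _ p (fun i m hm => ?_) x hv
  have h1 := Submodule.add_mem _ (degLT_mono (by omega : _ ≤ p + 1) (h i m))
    (mono_mem_degLT (K := K) (m := i ::ₘ m) (p := p + 1) (by simpa using hm))
  rwa [sub_add_cancel] at h1

/-- For m = j m', each correction term is one operator applied to a polynomial of degree at most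
that of m', and by induction an operator raises the degree by at most one. -/
theorem pbwAux_sub_mem (n : ℕ) (i : ι) (m : Multiset ι) :
    pbwAux b n (b i) (mono K m) - mono K (i ::ₘ m) ∈ degLT K ι (Multiset.card m + 1) := by
  induction n generalizing i m with
  | zero => simp [pbwAux, ofBasis_apply]
  | succ n ih =>
    rcases le_or_exists_cons i m with h | ⟨j, m, rfl, hij, hj⟩
    · simp [pbwAux_of_le b _ m h]
    · rw [pbwAux_succ_of_lt b n m hij hj, add_assoc, add_sub_cancel_left, Multiset.card_cons]
      exact Submodule.add_mem _ (mem_degLT_of_sub b ih _ (ih i m))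
        (mem_degLT_of_sub b ih _ (mono_mem_degLT (Nat.lt_succ_self _)))

/-- The correction terms for a monomial j m' evaluate the previous approximation only in degrees up
to that of m', where the induction hypothesis applies. Hence the approximations stop changing once
the index reaches the degree. -/
theorem pbwAux_stable (n : ℕ) (i : ι) (m : Multiset ι) (h : Multiset.card m < n + 1) :
    pbwAux b (n + 1) (b i) (mono K m) = pbwAux b n (b i) (mono K m) := by
  induction n generalizing i m with
  | zero =>
    obtain rfl : m = 0 := Multiset.card_eq_zero.1 (by omega)
    rw [pbwAux_of_le b _ _ (by simp), pbwAux_of_le b _ _ (by simp)]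
  | succ n ih =>
    rcases le_or_exists_cons i m with h' | ⟨j, m, rfl, hij, hj⟩
    · rw [pbwAux_of_le b _ m h', pbwAux_of_le b _ m h']
    · rw [Multiset.card_cons] at h
      have hm : Multiset.card m < n + 1 := by omega
      rw [pbwAux_succ_of_lt b _ m hij hj, pbwAux_succ_of_lt b _ m hij hj, ih i m hm]
      refine congrArg₂ (· + ·) (congrArg₂ (· + ·) rfl ?_) ?_
      · exact bilin_eq b _ _ (n + 1) ih _ (degLT_mono (by omega) (pbwAux_sub_mem b n i m))
      · exact bilin_eq b _ _ (n + 1) ih _ (mono_mem_degLT hm)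

/-- The action of `L` on polynomials in a basis of `L` that corresponds to the left regular action
on the enveloping algebra, written in the basis of ordered monomials. -/
noncomputable def pbw : L →ₗ[K] (Multiset ι →₀ K) →ₗ[K] (Multiset ι →₀ K) :=
  ofBasis b fun i m => pbwAux b (Multiset.card m) (b i) (mono K m)

theorem pbw_eq_pbwAux (n : ℕ) (x : L) {v : Multiset ι →₀ K} (hv : v ∈ degLT K ι (n + 1)) :
    pbw b x v = pbwAux b n x v := by
  refine bilin_eq b _ _ (n + 1) (fun i m hm => ?_) x hv
  rw [pbw, ofBasis_apply]
  obtain ⟨d, rfl⟩ := Nat.exists_eq_add_of_le (Nat.lt_succ_iff.1 hm)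
  clear hm hv
  induction d with
  | zero => rfl
  | succ d ih => rw [ih, ← add_assoc, pbwAux_stable b _ i m (by omega)]

theorem pbw_of_le {i : ι} (m : Multiset ι) (hi : ∀ k ∈ m, i ≤ k) :
    pbw b (b i) (mono K m) = mono K (i ::ₘ m) := by
  rw [pbw, ofBasis_apply, pbwAux_of_le b _ m hi]

theorem pbw_sub_mem (i : ι) (m : Multiset ι) :
    pbw b (b i) (mono K m) - mono K (i ::ₘ m) ∈ degLT K ι (Multiset.card m + 1) := by
  rw [pbw, ofBasis_apply]
  exact pbwAux_sub_mem b _ i m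

theorem pbw_mem (x : L) {p : ℕ} {v : Multiset ι →₀ K} (hv : v ∈ degLT K ι p) :
    pbw b x v ∈ degLT K ι (p + 1) :=
  mem_degLT_of_sub b (pbw_sub_mem b) x hv

theorem pbw_of_lt {i j : ι} (m : Multiset ι) (hij : j < i) (hj : ∀ k ∈ m, j ≤ k) :
    pbw b (b i) (mono K (j ::ₘ m)) = mono K (i ::ₘ j ::ₘ m) +
      pbw b (b j) (pbw b (b i) (mono K m) - mono K (i ::ₘ m)) + pbw b ⁅b i, b j⁆ (mono K m) := by
  have hm : mono K m ∈ degLT K ι (Multiset.card m + 1) := mono_mem_degLT (Nat.lt_succ_self _)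
  rw [pbw_eq_pbwAux b (Multiset.card m + 1) (b i) (mono_mem_degLT (by simp)),
    pbwAux_succ_of_lt b _ m hij hj, pbw_eq_pbwAux b _ ⁅b i, b j⁆ hm, pbw_eq_pbwAux b _ (b i) hm,
    pbw_eq_pbwAux b _ (b j) (pbwAux_sub_mem b _ i m)]

/-- The defect of the Lie action property. -/
noncomputable def pbwDefect :
    L →ₗ[K] L →ₗ[K] (Multiset ι →₀ K) →ₗ[K] (Multiset ι →₀ K) :=
  LinearMap.mk₂ K (fun x y => pbw b x ∘ₗ pbw b y - pbw b y ∘ₗ pbw b x - pbw b ⁅x, y⁆)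
    (by intro x x' y; simp [LinearMap.add_comp, LinearMap.comp_add]; abel)
    (by intro c x y; refine LinearMap.ext fun v => ?_; simp [smul_sub])
    (by intro x y y'; simp [LinearMap.add_comp, LinearMap.comp_add]; abel)
    (by intro c x y; refine LinearMap.ext fun v => ?_; simp [smul_sub])

theorem pbwDefect_apply (x y : L) (v : Multiset ι →₀ K) :
    pbwDefect b x y v = pbw b x (pbw b y v) - pbw b y (pbw b x v) - pbw b ⁅x, y⁆ v := rfl

theorem pbwDefect_skew (x y : L) (v : Multiset ι →₀ K) :
    pbwDefect b x y v = - pbwDefect b y x v := by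
  rw [pbwDefect_apply, pbwDefect_apply, ← lie_skew x y, map_neg, LinearMap.neg_apply]
  abel

/-- Here x_j m and x_j (i m) are plain monomials, so the recursion defining x_i (x_j m) is itself
the commutation relation. -/
theorem pbwDefect_of_le {i j : ι} (m : Multiset ι) (hij : j < i) (hj : ∀ k ∈ m, j ≤ k) :
    pbwDefect b (b i) (b j) (mono K m) = 0 := by
  have hj' : ∀ k ∈ i ::ₘ m, j ≤ k := fun k hk => by
    rcases Multiset.mem_cons.1 hk with rfl | hk
    · exact hij.le
    · exact hj k hk
  rw [pbwDefect_apply, pbw_of_le b m hj, pbw_of_lt b m hij hj, map_sub, pbw_of_le b _ hj',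
    Multiset.cons_swap]
  abel

/-- Induction on the degree of m, with j < i by skew-symmetry. If j is at most every variable of m,
the relation holds by construction. Otherwise the least variable k of m = k m' lies below both i and
j. Moving x_k to the left in x_i x_j x_k m' and x_j x_i x_k m' leaves relations on lower degrees and
one instance of the Jacobi identity. -/
theorem pbwDefect_eq_zero_aux (n : ℕ) : ∀ (i j : ι) (m : Multiset ι), Multiset.card m < n →
    pbwDefect b (b i) (b j) (mono K m) = 0 := by
  induction n with
  | zero => intro i j m h; omega
  | succ n ih =>
    have key : ∀ (i j : ι) (m : Multiset ι), Multiset.card m < n + 1 → j < i →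
        pbwDefect b (b i) (b j) (mono K m) = 0 := by
      intro i j m hm hij
      rcases le_or_exists_cons j m with h | ⟨k, m, rfl, hkj, hk⟩
      · exact pbwDefect_of_le b m hij h
      rw [Multiset.card_cons] at hm
      have hm' : mono K m ∈ degLT K ι n := mono_mem_degLT (by omega)
      have IH : ∀ (x y : L) {v : Multiset ι →₀ K}, v ∈ degLT K ι n → pbwDefect b x y v = 0 := by
        intro x y v hv
        refine (Submodule.mem_bot K).1 (mem_of_basis b ((pbwDefect b).flip y |>.flip v) ⊥ ?_ x)
        intro i
        exact bilin_mem b (pbwDefect b (b i)) ⊥ n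
          (fun j m hm => (Submodule.mem_bot K).2 (ih i j m hm)) y hv
      have IH' : ∀ (x y : L) {v : Multiset ι →₀ K}, v ∈ degLT K ι n →
          pbw b x (pbw b y v) = pbw b y (pbw b x v) + pbw b ⁅x, y⁆ v := by
        intro x y v hv
        have := IH x y hv
        rw [pbwDefect_apply, sub_sub, sub_eq_zero] at this
        exact this
      have hz : mono K (k ::ₘ m) = pbw b (b k) (mono K m) := (pbw_of_le b m hk).symm
      -- x_j m' is the monomial j m' plus terms of degree at most that of m'. The relation between
      -- x_i and x_k holds on the monomial because k is minimal in it, and on the other terms by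
      -- induction.
      have hC : ∀ i j : ι, k < i → k < j → pbw b (b i) (pbw b (b k) (pbw b (b j) (mono K m))) =
          pbw b (b k) (pbw b (b i) (pbw b (b j) (mono K m))) +
            pbw b ⁅b i, b k⁆ (pbw b (b j) (mono K m)) := by
        intro i j hki hkj
        have h1 : pbwDefect b (b i) (b k) (mono K (j ::ₘ m)) = 0 := by
          apply pbwDefect_of_le b _ hki
          intro l hl
          rcases Multiset.mem_cons.1 hl with rfl | hl
          · exact hkj.le
          · exact hk l hl
        have h2 := IH (b i) (b k) (degLT_mono (by omega : _ ≤ n) (pbw_sub_mem b j m))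
        rw [map_sub, h1, sub_zero, pbwDefect_apply, sub_sub, sub_eq_zero] at h2
        exact h2
      have hexp : ∀ i j : ι, k < i → k < j → pbw b (b i) (pbw b (b j) (mono K (k ::ₘ m))) =
          pbw b (b k) (pbw b (b i) (pbw b (b j) (mono K m))) +
            pbw b ⁅b i, b k⁆ (pbw b (b j) (mono K m)) +
            (pbw b ⁅b j, b k⁆ (pbw b (b i) (mono K m)) + pbw b ⁅b i, ⁅b j, b k⁆⁆ (mono K m)) := by
        intro i j hki hkj
        rw [hz, IH' (b j) (b k) hm', map_add, hC i j hki hkj, IH' (b i) ⁅b j, b k⁆ hm']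
      rw [pbwDefect_apply, hexp i j (hkj.trans hij) hkj, hexp j i hkj (hkj.trans hij), hz,
        IH' ⁅b i, b j⁆ (b k) hm', IH' (b i) (b j) hm', map_add]
      have hJ : ⁅⁅b i, b j⁆, b k⁆ = ⁅b i, ⁅b j, b k⁆⁆ - ⁅b j, ⁅b i, b k⁆⁆ := lie_lie _ _ _
      rw [hJ, map_sub, LinearMap.sub_apply]
      abel
    intro i j m hm
    rcases lt_trichotomy i j with h | rfl | h
    · rw [pbwDefect_skew, key j i m hm h, neg_zero]
    · simp [pbwDefect_apply]
    · exact key i j m hm h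

theorem pbw_lie (x y : L) (v : Multiset ι →₀ K) :
    pbw b ⁅x, y⁆ v = pbw b x (pbw b y v) - pbw b y (pbw b x v) := by
  obtain ⟨n, hv⟩ := exists_mem_degLT v
  have h : pbwDefect b x y v = 0 := by
    refine (Submodule.mem_bot K).1 (mem_of_basis b ((pbwDefect b).flip y |>.flip v) ⊥ ?_ x)
    intro i
    exact bilin_mem b (pbwDefect b (b i)) ⊥ n
      (fun j m hm => (Submodule.mem_bot K).2 (pbwDefect_eq_zero_aux b n i j m hm)) y hv
  rw [pbwDefect_apply, sub_eq_zero] at h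
  exact h.symm

end PBW

/-! ### A deformation of the symmetric algebra with its Euler field -/

section EulerFiltration

/-- The image of `L ⊗ G` in `L ⊗ S`. -/
def tensorSub {K : Type*} (L : Type*) {S : Type*} [Field K] [AddCommGroup L] [Module K L]
    [AddCommGroup S] [Module K S] (G : Submodule K S) : Submodule K (L ⊗[K] S) :=
  LinearMap.range (LinearMap.lTensor L G.subtype)

theorem tmul_mem_tensorSub {K L S : Type*} [Field K] [AddCommGroup L] [Module K L]
    [AddCommGroup S] [Module K S] {G : Submodule K S} (x : L) {z : S} (hz : z ∈ G) :
    x ⊗ₜ[K] z ∈ tensorSub L G :=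
  ⟨x ⊗ₜ ⟨z, hz⟩, by simp⟩

/-- A linear map on `L ⊗ S` maps `L ⊗ G` into `U` if it maps the pure tensors there. -/
theorem map_mem_of_mem_tensorSub {K L S N : Type*} [Field K] [AddCommGroup L] [Module K L]
    [AddCommGroup S] [Module K S] [AddCommGroup N] [Module K N] {G : Submodule K S}
    (φ : L ⊗[K] S →ₗ[K] N) (U : Submodule K N) (h : ∀ x, ∀ z ∈ G, φ (x ⊗ₜ z) ∈ U)
    {t : L ⊗[K] S} (ht : t ∈ tensorSub L G) : φ t ∈ U := by
  obtain ⟨t, rfl⟩ := ht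
  induction t with
  | zero => simp
  | tmul x z => exact h x z z.2
  | add s t hs ht => rw [map_add, map_add]; exact U.add_mem hs ht

/-- A Lie module `S` with a filtration `G` and a map `Δ : S → L ⊗ S` which behave, up to terms of
lower degree, like the symmetric algebra of `L`, filtered by the degree, with its de Rham
differential; `ε` is an invariant functional with `ε 1 = 1`. -/
structure EulerFiltration (K L S : Type*) [Field K] [LieRing L] [LieAlgebra K L] [AddCommGroup S]
    [Module K S] [LieRingModule L S] [LieModule K L S] where
  /-- The filtration. -/
  G : ℕ → Submodule K S
  /-- The de Rham differential. -/
  Δ : S →ₗ[K] L ⊗[K] S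
  /-- The augmentation. -/
  ε : S →ₗ[K] K
  /-- The unit. -/
  one : S
  G_zero : G 0 = ⊥
  G_mono : Monotone G
  exists_mem : ∀ z, ∃ q, z ∈ G q
  lie_mem : ∀ (x : L) {q : ℕ} {z : S}, z ∈ G q → ⁅x, z⁆ ∈ G (q + 1)
  Δ_mem : ∀ {q : ℕ} {z : S}, z ∈ G (q + 1) → Δ z ∈ tensorSub L (G q)
  -- `G (q + 1)` models polynomials of degree at most `q`, so the Euler field has eigenvalue `q` on
  -- its top part.
  euler : ∀ {q : ℕ} {z : S}, z ∈ G (q + 1) →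
    TensorProduct.lift (LieModule.toEnd K L S : L →ₗ[K] Module.End K S) (Δ z) - (q : K) • z ∈ G q
  -- The Leibniz rule d(x z) = x ⊗ z + x dz, to leading order.
  Δ_lie : ∀ (x : L) {q : ℕ} {z : S}, z ∈ G (q + 1) →
    Δ ⁅x, z⁆ - x ⊗ₜ z - LinearMap.lTensor L (LieModule.toEnd K L S x) (Δ z) ∈ tensorSub L (G q)
  ε_lie : ∀ (x : L) (z : S), ε ⁅x, z⁆ = 0
  ε_one : ε one = 1

variable {K L ι : Type*} [Field K] [LieRing L] [LieAlgebra K L] [LinearOrder ι]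
  (b : Module.Basis ι K L)

/-- Polynomials in a basis of `L`, with the action `pbw` of `L`. -/
def PBWModule (_b : Module.Basis ι K L) : Type _ := Multiset ι →₀ K

noncomputable instance : AddCommGroup (PBWModule b) := inferInstanceAs (AddCommGroup (_ →₀ K))

noncomputable instance : Module K (PBWModule b) := inferInstanceAs (Module K (_ →₀ K))

noncomputable instance : LieRingModule L (PBWModule b) where
  bracket x z := pbw b x z
  add_lie x y z := by
    change pbw b (x + y) z = pbw b x z + pbw b y z
    rw [map_add]; rfl
  lie_add x z z' := map_add (pbw b x) z z'
  leibniz_lie x y z := by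
    change pbw b x (pbw b y z) = pbw b ⁅x, y⁆ z + pbw b y (pbw b x z)
    exact ((congrArg (· + _) (pbw_lie b x y z)).trans (sub_add_cancel _ _)).symm

instance : LieModule K L (PBWModule b) where
  smul_lie c x z := by
    change pbw b (c • x) z = c • pbw b x z
    rw [map_smul]; rfl
  lie_smul c x z := map_smul (pbw b x) c z

/-- The de Rham differential on polynomials. -/
noncomputable def pbwΔ : (Multiset ι →₀ K) →ₗ[K] L ⊗[K] (Multiset ι →₀ K) :=
  Finsupp.linearCombination K fun m => (m.map fun i => b i ⊗ₜ[K] mono K (m.erase i)).sum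

theorem pbwΔ_mono (m : Multiset ι) :
    pbwΔ b (mono K m) = (m.map fun i => b i ⊗ₜ[K] mono K (m.erase i)).sum := by
  rw [pbwΔ, mono, Finsupp.linearCombination_single, one_smul]

theorem pbwΔ_mono_cons (i : ι) (m : Multiset ι) :
    pbwΔ b (mono K (i ::ₘ m)) = b i ⊗ₜ mono K m +
      (m.map fun k => b k ⊗ₜ[K] mono K (i ::ₘ m.erase k)).sum := by
  rw [pbwΔ_mono, Multiset.map_cons, Multiset.sum_cons, Multiset.erase_cons_head]
  congr 2
  refine Multiset.map_congr rfl fun k hk => ?_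
  rw [Multiset.erase_cons_tail_of_mem hk]

theorem pbwΔ_mem {q : ℕ} {z : Multiset ι →₀ K} (hz : z ∈ degLT K ι (q + 1)) :
    pbwΔ b z ∈ tensorSub L (degLT K ι q) := by
  refine degLT_le_comap (pbwΔ b) _ (q + 1) (fun m hm => ?_) hz
  rw [pbwΔ_mono]
  refine multiset_sum_mem _ fun t ht => ?_
  obtain ⟨i, hi, rfl⟩ := Multiset.mem_map.1 ht
  have := Multiset.card_pos_iff_exists_mem.2 ⟨i, hi⟩
  refine tmul_mem_tensorSub _ (mono_mem_degLT ?_)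
  rw [Multiset.card_erase_of_mem hi, Nat.pred_eq_sub_one]
  omega

/-- Replacing x_i (m / i) by the monomial m costs only terms of lower degree. The sum over the
variables of m then counts m once for each variable, with multiplicity. -/
theorem pbw_euler {q : ℕ} {z : Multiset ι →₀ K} (hz : z ∈ degLT K ι (q + 1)) :
    TensorProduct.lift (pbw b) (pbwΔ b z) - (q : K) • z ∈ degLT K ι q := by
  refine degLT_le_comap (TensorProduct.lift (pbw b) ∘ₗ pbwΔ b - (q : K) • LinearMap.id) _ (q + 1)
    (fun m hm => ?_) hz
  -- The sum runs over a sub-multiset `m'`, so that induction on `m'` can proceed while `m` stays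
  -- fixed.
  have h : ∀ m' : Multiset ι, m' ≤ m → (m'.map fun i =>
      pbw b (b i) (mono K (m.erase i))).sum - (Multiset.card m' : K) • mono K m ∈
        degLT K ι (Multiset.card m) := by
    intro m'
    induction m' using Multiset.induction with
    | empty => intro _; simp
    | cons i m' ih =>
      intro hm'
      have hi : i ∈ m := Multiset.mem_of_le hm' (Multiset.mem_cons_self i m')
      have h1 := Submodule.add_mem _ (ih ((Multiset.le_cons_self m' i).trans hm'))
        (degLT_mono ?_ (pbw_sub_mem b i (m.erase i)))
      · rw [Multiset.cons_erase hi] at h1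
        rw [Multiset.map_cons, Multiset.sum_cons, Multiset.card_cons, Nat.cast_add, Nat.cast_one,
          add_smul, one_smul]
        convert h1 using 1
        abel
      · have := Multiset.card_pos_iff_exists_mem.2 ⟨i, hi⟩
        rw [Multiset.card_erase_of_mem hi, Nat.pred_eq_sub_one]
        omega
  have h2 := h m le_rfl
  have h3 : TensorProduct.lift (pbw b) (pbwΔ b (mono K m)) =
      (m.map fun i => pbw b (b i) (mono K (m.erase i))).sum := by
    rw [pbwΔ_mono, map_multiset_sum, Multiset.map_map]
    rfl
  change TensorProduct.lift (pbw b) (pbwΔ b (mono K m)) - (q : K) • mono K m ∈ _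
  rw [h3]
  -- Below the top degree the monomial already lies in the filtration step, so the mismatch between
  -- its degree and `q` is harmless.
  rcases Nat.lt_succ_iff_lt_or_eq.1 hm with h4 | h4
  · have h5 := Submodule.add_mem _ (degLT_mono h4.le h2) (Submodule.smul_mem _
      (Multiset.card m : K) (mono_mem_degLT (K := K) h4))
    rw [sub_add_cancel] at h5
    exact Submodule.sub_mem _ h5 (Submodule.smul_mem _ _ (mono_mem_degLT h4))
  · rw [h4] at h2
    exact h2

/-- Up to lower degree x_i m is the monomial i m, whose differential is b_i ⊗ m plus the sum of the
b_k ⊗ i (m / k). Replacing each monomial i (m / k) by x_i (m / k) again costs only lower degree. -/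
theorem pbwΔ_pbw (x : L) {q : ℕ} {z : Multiset ι →₀ K} (hz : z ∈ degLT K ι (q + 1)) :
    pbwΔ b (pbw b x z) - x ⊗ₜ z - LinearMap.lTensor L (pbw b x) (pbwΔ b z) ∈
      tensorSub L (degLT K ι q) := by
  refine bilin_mem b ((LinearMap.compRight K (pbwΔ b)) ∘ₗ pbw b - TensorProduct.mk K L _ -
    (LinearMap.llcomp K _ _ _).flip (pbwΔ b) ∘ₗ
      (LinearMap.lTensorHom L : _ →ₗ[K] (L ⊗[K] _ →ₗ[K] L ⊗[K] _)) ∘ₗ pbw b) _ (q + 1)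
    (fun i m hm => ?_) x hz
  change pbwΔ b (pbw b (b i) (mono K m)) - b i ⊗ₜ mono K m -
    LinearMap.lTensor L (pbw b (b i)) (pbwΔ b (mono K m)) ∈ _
  have h1 : pbwΔ b (pbw b (b i) (mono K m)) - pbwΔ b (mono K (i ::ₘ m)) ∈
      tensorSub L (degLT K ι q) := by
    rw [← map_sub]
    exact pbwΔ_mem b (degLT_mono (by omega) (pbw_sub_mem b i m))
  have h2 : (m.map fun k => b k ⊗ₜ[K] mono K (i ::ₘ m.erase k)).sum -
      LinearMap.lTensor L (pbw b (b i)) (pbwΔ b (mono K m)) ∈ tensorSub L (degLT K ι q) := by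
    rw [pbwΔ_mono, map_multiset_sum, Multiset.map_map, ← Multiset.sum_map_sub]
    refine multiset_sum_mem _ fun t ht => ?_
    obtain ⟨k, hk, rfl⟩ := Multiset.mem_map.1 ht
    have := Multiset.card_pos_iff_exists_mem.2 ⟨k, hk⟩
    rw [Function.comp_apply, LinearMap.lTensor_tmul, ← TensorProduct.tmul_sub, ← neg_sub,
      TensorProduct.tmul_neg]
    refine Submodule.neg_mem _ (tmul_mem_tensorSub _ (degLT_mono ?_ (pbw_sub_mem b i _)))
    rw [Multiset.card_erase_of_mem hk, Nat.pred_eq_sub_one]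
    omega
  have h3 := Submodule.add_mem _ h1 h2
  rw [pbwΔ_mono_cons] at h3
  convert h3 using 1
  abel

/-- The constant term of a polynomial. -/
noncomputable def pbwε : (Multiset ι →₀ K) →ₗ[K] K := Finsupp.lapply 0

/-- Every value is a combination of nonconstant monomials and of values of the previous
approximation, so no constant term ever appears. -/
theorem pbwAux_ε (n : ℕ) (x : L) (z : Multiset ι →₀ K) : pbwε (pbwAux b n x z) = 0 := by
  induction n generalizing x z with
  | zero =>
    obtain ⟨p, hz⟩ := exists_mem_degLT z
    refine (Submodule.mem_bot K).1 (bilin_mem b (LinearMap.compRight K pbwε ∘ₗ pbwAux b 0) ⊥ p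
      (fun i m _ => ?_) x hz)
    change pbwε (pbwAux b 0 (b i) (mono K m)) = 0
    rw [pbwAux, ofBasis_apply]
    simp [pbwε, mono]
  | succ n ih =>
    obtain ⟨p, hz⟩ := exists_mem_degLT z
    refine (Submodule.mem_bot K).1 (bilin_mem b (LinearMap.compRight K pbwε ∘ₗ pbwAux b (n + 1)) ⊥ p
      (fun i m _ => ?_) x hz)
    change pbwε (pbwAux b (n + 1) (b i) (mono K m)) = 0
    have h0 : ∀ m : Multiset ι, pbwε (mono K (i ::ₘ m)) = 0 := fun m => by simp [pbwε, mono]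
    rcases le_or_exists_cons i m with h | ⟨j, m, rfl, hij, hj⟩
    · rw [pbwAux_of_le b _ m h, h0]
    · rw [pbwAux_succ_of_lt b n m hij hj, map_add, map_add, ih, ih, h0, add_zero, add_zero]

theorem pbw_ε (x : L) (z : Multiset ι →₀ K) : pbwε (pbw b x z) = 0 := by
  obtain ⟨p, hz⟩ := exists_mem_degLT z
  rw [pbw_eq_pbwAux b p x (degLT_mono (Nat.le_succ p) hz), pbwAux_ε]

/-- The filtration of `PBWModule` by the degree. -/
noncomputable def pbwFiltration : EulerFiltration K L (PBWModule b) where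
  G := degLT K ι
  Δ := pbwΔ b
  ε := pbwε
  one := mono K 0
  G_zero := degLT_zero
  G_mono _ _ h := degLT_mono h
  exists_mem := exists_mem_degLT
  lie_mem x _ _ hz := pbw_mem b x hz
  Δ_mem hz := pbwΔ_mem b hz
  euler hz := pbw_euler b hz
  Δ_lie x _ _ hz := pbwΔ_pbw b x hz
  ε_lie x z := pbw_ε b x z
  ε_one := Finsupp.single_eq_same

end EulerFiltration

/-! ### Vanishing of Lie algebra cohomology with coefficients in Hom(S, N) -/

section CoinducedAcyclic

variable {K L S N : Type*} [Field K] [LieRing L] [LieAlgebra K L] [AddCommGroup S]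
  [Module K S] [LieRingModule L S] [LieModule K L S] [AddCommGroup N] [Module K N]
  [LieRingModule L N] [LieModule K L N]

/-- An alternating map with values in linear maps, from a linear map with values in alternating
maps. -/
def flipAlternating {W : Type*} [AddCommGroup W] [Module K W] {n : ℕ}
    (F : L →ₗ[K] L [⋀^Fin n]→ₗ[K] W) : L [⋀^Fin n]→ₗ[K] (L →ₗ[K] W) where
  toFun w :=
    { toFun := fun x => F x w
      map_add' := fun x y => by rw [map_add]; rfl
      map_smul' := fun c x => by rw [map_smul]; rfl }
  map_update_add' w i x y := by
    ext a
    exact (F a).map_update_add w i x y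
  map_update_smul' w i c x := by
    ext a
    exact (F a).map_update_smul w i c x
  map_eq_zero_of_eq' w i j h hij := by
    ext a
    exact (F a).map_eq_zero_of_eq w h hij

/-- Contraction of `x ↦ g x` with `Δ`. -/
noncomputable def contractΔ (E : EulerFiltration K L S) :
    (L →ₗ[K] S →ₗ[K] N) →ₗ[K] (S →ₗ[K] N) where
  toFun g := TensorProduct.lift g ∘ₗ E.Δ
  map_add' g g' := by
    rw [← LinearMap.add_comp]
    congr 1
    apply TensorProduct.ext'
    intro x z
    simp
  map_smul' c g := by
    rw [RingHom.id_apply, ← LinearMap.smul_comp]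
    congr 1
    apply TensorProduct.ext'
    intro x z
    simp

/-- The contraction of a cochain with the Euler field. -/
noncomputable def eulerContract (E : EulerFiltration K L S) (n : ℕ)
    (f : L [⋀^Fin (n + 1)]→ₗ[K] (S →ₗ[K] N)) : L [⋀^Fin n]→ₗ[K] (S →ₗ[K] N) :=
  (contractΔ E).compAlternatingMap (flipAlternating f.curryLeft)

/-- When all values of `f` kill `z`, only the action of L on the argument `z` survives in the
coboundary. The action on `N` and the bracket terms of L drop out, which is why `N` plays no part in
the homotopy. -/
theorem ceD_apply_of_vanish (n : ℕ) (f : L [⋀^Fin n]→ₗ[K] (S →ₗ[K] N)) (w : Fin (n + 1) → L)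
    (z : S) (hz : ∀ w, f w z = 0) :
    ceD n f w z = - ∑ i : Fin (n + 1), (-1 : ℤ) ^ (i : ℕ) • f (i.removeNth w) ⁅w i, z⁆ := by
  have h : ceD n f w = ∑ i : Fin (n + 1), (-1 : ℤ) ^ (i : ℕ) • ⁅w i, f (i.removeNth w)⁆ +
      ∑ p : Fin (n + 1), ∑ q : Fin (n + 1), if p < q then
        (-1 : ℤ) ^ ((p : ℕ) + 1) • f (p.removeNth (Function.update w q ⁅w p, w q⁆)) else 0 := rfl
  rw [h, LinearMap.add_apply, LinearMap.sum_apply, LinearMap.sum_apply, ← Finset.sum_neg_distrib]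
  have h2 : ∀ p : Fin (n + 1), (∑ q : Fin (n + 1), if p < q then
        (-1 : ℤ) ^ ((p : ℕ) + 1) • f (p.removeNth (Function.update w q ⁅w p, w q⁆)) else 0) z =
      0 := by
    intro p
    rw [LinearMap.sum_apply]
    refine Finset.sum_eq_zero fun q _ => ?_
    split_ifs
    · rw [LinearMap.smul_apply, hz, smul_zero]
    · rfl
  rw [Finset.sum_eq_zero (fun p _ => h2 p), add_zero]
  refine Finset.sum_congr rfl fun i _ => ?_
  rw [LinearMap.smul_apply, LieHom.lie_apply, hz, lie_zero, zero_sub, smul_neg]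

variable (E : EulerFiltration K L S)

/-- The cochain vanishes on the `q`-th step of the filtration. -/
def VanishesOn {n : ℕ} (q : ℕ) (f : L [⋀^Fin n]→ₗ[K] (S →ₗ[K] N)) : Prop :=
  ∀ w, ∀ z ∈ E.G q, f w z = 0

/-- This is how error terms disappear: the contraction of `f` only sees tensors modulo L ⊗ `G q`. -/
theorem lift_eq_zero {n q : ℕ} {f : L [⋀^Fin (n + 1)]→ₗ[K] (S →ₗ[K] N)} (hf : VanishesOn E q f)
    (w : Fin n → L) {t : L ⊗[K] S} (ht : t ∈ tensorSub L (E.G q)) :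
    TensorProduct.lift (flipAlternating f.curryLeft w) t = 0 :=
  (Submodule.mem_bot K).1 (map_mem_of_mem_tensorSub _ ⊥
    (fun x z hz => (Submodule.mem_bot K).2 (hf (Matrix.vecCons x w) z hz)) ht)

theorem eulerContract_vanishesOn {n q : ℕ} {f : L [⋀^Fin (n + 1)]→ₗ[K] (S →ₗ[K] N)}
    (hf : VanishesOn E q f) : VanishesOn E (q + 1) (eulerContract E n f) :=
  fun w _ hz => lift_eq_zero E hf w (E.Δ_mem hz)

/-- The homotopy formula, in the lowest degree. -/
theorem ceD_eulerContract {n q : ℕ} {f : L [⋀^Fin (n + 1)]→ₗ[K] (S →ₗ[K] N)}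
    (hc : ceD (n + 1) f = 0) (hf : VanishesOn E q f) (w : Fin (n + 1) → L) {z : S}
    (hz : z ∈ E.G (q + 1)) :
    ceD n (eulerContract E n f) w z = -((q + (n + 1) : ℕ) : K) • f w z := by
  rw [ceD_apply_of_vanish n _ w z (fun w => eulerContract_vanishesOn E hf w z hz)]
  -- The Leibniz rule for `E.Δ` splits each summand in two, its error being killed by `f`. The first
  -- pieces add up to n + 1 copies of `f w z`, the second to `q` copies.
  have h1 : ∀ i : Fin (n + 1), eulerContract E n f (i.removeNth w) ⁅w i, z⁆ =
      f (Matrix.vecCons (w i) (i.removeNth w)) z +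
        TensorProduct.lift (flipAlternating f.curryLeft (i.removeNth w))
          (LinearMap.lTensor L (LieModule.toEnd K L S (w i)) (E.Δ z)) := by
    intro i
    have := lift_eq_zero E hf (i.removeNth w) (E.Δ_lie (w i) hz)
    rw [map_sub, map_sub, sub_sub, sub_eq_zero] at this
    exact this
  have h2 : ∀ i : Fin (n + 1), (-1 : ℤ) ^ (i : ℕ) • f (Matrix.vecCons (w i) (i.removeNth w)) z =
      f w z := by
    intro i
    rw [← LinearMap.smul_apply, ← AlternatingMap.map_insertNth, Fin.insertNth_removeNth,
      Function.update_eq_self]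
  -- This is the cocycle condition at (x, w), evaluated on y ∈ `G q`. Since `f` itself vanishes on
  -- y, it says that f(w)([x, y]) is the alternating sum of the f(x, w without w_i)([w_i, y]).
  have h3 : ∀ t ∈ tensorSub L (E.G q),
      ∑ i : Fin (n + 1), (-1 : ℤ) ^ (i : ℕ) •
        TensorProduct.lift (flipAlternating f.curryLeft (i.removeNth w))
          (LinearMap.lTensor L (LieModule.toEnd K L S (w i)) t) =
      f w (TensorProduct.lift (LieModule.toEnd K L S : L →ₗ[K] Module.End K S) t) := by
    intro t ht
    rw [← sub_eq_zero]
    let Φ : L ⊗[K] S →ₗ[K] N := (∑ i : Fin (n + 1), (-1 : ℤ) ^ (i : ℕ) •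
        (TensorProduct.lift (flipAlternating f.curryLeft (i.removeNth w)) ∘ₗ
          (LinearMap.lTensor L (LieModule.toEnd K L S (w i)) : L ⊗[K] S →ₗ[K] L ⊗[K] S))) -
      f w ∘ₗ TensorProduct.lift (LieModule.toEnd K L S : L →ₗ[K] Module.End K S)
    have hΦ : ∀ x, ∀ y ∈ E.G q, Φ (x ⊗ₜ y) ∈ (⊥ : Submodule K N) := by
      intro x y hy
      rw [Submodule.mem_bot]
      have h4 := congrArg (fun F => F (Matrix.vecCons x w) y) hc
      have h5 : ceD (n + 1) f (Matrix.vecCons x w) y = 0 := h4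
      rw [ceD_apply_of_vanish _ _ _ _ (fun w => hf w y hy), Fin.sum_univ_succ, neg_eq_zero] at h5
      have h6 : ∀ i : Fin (n + 1), i.succ.removeNth (Matrix.vecCons x w) =
          Matrix.vecCons x (i.removeNth w) := by
        intro i
        funext k
        refine Fin.cases ?_ (fun k => ?_) k <;> simp [Fin.removeNth, Matrix.vecCons]
      simp only [h6, Fin.val_succ, pow_succ, Matrix.cons_val_succ, Matrix.cons_val_zero,
        Fin.val_zero, pow_zero, one_smul, mul_neg, mul_one, neg_smul,
        Finset.sum_neg_distrib] at h5
      have h7 : (0 : Fin (n + 1 + 1)).removeNth (Matrix.vecCons x w) = w := by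
        funext k; simp [Fin.removeNth]
      rw [h7] at h5
      rw [LinearMap.sub_apply, LinearMap.sum_apply, sub_eq_zero]
      refine Eq.trans ?_ (add_neg_eq_zero.1 h5).symm
      refine Finset.sum_congr rfl fun i _ => ?_
      rw [LinearMap.smul_apply]
      rfl
    have h := (Submodule.mem_bot K).1 (map_mem_of_mem_tensorSub Φ ⊥ hΦ ht)
    rw [LinearMap.sub_apply, LinearMap.sum_apply] at h
    exact h
  -- The Euler identity holds modulo `G q`, on which `f` vanishes.
  have h8 : f w (TensorProduct.lift (LieModule.toEnd K L S : L →ₗ[K] Module.End K S) (E.Δ z)) =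
      (q : K) • f w z := by
    have := hf w _ (E.euler hz)
    rw [map_sub, map_smul, sub_eq_zero] at this
    exact this
  simp only [h1, smul_add, h2, Finset.sum_add_distrib, h3 _ (E.Δ_mem hz), h8]
  rw [Finset.sum_const, Finset.card_univ, Fintype.card_fin, ← Nat.cast_smul_eq_nsmul K,
    ← add_smul, neg_smul, Nat.cast_add q, add_comm]

/-- A sequence of cochains which stabilizes on each step of the filtration has a limit. -/
theorem exists_limit {n : ℕ} (F : ℕ → L [⋀^Fin n]→ₗ[K] (S →ₗ[K] N))
    (hF : ∀ p q, p ≤ q → ∀ w, ∀ z ∈ E.G p, F q w z = F p w z) :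
    ∃ G : L [⋀^Fin n]→ₗ[K] (S →ₗ[K] N), ∀ p w, ∀ z ∈ E.G p, G w z = F p w z := by
  -- The limit at `z` is read off at any index whose filtration step contains `z`; `key` shows that
  -- the choice does not matter.
  choose d hd using E.exists_mem
  have key : ∀ p w, ∀ z ∈ E.G p, F (d z) w z = F p w z := by
    intro p w z hz
    rw [← hF p (max p (d z)) (le_max_left _ _) w z hz,
      ← hF (d z) (max p (d z)) (le_max_right _ _) w z (hd z)]
  refine ⟨{ toFun := fun w =>
              { toFun := fun z => F (d z) w z
                map_add' := fun z z' => ?_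
                map_smul' := fun c z => ?_ }
            map_update_add' := fun w i x y => ?_
            map_update_smul' := fun w i c x => ?_
            map_eq_zero_of_eq' := fun w i j h hij => ?_ }, key⟩
  · have h1 : z ∈ E.G (max (d z) (d z')) := E.G_mono (le_max_left _ _) (hd z)
    have h2 : z' ∈ E.G (max (d z) (d z')) := E.G_mono (le_max_right _ _) (hd z')
    rw [key _ w z h1, key _ w z' h2, key _ w (z + z') (Submodule.add_mem _ h1 h2), map_add]
  · rw [key (d z) w (c • z) (Submodule.smul_mem _ c (hd z)), map_smul]
    rfl
  · ext z
    exact congrArg (fun f => f z) ((F (d z)).map_update_add w i x y)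
  · ext z
    exact congrArg (fun f => f z) ((F (d z)).map_update_smul w i c x)
  · ext z
    exact congrArg (fun f => f z) ((F (d z)).map_eq_zero_of_eq w h hij)

variable [CharZero K]

/-- The Chevalley-Eilenberg cohomology of `Hom(S, N)` vanishes in positive degrees. -/
theorem exists_ceD_eq (E : EulerFiltration K L S) (n : ℕ) (f : L [⋀^Fin (n + 1)]→ₗ[K] (S →ₗ[K] N))
    (hf : ceD (n + 1) f = 0) : ∃ g, ceD n g = f := by
  -- The inverse of the factor in the homotopy formula for a cocycle vanishing on `G q`; the factor
  -- is nonzero because n + 1 > 0 and the characteristic is zero.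
  let c : ℕ → K := fun q => ((q + (n + 1) : ℕ) : K)⁻¹
  -- Successive corrections: `s q` is cohomologous to `f` and vanishes on `G q`, and the next
  -- coboundary cancels its leading part on `G (q + 1)`. `F q` collects the primitives used so far.
  let s : ℕ → L [⋀^Fin (n + 1)]→ₗ[K] (S →ₗ[K] N) := fun q =>
    Nat.rec f (fun q φ => φ + c q • ceD n (eulerContract E n φ)) q
  let F : ℕ → L [⋀^Fin n]→ₗ[K] (S →ₗ[K] N) := fun q =>
    ∑ r ∈ Finset.range q, c r • eulerContract E n (s r)
  have hs : ∀ q, s (q + 1) = s q + c q • ceD n (eulerContract E n (s q)) := fun _ => rfl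
  have hsc : ∀ q, ceD (n + 1) (s q) = 0 := by
    intro q
    induction q with
    | zero => exact hf
    | succ q ih => rw [hs, map_add, ih, map_smul, ceD_ceD, smul_zero, add_zero]
  have hsv : ∀ q, VanishesOn E q (s q) := by
    intro q
    induction q with
    | zero =>
      intro w z hz
      rw [E.G_zero, Submodule.mem_bot] at hz
      rw [hz, map_zero]
    | succ q ih =>
      intro w z hz
      rw [hs, AlternatingMap.add_apply, LinearMap.add_apply, AlternatingMap.smul_apply,
        LinearMap.smul_apply, ceD_eulerContract E (hsc q) ih w hz, smul_smul, mul_neg,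
        inv_mul_cancel₀ (Nat.cast_ne_zero.2 (by omega)), neg_one_smul, add_neg_cancel]
  have hsF : ∀ q, s q = f + ceD n (F q) := by
    intro q
    induction q with
    | zero => simp [F, s]
    | succ q ih =>
      rw [hs]
      nth_rewrite 1 [ih]
      simp only [F, Finset.sum_range_succ, map_add, map_smul, add_assoc]
  -- The summand with index r vanishes on `G (r + 1)`, so on `G p` only the summands with r < p
  -- contribute.
  have hF : ∀ p q, p ≤ q → ∀ w, ∀ z ∈ E.G p, F q w z = F p w z := by
    intro p q hpq w z hz
    obtain ⟨d, rfl⟩ := Nat.exists_eq_add_of_le hpq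
    induction d with
    | zero => rfl
    | succ d ih =>
      have h1 : F (p + (d + 1)) = F (p + d) + c (p + d) • eulerContract E n (s (p + d)) :=
        Finset.sum_range_succ _ _
      rw [h1, AlternatingMap.add_apply, LinearMap.add_apply, AlternatingMap.smul_apply,
        LinearMap.smul_apply, eulerContract_vanishesOn E (hsv (p + d)) w z
          (E.G_mono (by omega) hz), smul_zero, add_zero, ih (by omega)]
  obtain ⟨g, hg⟩ := exists_limit E F hF
  refine ⟨-g, ?_⟩
  ext w z
  obtain ⟨p, hz⟩ := E.exists_mem z
  -- The index is p + 1 because the coboundary at z ∈ `G p` also evaluates cochains at [w_i, z],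
  -- which lies in `G (p + 1)`.
  have h1 : ceD n (g - F (p + 1)) w z = 0 := by
    have hv : ∀ w, ∀ z ∈ E.G (p + 1), (g - F (p + 1)) w z = 0 := fun w z hz => by
      rw [AlternatingMap.sub_apply, LinearMap.sub_apply, hg _ w z hz, sub_self]
    rw [ceD_apply_of_vanish n _ w z (fun w => hv w z (E.G_mono (Nat.le_succ p) hz)),
      Finset.sum_eq_zero, neg_zero]
    intro i _
    rw [hv _ _ (E.lie_mem _ hz), smul_zero]
  have h2 : (f + ceD n (F (p + 1))) w z = 0 := by
    rw [← hsF]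
    exact hsv (p + 1) w z (E.G_mono (Nat.le_succ p) hz)
  rw [AlternatingMap.add_apply, LinearMap.add_apply] at h2
  rw [map_sub, AlternatingMap.sub_apply, LinearMap.sub_apply, sub_eq_zero] at h1
  rw [map_neg, AlternatingMap.neg_apply, LinearMap.neg_apply, h1]
  exact neg_eq_of_add_eq_zero_left h2

end CoinducedAcyclic

/-! ### Splitting short exact sequences over the field -/

section Splitting

variable {K V₁ V₂ V₃ : Type*} [Field K] [AddCommGroup V₁] [Module K V₁] [AddCommGroup V₂]
  [Module K V₂] [AddCommGroup V₃] [Module K V₃]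

theorem exists_splitting (f : V₁ →ₗ[K] V₂) (g : V₂ →ₗ[K] V₃) (hf : Function.Injective f)
    (hg : Function.Surjective g) (hfg : Function.Exact f g) :
    ∃ (r : V₂ →ₗ[K] V₁) (s : V₃ →ₗ[K] V₂), r ∘ₗ f = LinearMap.id ∧ g ∘ₗ s = LinearMap.id ∧
      f ∘ₗ r + s ∘ₗ g = LinearMap.id := by
  obtain ⟨r, hr⟩ := f.exists_leftInverse_of_injective (LinearMap.ker_eq_bot.2 hf)
  obtain ⟨s, hs⟩ := g.exists_rightInverse_of_surjective (LinearMap.range_eq_top.2 hg)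
  have hr' : ∀ x, r (f x) = x := fun x => congrArg (fun F => F x) hr
  have hs' : ∀ x, g (s x) = x := fun x => congrArg (fun F => F x) hs
  -- A retraction and a section chosen independently need not give complementary projections;
  -- precomposing `r` with 1 - s g makes it vanish on the image of `s`.
  refine ⟨r ∘ₗ (LinearMap.id - s ∘ₗ g), s, ?_, hs, ?_⟩
  · ext x
    have : g (f x) = 0 := hfg.apply_apply_eq_zero x
    simp [this, hr']
  · ext x
    obtain ⟨y, hy⟩ := (hfg (x - s (g x))).1 (by rw [map_sub, hs', sub_self])
    simp only [LinearMap.add_apply, LinearMap.comp_apply, LinearMap.sub_apply, LinearMap.id_apply]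
    rw [← hy, hr', hy, sub_add_cancel]

end Splitting

/-! ### Chevalley-Eilenberg cochains as an exact functor on U(L)-modules -/

section LieComplex

variable {K L : Type u} [Field K] [LieRing L] [LieAlgebra K L]

section

variable (L) (N N' N'' : Type u) [AddCommGroup N] [Module K N] [LieRingModule L N]
  [LieModule K L N] [AddCommGroup N'] [Module K N'] [LieRingModule L N'] [LieModule K L N']
  [AddCommGroup N''] [Module K N''] [LieRingModule L N''] [LieModule K L N'']

variable (K) in
/-- The Chevalley-Eilenberg complex of a Lie module. -/
noncomputable def lieComplex : CochainComplex (ModuleCat.{u} K) ℕ :=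
  CochainComplex.of (fun n => ModuleCat.of K (L [⋀^Fin n]→ₗ[K] N))
    (fun n => ModuleCat.ofHom (ceD n))
    (fun n => by apply ModuleCat.hom_ext; refine LinearMap.ext fun f => ?_; exact ceD_ceD n f)

theorem lieComplex_d (n : ℕ) (f : L [⋀^Fin n]→ₗ[K] N) :
    (lieComplex K L N).d n (n + 1) f = ceD n f := by
  have h : (lieComplex K L N).d n (n + 1) = ModuleCat.ofHom (ceD n) := by
    simp only [lieComplex, CochainComplex.of_d]
  rw [h]
  rfl

variable {L N N' N''}

/-- The map of Chevalley-Eilenberg complexes induced by a map of Lie modules. -/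
noncomputable def lieComplexMap (φ : N →ₗ[K] N') (hφ : ∀ (x : L) (m : N), φ ⁅x, m⁆ = ⁅x, φ m⁆) :
    lieComplex K L N ⟶ lieComplex K L N' :=
  CochainComplex.ofHom (fun n => ModuleCat.ofHom (LinearMap.compAlternatingMapₗ K φ)) (fun n => by
    simp only [lieComplex, CochainComplex.of_d]
    apply ModuleCat.hom_ext
    refine LinearMap.ext fun f => ?_
    exact ceD_comp n φ hφ f)

end

section

variable (K L)
variable (N : Type u) [AddCommGroup N] [Module (UniversalEnvelopingAlgebra K L) N]

/-- A module over the enveloping algebra, considered as a Lie module. -/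
def LieRes (_K _L N : Type*) : Type _ := N

instance : AddCommGroup (LieRes K L N) := inferInstanceAs (AddCommGroup N)

noncomputable instance : Module K (LieRes K L N) :=
  Module.restrictScalars K (UniversalEnvelopingAlgebra K L) N

noncomputable instance : Module (UniversalEnvelopingAlgebra K L) (LieRes K L N) :=
  inferInstanceAs (Module (UniversalEnvelopingAlgebra K L) N)

instance : IsScalarTower K (UniversalEnvelopingAlgebra K L) (LieRes K L N) :=
  IsScalarTower.restrictScalars K (UniversalEnvelopingAlgebra K L) N

noncomputable instance : LieRingModule L (LieRes K L N) where
  bracket x n := UniversalEnvelopingAlgebra.ι K x • n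
  add_lie x y n := by rw [map_add, add_smul]
  lie_add x n n' := smul_add _ n n'
  leibniz_lie x y n := by
    let : LieRing (UniversalEnvelopingAlgebra K L) := LieRing.ofAssociativeRing
    rw [LieHom.map_lie, LieRing.of_associative_ring_bracket, sub_smul, mul_smul, mul_smul]
    abel

variable {N} in
theorem lieRes_lie (x : L) (n : LieRes K L N) : ⁅x, n⁆ = UniversalEnvelopingAlgebra.ι K x • n := rfl

instance : LieModule K L (LieRes K L N) where
  smul_lie c x n := by rw [lieRes_lie, lieRes_lie, map_smul, smul_assoc]
  lie_smul c x n := by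
    rw [lieRes_lie, lieRes_lie, algebra_compatible_smul (UniversalEnvelopingAlgebra K L) c n,
      ← mul_smul, ← Algebra.commutes, mul_smul, ← algebra_compatible_smul]

/-- A Lie module, considered as a module over the enveloping algebra. -/
noncomputable def lieObj (W : Type u) [AddCommGroup W] [Module K W] [LieRingModule L W]
    [LieModule K L W] : ModuleCat.{u} (UniversalEnvelopingAlgebra K L) :=
  letI : Module (UniversalEnvelopingAlgebra K L) W :=
    Module.compHom W (ueaAct K L W).toRingHom
  ModuleCat.of (UniversalEnvelopingAlgebra K L) W

variable {K L N}
variable {W : Type u} [AddCommGroup W] [Module K W] [LieRingModule L W] [LieModule K L W]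

/-- A map of Lie modules is linear over the enveloping algebra. -/
theorem map_ueaAct {W' : Type*} [AddCommGroup W'] [Module K W'] [LieRingModule L W']
    [LieModule K L W'] (φ : W →ₗ[K] W') (hφ : ∀ (x : L) (w : W), φ ⁅x, w⁆ = ⁅x, φ w⁆)
    (u : UniversalEnvelopingAlgebra K L) (w : W) :
    φ (ueaAct K L W u w) = ueaAct K L W' u (φ w) := by
  induction u using uea_induction generalizing w with
  | hι x => rw [ueaAct_ι, ueaAct_ι, hφ]
  | ha c => simp [Algebra.algebraMap_eq_smul_one]
  | hadd u v hu hv => rw [map_add, map_add, LinearMap.add_apply, LinearMap.add_apply, map_add, hu, hv]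
  | hmul u v hu hv => rw [map_mul, map_mul, Module.End.mul_apply, Module.End.mul_apply, hu, hv]

theorem ueaAct_lieRes (u : UniversalEnvelopingAlgebra K L) (n : LieRes K L N) :
    ueaAct K L (LieRes K L N) u n = u • n := by
  induction u using uea_induction generalizing n with
  | hι x => rw [ueaAct_ι, lieRes_lie]
  | ha c => rw [AlgHom.commutes, algebraMap_smul]; rfl
  | hadd u v hu hv => rw [map_add, LinearMap.add_apply, add_smul, hu, hv]
  | hmul u v hu hv => rw [map_mul, Module.End.mul_apply, mul_smul, hu, hv]

/-- The identity, from a Lie module to itself. -/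
noncomputable def lieResObj : W ≃ₗ[K] LieRes K L (lieObj K L W) where
  toFun w := w
  invFun w := w
  map_add' _ _ := rfl
  map_smul' c w := by
    change _ = ueaAct K L W (algebraMap K _ c) w
    rw [AlgHom.commutes]
    rfl
  left_inv _ := rfl
  right_inv _ := rfl

theorem lieResObj_lie (x : L) (w : W) :
    (lieResObj ⁅x, w⁆ : LieRes K L (lieObj K L W)) = ⁅x, (lieResObj w : LieRes K L (lieObj K L W))⁆ :=
  (ueaAct_ι W x w).symm

theorem lieResObj_symm_lie (x : L) (w : LieRes K L (lieObj K L W)) :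
    lieResObj.symm ⁅x, w⁆ = ⁅x, (lieResObj.symm w : W)⁆ :=
  ueaAct_ι W x _

end

/-- A map of Lie modules, as a map of modules over the enveloping algebra. -/
noncomputable def toLieObj {N : ModuleCat.{u} (UniversalEnvelopingAlgebra K L)} {W : Type u}
    [AddCommGroup W] [Module K W] [LieRingModule L W] [LieModule K L W]
    (ψ : LieRes K L N →ₗ[K] W) (hψ : ∀ (x : L) (n : LieRes K L N), ψ ⁅x, n⁆ = ⁅x, ψ n⁆) :
    N ⟶ lieObj K L W :=
  let f : N →ₗ[UniversalEnvelopingAlgebra K L] lieObj K L W :=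
    { toFun := fun n => ψ (n : LieRes K L N)
      map_add' := fun n n' => map_add ψ n n'
      map_smul' := fun u n =>
        (congrArg ψ (ueaAct_lieRes u n)).symm.trans (map_ueaAct ψ hψ u n) }
  ModuleCat.ofHom (X := N) (Y := lieObj K L W) f

/-- The `K`-linear map underlying a map of modules over the enveloping algebra. -/
noncomputable def lieResMap {N N' : ModuleCat.{u} (UniversalEnvelopingAlgebra K L)} (φ : N ⟶ N') :
    LieRes K L N →ₗ[K] LieRes K L N' where
  toFun := φ.hom
  map_add' := map_add φ.hom
  map_smul' c n := map_smul φ.hom (algebraMap K (UniversalEnvelopingAlgebra K L) c) n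

theorem lieResMap_lie {N N' : ModuleCat.{u} (UniversalEnvelopingAlgebra K L)} (φ : N ⟶ N') (x : L)
    (n : LieRes K L N) : lieResMap φ ⁅x, n⁆ = ⁅x, lieResMap φ n⁆ :=
  map_smul φ.hom (UniversalEnvelopingAlgebra.ι K x) n

variable (K L) in
/-- The Chevalley-Eilenberg complex as a functor on modules over the enveloping algebra. -/
noncomputable def lieFunctor :
    ModuleCat.{u} (UniversalEnvelopingAlgebra K L) ⥤ CochainComplex (ModuleCat.{u} K) ℕ where
  obj N := lieComplex K L (LieRes K L N)
  map φ := lieComplexMap (lieResMap φ) (lieResMap_lie φ)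
  map_id _ := rfl
  map_comp _ _ := rfl

instance : (lieFunctor K L).PreservesZeroMorphisms where
  map_zero _ _ := rfl

theorem exists_splitting_of_shortExact
    {S : ShortComplex (ModuleCat.{u} (UniversalEnvelopingAlgebra K L))} (hS : S.ShortExact) :
    ∃ (r : LieRes K L S.X₂ →ₗ[K] LieRes K L S.X₁) (s : LieRes K L S.X₃ →ₗ[K] LieRes K L S.X₂),
      r ∘ₗ lieResMap S.f = LinearMap.id ∧ lieResMap S.g ∘ₗ s = LinearMap.id ∧
      lieResMap S.f ∘ₗ r + s ∘ₗ lieResMap S.g = LinearMap.id :=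
  exists_splitting (lieResMap S.f) (lieResMap S.g) hS.moduleCat_injective_f
    hS.moduleCat_surjective_g ((ShortComplex.ShortExact.moduleCat_exact_iff_function_exact S).1 hS.exact)

/-- The sequence of modules splits K-linearly, and in each fixed degree the functor of alternating
cochains depends only on the K-linear structure, so it preserves the splitting. -/
theorem lieFunctor_shortExact (S : ShortComplex (ModuleCat.{u} (UniversalEnvelopingAlgebra K L)))
    (hS : S.ShortExact) : (S.map (lieFunctor K L)).ShortExact := by
  obtain ⟨r, s, h1, h2, h3⟩ := exists_splitting_of_shortExact hS
  apply HomologicalComplex.shortExact_of_degreewise_shortExact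
  intro n
  refine ShortComplex.Splitting.shortExact
    { r := ModuleCat.ofHom (LinearMap.compAlternatingMapₗ K r)
      s := ModuleCat.ofHom (LinearMap.compAlternatingMapₗ K s)
      f_r := ?_
      s_g := ?_
      id := ?_ }
  all_goals
    apply ModuleCat.hom_ext
    refine LinearMap.ext fun (f : L [⋀^Fin n]→ₗ[K] _) => AlternatingMap.ext fun w => ?_
  · exact congrArg (fun F => F (f w)) h1
  · exact congrArg (fun F => F (f w)) h2
  · exact congrArg (fun F => F (f w)) h3

/-- The Chevalley-Eilenberg cohomology of a retract of a Lie module with vanishing cohomology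
vanishes. -/
theorem exists_ceD_eq_of_retract {N W : Type*} [AddCommGroup N] [Module K N] [LieRingModule L N]
    [LieModule K L N] [AddCommGroup W] [Module K W] [LieRingModule L W] [LieModule K L W]
    (i : N →ₗ[K] W) (hi : ∀ (x : L) (n : N), i ⁅x, n⁆ = ⁅x, i n⁆) (r : W →ₗ[K] N)
    (hr : ∀ (x : L) (w : W), r ⁅x, w⁆ = ⁅x, r w⁆) (hri : ∀ n, r (i n) = n) (n : ℕ)
    (hW : ∀ f : L [⋀^Fin (n + 1)]→ₗ[K] W, ceD (n + 1) f = 0 → ∃ g, ceD n g = f)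
    (f : L [⋀^Fin (n + 1)]→ₗ[K] N) (hf : ceD (n + 1) f = 0) : ∃ g, ceD n g = f := by
  obtain ⟨g, hg⟩ := hW (i.compAlternatingMap f) (by rw [ceD_comp (n + 1) i hi, hf]; ext; simp)
  refine ⟨r.compAlternatingMap g, ?_⟩
  rw [ceD_comp n r hr, hg]
  ext w
  exact hri (f w)

/-- The embedding `n ↦ (z ↦ ε(z) n)` in the coinduced module. -/
def constCoind {S N : Type*} [AddCommGroup S] [Module K S] [LieRingModule L S] [LieModule K L S]
    [AddCommGroup N] [Module K N] (E : EulerFiltration K L S) : N →ₗ[K] S →ₗ[K] N :=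
  (LinearMap.lsmul K N ∘ₗ E.ε).flip

theorem constCoind_apply {S N : Type*} [AddCommGroup S] [Module K S] [LieRingModule L S]
    [LieModule K L S] [AddCommGroup N] [Module K N] (E : EulerFiltration K L S) (n : N) (z : S) :
    constCoind E n z = E.ε z • n := rfl

/-- Invariance of ε removes the term where x acts on the argument, leaving only the action on the
value. -/
theorem constCoind_lie {S N : Type*} [AddCommGroup S] [Module K S] [LieRingModule L S]
    [LieModule K L S] [AddCommGroup N] [Module K N] [LieRingModule L N] [LieModule K L N]
    (E : EulerFiltration K L S) (x : L) (n : N) : constCoind E ⁅x, n⁆ = ⁅x, constCoind E n⁆ := by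
  ext z
  rw [LieHom.lie_apply, constCoind_apply, constCoind_apply, constCoind_apply, E.ε_lie, zero_smul,
    sub_zero, lie_smul]

theorem constCoind_injective {S N : Type*} [AddCommGroup S] [Module K S] [LieRingModule L S]
    [LieModule K L S] [AddCommGroup N] [Module K N] (E : EulerFiltration K L S) :
    Function.Injective (constCoind (N := N) E) := by
  intro n n' h
  have := congrArg (fun F => F E.one) h
  simpa [constCoind_apply, E.ε_one] using this

variable (K L) in
/-- Over a field, every Lie algebra has a module with an Euler filtration. -/
theorem exists_eulerFiltration : ∃ (S : Type u) (_ : AddCommGroup S) (_ : Module K S)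
    (_ : LieRingModule L S) (_ : LieModule K L S), Nonempty (EulerFiltration K L S) := by
  let b := Module.Basis.ofVectorSpace K L
  classical
  -- The ordered monomials need some linear order on the basis, and any order will do; a
  -- well-ordering of the index set supplies one.
  let : LinearOrder (Module.Basis.ofVectorSpaceIndex K L) :=
    linearOrderOfSTO (WellOrderingRel (α := Module.Basis.ofVectorSpaceIndex K L))
  exact ⟨PBWModule b, inferInstance, inferInstance, inferInstance, inferInstance,
    ⟨pbwFiltration b⟩⟩

/-- The Chevalley-Eilenberg cohomology of an injective module vanishes in positive degrees. -/
theorem exists_ceD_eq_of_injective [CharZero K]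
    (J : ModuleCat.{u} (UniversalEnvelopingAlgebra K L)) [Injective J] (n : ℕ)
    (f : L [⋀^Fin (n + 1)]→ₗ[K] LieRes K L J) (hf : ceD (n + 1) f = 0) : ∃ g, ceD n g = f := by
  obtain ⟨S, _, _, _, _, ⟨E⟩⟩ := exists_eulerFiltration K L
  -- The injective module becomes a direct summand of the acyclic module Hom(S, J), and the
  -- vanishing passes to summands.
  let i : J ⟶ lieObj K L (S →ₗ[K] LieRes K L J) :=
    toLieObj (constCoind (N := LieRes K L J) E) (constCoind_lie E)
  have : Mono i := (ModuleCat.mono_iff_injective i).2 (constCoind_injective (N := LieRes K L J) E)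
  let r := Injective.factorThru (𝟙 J) i
  have hr : i ≫ r = 𝟙 J := Injective.comp_factorThru _ _
  refine exists_ceD_eq_of_retract (constCoind (N := LieRes K L J) E) (constCoind_lie E)
    (lieResMap r ∘ₗ lieResObj.toLinearMap) (fun x w => ?_) (fun j => ?_) n
    (exists_ceD_eq E n) f hf
  · change lieResMap r (lieResObj ⁅x, w⁆) = _
    rw [lieResObj_lie, lieResMap_lie]
    rfl
  · exact ConcreteCategory.congr_hom hr j

end LieComplex

/-! ### Chevalley-Eilenberg cohomology as `Ext` over U(A) -/

section LieExt

variable (K A : Type u) [Field K] [Ring A] [Algebra K A] [PoissonAlgebra K A]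

/-- The trivial module is `K`. -/
noncomputable def trivialVal : trivialMod K A ≃ K := Equiv.refl K

/-- The generator of the trivial module. -/
noncomputable def trivialOne : trivialMod K A := (trivialVal K A).symm 1

variable {K A}

theorem trivialMod_smul (u : LieEnv K A) (c : trivialMod K A) :
    letI : LieRing K := LieRing.ofAssociativeRing
    trivialVal K A (u • c) =
      UniversalEnvelopingAlgebra.lift K (0 : PoissonLie K A →ₗ⁅K⁆ K) u * trivialVal K A c := rfl

theorem trivialMod_ι_smul (x : PoissonLie K A) (c : trivialMod K A) :
    (UniversalEnvelopingAlgebra.ι K x : LieEnv K A) • c = 0 := by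
  let : LieRing K := LieRing.ofAssociativeRing
  apply (trivialVal K A).injective
  refine (trivialMod_smul _ c).trans ?_
  rw [UniversalEnvelopingAlgebra.lift_ι_apply]
  exact zero_mul _

theorem trivialMod_algebraMap_smul (a : K) (c : trivialMod K A) :
    trivialVal K A ((algebraMap K (LieEnv K A) a) • c) = a * trivialVal K A c := by
  let : LieRing K := LieRing.ofAssociativeRing
  refine (trivialMod_smul _ c).trans ?_
  rw [AlgHom.commutes]
  rfl

theorem trivialMod_eq (c : trivialMod K A) :
    c = (algebraMap K (LieEnv K A) (trivialVal K A c)) • trivialOne K A :=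
  (trivialVal K A).injective
    ((trivialMod_algebraMap_smul _ _).trans (mul_one (trivialVal K A c))).symm

/-- A map from the trivial module is an invariant element. -/
noncomputable def trivialHom {N : ModuleCat.{u} (LieEnv K A)} (n : LieRes K (PoissonLie K A) N)
    (hn : ∀ x : PoissonLie K A, ⁅x, n⁆ = 0) : trivialMod K A ⟶ N :=
  let f : trivialMod K A →ₗ[LieEnv K A] N :=
    { toFun := fun c => (trivialVal K A c • n : LieRes K (PoissonLie K A) N)
      map_add' := fun c c' => add_smul (trivialVal K A c) (trivialVal K A c') n
      map_smul' := fun u c => by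
        change trivialVal K A (u • c) • n = u • (trivialVal K A c • n)
        induction u using uea_induction generalizing c with
        | hι x =>
          rw [trivialMod_ι_smul]
          refine (zero_smul K n).trans ?_
          rw [← lieRes_lie, lie_smul, hn, smul_zero]
        | ha a =>
          rw [trivialMod_algebraMap_smul, algebraMap_smul, mul_smul]
        | hadd u v hu hv =>
          rw [add_smul, add_smul, ← hu, ← hv]
          exact add_smul _ _ n
        | hmul u v hu hv => rw [mul_smul, mul_smul, hu, hv] }
  ModuleCat.ofHom (X := trivialMod K A) (Y := N) f

theorem trivialHom_one {N : ModuleCat.{u} (LieEnv K A)} (n : LieRes K (PoissonLie K A) N)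
    (hn : ∀ x : PoissonLie K A, ⁅x, n⁆ = 0) : trivialHom n hn (trivialOne K A) = n :=
  one_smul K n

/-- Maps from the trivial module as cochains of degree zero. -/
noncomputable def trivialCochain (N : ModuleCat.{u} (LieEnv K A)) :
    (trivialMod K A ⟶ N) →ₗ[K] (PoissonLie K A) [⋀^Fin 0]→ₗ[K] LieRes K (PoissonLie K A) N where
  toFun φ := AlternatingMap.constOfIsEmpty K (PoissonLie K A) (Fin 0)
    (φ (trivialOne K A) : LieRes K (PoissonLie K A) N)
  map_add' _ _ := rfl
  map_smul' _ _ := rfl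

theorem trivialCochain_apply (N : ModuleCat.{u} (LieEnv K A)) (φ : trivialMod K A ⟶ N)
    (w : Fin 0 → PoissonLie K A) : trivialCochain N φ w = φ (trivialOne K A) := rfl

theorem ceD_zero_apply {L W : Type*} [LieRing L] [LieAlgebra K L] [AddCommGroup W] [Module K W]
    [LieRingModule L W] [LieModule K L W] (f : L [⋀^Fin 0]→ₗ[K] W) (w : Fin 1 → L) :
    ceD 0 f w = ⁅w 0, f (Fin.tail w)⁆ := by
  rw [← Fin.cons_self_tail w]
  have := congrArg (fun F => F (Fin.tail w)) (ceD_zero_curryLeft f (w 0))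
  refine this.trans ?_
  rw [lieDer_apply]
  simp

theorem ceD_trivialCochain (N : ModuleCat.{u} (LieEnv K A)) (φ : trivialMod K A ⟶ N) :
    ceD 0 (trivialCochain N φ) = 0 := by
  ext w
  rw [ceD_zero_apply, trivialCochain_apply]
  change (UniversalEnvelopingAlgebra.ι K (w 0) : LieEnv K A) • φ.hom (trivialOne K A) = 0
  rw [← map_smul, trivialMod_ι_smul, map_zero]

theorem trivialCochain_injective (N : ModuleCat.{u} (LieEnv K A)) :
    Function.Injective (trivialCochain N) := by
  intro φ ψ h
  have h1 : φ.hom (trivialOne K A) = ψ.hom (trivialOne K A) := congrArg (fun F => F 0) h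
  ext c
  rw [trivialMod_eq c]
  exact (map_smul φ.hom _ _).trans ((congrArg _ h1).trans (map_smul ψ.hom _ _).symm)

/-- A cocycle of degree zero is an element killed by L, and such an element is the image of 1 under
a map from the trivial module. -/
theorem exists_trivialCochain_eq (N : ModuleCat.{u} (LieEnv K A))
    (f : (PoissonLie K A) [⋀^Fin 0]→ₗ[K] LieRes K (PoissonLie K A) N) (hf : ceD 0 f = 0) :
    ∃ φ, trivialCochain N φ = f := by
  refine ⟨trivialHom (f 0) fun x => ?_, ?_⟩
  · have := congrArg (fun F => F (fun _ => x)) hf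
    simp only [ceD_zero_apply] at this
    rw [Subsingleton.elim (0 : Fin 0 → PoissonLie K A) (Fin.tail fun _ => x)]
    exact this
  · ext w
    rw [trivialCochain_apply, trivialHom_one, Subsingleton.elim w 0]

/-- Dimension shifting with k = 0 and X the trivial module: the lowest cohomology consists of the
invariants. -/
theorem nonempty_lieFunctor_homology_equiv_ext [CharZero K] (n : ℕ)
    (N : ModuleCat.{u} (LieEnv K A)) :
    Nonempty (((lieFunctor K (PoissonLie K A)).obj N).homology n ≃ₗ[K]
      Abelian.Ext (trivialMod K A) N n) := by
  have h := nonempty_homology_equiv_ext (lieFunctor K (PoissonLie K A)) lieFunctor_shortExact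
    (trivialMod K A) 0 (fun N i => HomologicalComplex.shape _ _ _ (by simp)) trivialCochain
    (fun N x => by
      refine (lieComplex_d _ _ 0 _).trans ?_
      exact ceD_trivialCochain N x)
    (fun φ x => rfl) trivialCochain_injective
    (fun N f hf => exists_trivialCochain_eq N f ((lieComplex_d _ _ 0 f).symm.trans hf))
    (fun J _ m => isZero_homology _ _ (fun f hf => by
      obtain ⟨g, hg⟩ := exists_ceD_eq_of_injective J (0 + m) f ((lieComplex_d _ _ _ f).symm.trans hf)
      exact ⟨g, (lieComplex_d _ _ _ g).trans hg⟩)) n N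
  rw [zero_add] at h
  exact h

/-- An equivalence of Lie modules induces an isomorphism of Chevalley-Eilenberg complexes. -/
noncomputable def lieComplexIso {L : Type u} [LieRing L] [LieAlgebra K L] {N N' : Type u}
    [AddCommGroup N] [Module K N] [LieRingModule L N] [LieModule K L N] [AddCommGroup N']
    [Module K N'] [LieRingModule L N'] [LieModule K L N'] (e : N ≃ₗ[K] N')
    (he : ∀ (x : L) (n : N), e ⁅x, n⁆ = ⁅x, e n⁆)
    (he' : ∀ (x : L) (n : N'), e.symm ⁅x, n⁆ = ⁅x, e.symm n⁆) :
    lieComplex K L N ≅ lieComplex K L N' where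
  hom := lieComplexMap e.toLinearMap he
  inv := lieComplexMap e.symm.toLinearMap he'
  hom_inv_id := by
    ext n : 1
    apply ModuleCat.hom_ext
    refine LinearMap.ext fun (f : L [⋀^Fin n]→ₗ[K] N) => AlternatingMap.ext fun w => ?_
    exact e.symm_apply_apply (f w)
  inv_hom_id := by
    ext n : 1
    apply ModuleCat.hom_ext
    refine LinearMap.ext fun (f : L [⋀^Fin n]→ₗ[K] N') => AlternatingMap.ext fun w => ?_
    exact e.apply_symm_apply (f w)

/-- The Chevalley-Eilenberg cohomology is `Ext` over the enveloping algebra. -/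
theorem nonempty_ceComplex_homology_equiv_ext [CharZero K] (M : Type u) [AddCommGroup M]
    [Module K M] [Module A M] [Module Aᵐᵒᵖ M] [SMulCommClass A Aᵐᵒᵖ M] [IsScalarTower K A M]
    [IsScalarTower K Aᵐᵒᵖ M] [QuasiPoissonModule K A M] (n : ℕ) :
    Nonempty ((ceComplex K A M).homology n ≃ₗ[K]
      Abelian.Ext (trivialMod K A) (lieMod K A M) n) := by
  obtain ⟨e⟩ := nonempty_lieFunctor_homology_equiv_ext n (lieMod K A M)
  have i : ceComplex K A M ≅ (lieFunctor K (PoissonLie K A)).obj (lieMod K A M) :=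
    lieComplexIso lieResObj lieResObj_lie lieResObj_symm_lie
  exact ⟨((HomologicalComplex.homologyFunctor _ _ n).mapIso i).toLinearEquiv ≪≫ₗ e⟩

end LieExt

/-! ### Generators of the smash product -/

section SmashHoms

variable (K L B : Type*) [Field K] [LieRing L] [LieAlgebra K L] [Ring B] [Algebra K B]
  [LieRingModule L B] [LieModule K L B] [LieActsByDerivations L B]

/-- The embedding `b ↦ b # 1`. -/
noncomputable def smkLeft : B →ₐ[K] Smash K L B :=
  AlgHom.ofLinearMap
    { toFun := fun b => smk K L b 1
      map_add' := fun b c => TensorProduct.add_tmul b c (1 : UniversalEnvelopingAlgebra K L)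
      map_smul' := fun c b => (TensorProduct.smul_tmul' c b _).symm } rfl
    (fun b c => (smk_mul_smk_one b c 1).symm)

/-- The embedding `u ↦ 1 # u`. -/
noncomputable def smkRight : UniversalEnvelopingAlgebra K L →ₐ[K] Smash K L B :=
  AlgHom.ofLinearMap
    { toFun := fun u => smk K L (1 : B) u
      map_add' := fun u v => TensorProduct.tmul_add (1 : B) u v
      map_smul' := fun c u => TensorProduct.tmul_smul c (1 : B) u } rfl
    (fun u v => (smk_one_mul_smk (1 : B) u v).symm)

variable {K L B}

theorem smkLeft_apply (b : B) : smkLeft K L B b = smk K L b 1 := rfl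

theorem smkRight_apply (u : UniversalEnvelopingAlgebra K L) : smkRight K L B u = smk K L 1 u := rfl

theorem smk_eq (b : B) (u : UniversalEnvelopingAlgebra K L) :
    smk K L b u = smkLeft K L B b * smkRight K L B u := by
  rw [smkLeft_apply, smkRight_apply, smk_one_mul_smk, one_mul]

theorem smkRight_ι_mul_smkLeft (x : L) (b : B) :
    smkRight K L B (UniversalEnvelopingAlgebra.ι K x) * smkLeft K L B b =
      smkLeft K L B ⁅x, b⁆ +
        smkLeft K L B b * smkRight K L B (UniversalEnvelopingAlgebra.ι K x) := by
  rw [← smk_eq, smkLeft_apply, smkLeft_apply, smkRight_apply, smk_ι_mul_smk, mul_one]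

/-- Since b # u = (b # 1)(1 # u) and U(L) is generated by L, the images of B and L generate the
smash product as a ring. Linearity can therefore be tested on B and on L separately. -/
theorem smash_induction {P : Smash K L B → Prop} (hb : ∀ b, P (smkLeft K L B b))
    (hι : ∀ x, P (smkRight K L B (UniversalEnvelopingAlgebra.ι K x)))
    (hadd : ∀ p q, P p → P q → P (p + q)) (hmul : ∀ p q, P p → P q → P (p * q))
    (q : Smash K L B) : P q := by
  have hu : ∀ u, P (smkRight K L B u) := by
    intro u
    induction u using uea_induction with
    | hι x => exact hι x
    | ha c => rw [AlgHom.commutes, ← AlgHom.commutes (smkLeft K L B)]; exact hb _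
    | hadd u v hu hv => rw [map_add]; exact hadd _ _ hu hv
    | hmul u v hu hv => rw [map_mul]; exact hmul _ _ hu hv
  refine TensorProduct.induction_on (motive := P) q ?_ (fun b u => ?_) hadd
  · have := hb 0
    rw [map_zero] at this
    exact this
  · have := hmul _ _ (hb b) (hu u)
    rw [← smk_eq] at this
    exact this

/-- An additive map between modules over the smash product is linear if it commutes with `B` and
with `L`. -/
theorem map_smash_smul {N N' : Type*} [AddCommGroup N] [Module (Smash K L B) N] [AddCommGroup N']
    [Module (Smash K L B) N'] (φ : N →+ N')
    (hb : ∀ (b : B) n, φ (smkLeft K L B b • n) = smkLeft K L B b • φ n)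
    (hx : ∀ (x : L) n, φ (smkRight K L B (UniversalEnvelopingAlgebra.ι K x) • n) =
      smkRight K L B (UniversalEnvelopingAlgebra.ι K x) • φ n) (q : Smash K L B) (n : N) :
    φ (q • n) = q • φ n := by
  induction q using smash_induction generalizing n with
  | hb b => exact hb b n
  | hι x => exact hx x n
  | hadd p q hp hq => rw [add_smul, map_add, hp, hq, add_smul]
  | hmul p q hp hq => rw [mul_smul, hp, hq, mul_smul]

end SmashHoms

/-! ### Modules over A^e # U(A) as quasi-Poisson modules -/

section QuasiHoms

variable (K A : Type*) [Field K] [Ring A] [Algebra K A] [PoissonAlgebra K A]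

noncomputable instance : Semiring (QuasiEnv K A) := inferInstance

noncomputable instance : Monoid (QuasiEnv K A) := inferInstance

noncomputable instance : Mul (QuasiEnv K A) := inferInstance

theorem lie_one_alg (x : PoissonLie K A) : ⁅x, (1 : A)⁆ = 0 := by
  have := lie_alg_mul x (1 : A) 1
  simpa using this

/-- The embedding of `A` in `A^e # U(A)`. -/
noncomputable def quasiLeft : A →ₐ[K] QuasiEnv K A :=
  (smkLeft K (PoissonLie K A) (A ⊗[K] Aᵐᵒᵖ)).comp Algebra.TensorProduct.includeLeft

/-- The embedding of `A^op` in `A^e # U(A)`. -/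
noncomputable def quasiRight : Aᵐᵒᵖ →ₐ[K] QuasiEnv K A :=
  (smkLeft K (PoissonLie K A) (A ⊗[K] Aᵐᵒᵖ)).comp Algebra.TensorProduct.includeRight

/-- The embedding of the Lie algebra `A` in `A^e # U(A)`. -/
noncomputable def quasiLie : PoissonLie K A →ₗ[K] QuasiEnv K A where
  toFun x := smkRight K (PoissonLie K A) (A ⊗[K] Aᵐᵒᵖ) (UniversalEnvelopingAlgebra.ι K x)
  map_add' x y := by rw [map_add, map_add]
  map_smul' c x := by rw [map_smul, map_smul, RingHom.id_apply]

variable {K A}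

theorem quasiLie_apply (x : PoissonLie K A) : quasiLie K A x =
    smkRight K (PoissonLie K A) (A ⊗[K] Aᵐᵒᵖ) (UniversalEnvelopingAlgebra.ι K x) := rfl

theorem quasiLie_smul (c : K) (x : PoissonLie K A) :
    quasiLie K A (c • x) = algebraMap K (QuasiEnv K A) c * quasiLie K A x :=
  (map_smul (quasiLie K A) c x).trans (Algebra.smul_def c (quasiLie K A x))

theorem quasiLie_lie (x y : PoissonLie K A) : quasiLie K A ⁅x, y⁆ =
    quasiLie K A x * quasiLie K A y - quasiLie K A y * quasiLie K A x := by
  let : LieRing (UniversalEnvelopingAlgebra K (PoissonLie K A)) := LieRing.ofAssociativeRing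
  rw [quasiLie_apply, LieHom.map_lie, LieRing.of_associative_ring_bracket, map_sub, map_mul,
    map_mul]
  rfl

theorem quasiLeft_mul_quasiRight (a : A) (b : Aᵐᵒᵖ) : quasiLeft K A a * quasiRight K A b =
    smkLeft K (PoissonLie K A) (A ⊗[K] Aᵐᵒᵖ) (a ⊗ₜ b) := by
  change smkLeft K _ _ (a ⊗ₜ 1) * smkLeft K _ _ (1 ⊗ₜ b) = _
  rw [← map_mul, Algebra.TensorProduct.tmul_mul_tmul, mul_one, one_mul]

theorem quasiRight_mul_quasiLeft (a : A) (b : Aᵐᵒᵖ) : quasiRight K A b * quasiLeft K A a =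
    smkLeft K (PoissonLie K A) (A ⊗[K] Aᵐᵒᵖ) (a ⊗ₜ b) := by
  change smkLeft K _ _ (1 ⊗ₜ b) * smkLeft K _ _ (a ⊗ₜ 1) = _
  rw [← map_mul, Algebra.TensorProduct.tmul_mul_tmul, mul_one, one_mul]

theorem quasiLie_mul_quasiLeft (x : PoissonLie K A) (a : A) : quasiLie K A x * quasiLeft K A a =
    quasiLeft K A ⁅x, a⁆ + quasiLeft K A a * quasiLie K A x := by
  refine (smkRight_ι_mul_smkLeft (K := K) x (a ⊗ₜ[K] (1 : Aᵐᵒᵖ))).trans ?_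
  have h1 : ⁅x, (1 : Aᵐᵒᵖ)⁆ = 0 := congrArg op (lie_one_alg K A x)
  have h2 : ⁅x, a ⊗ₜ[K] (1 : Aᵐᵒᵖ)⁆ = ⁅x, a⁆ ⊗ₜ[K] (1 : Aᵐᵒᵖ) := by
    rw [TensorProduct.LieModule.lie_tmul_right, h1, TensorProduct.tmul_zero, add_zero]
  rw [h2]
  rfl

theorem quasiLie_mul_quasiRight (x : PoissonLie K A) (b : A) :
    quasiLie K A x * quasiRight K A (op b) =
      quasiRight K A (op ⁅x, b⁆) + quasiRight K A (op b) * quasiLie K A x := by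
  refine (smkRight_ι_mul_smkLeft (K := K) x ((1 : A) ⊗ₜ[K] op b)).trans ?_
  have h2 : ⁅x, (1 : A) ⊗ₜ[K] op b⁆ = (1 : A) ⊗ₜ[K] op ⁅x, b⁆ := by
    rw [TensorProduct.LieModule.lie_tmul_right, lie_one_alg, TensorProduct.zero_tmul, zero_add]
    rfl
  rw [h2]
  rfl

section Res

variable (K A)
variable (N : Type*) [AddCommGroup N] [Module (QuasiEnv K A) N]

/-- A module over `A^e # U(A)`, considered as a quasi-Poisson module. -/
def QuasiRes (_K _A N : Type*) : Type _ := N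

instance : AddCommGroup (QuasiRes K A N) := ‹AddCommGroup N›

noncomputable instance : Module K (QuasiRes K A N) := Module.restrictScalars K (QuasiEnv K A) N

noncomputable instance : Module A (QuasiRes K A N) :=
  Module.compHom N (quasiLeft K A).toRingHom

noncomputable instance : Module Aᵐᵒᵖ (QuasiRes K A N) :=
  Module.compHom N (quasiRight K A).toRingHom

/-- The identity map. -/
def toQuasiRes : N ≃+ QuasiRes K A N := AddEquiv.refl N

variable {N}

theorem quasiRes_smul (a : A) (n : N) :
    a • toQuasiRes K A N n = toQuasiRes K A N (quasiLeft K A a • n) := rfl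

theorem quasiRes_op_smul (b : Aᵐᵒᵖ) (n : N) :
    b • toQuasiRes K A N n = toQuasiRes K A N (quasiRight K A b • n) := rfl

theorem quasiRes_smul_field (c : K) (n : N) :
    c • toQuasiRes K A N n = toQuasiRes K A N (algebraMap K (QuasiEnv K A) c • n) := rfl

instance : SMulCommClass A Aᵐᵒᵖ (QuasiRes K A N) where
  smul_comm a b n := by
    obtain ⟨n, rfl⟩ := (toQuasiRes K A N).surjective n
    rw [quasiRes_op_smul, quasiRes_smul, quasiRes_smul, quasiRes_op_smul, ← mul_smul, ← mul_smul,
      quasiLeft_mul_quasiRight, quasiRight_mul_quasiLeft]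

instance : IsScalarTower K A (QuasiRes K A N) where
  smul_assoc c a n := by
    obtain ⟨n, rfl⟩ := (toQuasiRes K A N).surjective n
    rw [quasiRes_smul, quasiRes_smul, quasiRes_smul_field, ← mul_smul, Algebra.smul_def, map_mul,
      AlgHom.commutes]

instance : IsScalarTower K Aᵐᵒᵖ (QuasiRes K A N) where
  smul_assoc c a n := by
    obtain ⟨n, rfl⟩ := (toQuasiRes K A N).surjective n
    rw [quasiRes_op_smul, quasiRes_op_smul, quasiRes_smul_field, ← mul_smul, Algebra.smul_def, map_mul,
      AlgHom.commutes]

variable (N) in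
/-- The Lie action on a module over `A^e # U(A)`. -/
noncomputable def quasiResAct : A →ₗ[K] QuasiRes K A N →ₗ[K] QuasiRes K A N :=
  LinearMap.mk₂ K (fun a n => toQuasiRes K A N (quasiLie K A (toLie K a) •
      (toQuasiRes K A N).symm n))
    (fun a b n => by rw [map_add, map_add, add_smul, map_add])
    (fun c a n => by
      rw [map_smul (toLie K) c a, quasiLie_smul, quasiRes_smul_field, ← mul_smul])
    (fun a n n' => by rw [map_add, smul_add, map_add])
    (fun c a n => by
      obtain ⟨n, rfl⟩ := (toQuasiRes K A N).surjective n
      rw [quasiRes_smul_field, AddEquiv.symm_apply_apply, AddEquiv.symm_apply_apply,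
        quasiRes_smul_field, ← mul_smul, ← mul_smul, Algebra.commutes])

theorem quasiResAct_apply (a : A) (n : N) : quasiResAct K A N a (toQuasiRes K A N n) =
    toQuasiRes K A N (quasiLie K A (toLie K a) • n) := rfl

noncomputable instance : QuasiPoissonModule K A (QuasiRes K A N) where
  act := quasiResAct K A N
  act_bracket a b n := by
    obtain ⟨n, rfl⟩ := (toQuasiRes K A N).surjective n
    rw [quasiResAct_apply, quasiResAct_apply, quasiResAct_apply, quasiResAct_apply,
      quasiResAct_apply, ← map_sub, ← mul_smul, ← mul_smul, ← sub_smul, ← quasiLie_lie]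
    rfl
  act_smul a b n := by
    obtain ⟨n, rfl⟩ := (toQuasiRes K A N).surjective n
    rw [quasiResAct_apply, quasiRes_smul, quasiRes_smul, quasiRes_smul, quasiResAct_apply,
      ← map_add, ← mul_smul, ← mul_smul, ← add_smul, quasiLie_mul_quasiLeft]
    rfl
  act_op_smul a b n := by
    obtain ⟨n, rfl⟩ := (toQuasiRes K A N).surjective n
    rw [quasiResAct_apply, quasiRes_op_smul, quasiRes_op_smul, quasiRes_op_smul,
      quasiResAct_apply, ← map_add, ← mul_smul, ← mul_smul, ← add_smul, quasiLie_mul_quasiRight]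
    rfl

theorem quasiRes_lie (x : PoissonLie K A) (n : N) :
    ⁅x, toQuasiRes K A N n⁆ = toQuasiRes K A N (quasiLie K A x • n) := rfl

end Res

section Hom

variable {M M' : Type*} [AddCommGroup M] [Module K M] [Module A M] [Module Aᵐᵒᵖ M]
  [SMulCommClass A Aᵐᵒᵖ M] [IsScalarTower K A M] [IsScalarTower K Aᵐᵒᵖ M]
  [QuasiPoissonModule K A M] [AddCommGroup M'] [Module K M'] [Module A M'] [Module Aᵐᵒᵖ M']
  [SMulCommClass A Aᵐᵒᵖ M'] [IsScalarTower K A M'] [IsScalarTower K Aᵐᵒᵖ M']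
  [QuasiPoissonModule K A M']

/-- The map is a homomorphism of quasi-Poisson modules. -/
structure IsQuasiHom (φ : M →ₗ[K] M') : Prop where
  map_smul : ∀ (a : A) (m : M), φ (a • m) = a • φ m
  map_op_smul : ∀ (a : A) (m : M), φ (op a • m) = op a • φ m
  map_lie : ∀ (x : PoissonLie K A) (m : M), φ ⁅x, m⁆ = ⁅x, φ m⁆

theorem quasiHom_quasiLeft (a : A) (m : M) : quasiHom K A M (quasiLeft K A a) m = a • m := by
  refine (quasiHom_smk K A M a 1 1 m).trans ?_
  rw [map_one, Module.End.one_apply, op_one, one_smul]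

theorem quasiHom_quasiRight (b : A) (m : M) :
    quasiHom K A M (quasiRight K A (op b)) m = op b • m := by
  refine (quasiHom_smk K A M 1 b 1 m).trans ?_
  rw [map_one, Module.End.one_apply, one_smul]

theorem quasiHom_quasiLie (x : PoissonLie K A) (m : M) :
    quasiHom K A M (quasiLie K A x) m = ⁅x, m⁆ := by
  refine (quasiHom_smk K A M 1 1 (UniversalEnvelopingAlgebra.ι K x) m).trans ?_
  rw [ueaAct_ι, op_one, one_smul, one_smul]

theorem quasiEnv_induction {P : QuasiEnv K A → Prop} (hl : ∀ a, P (quasiLeft K A a))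
    (hr : ∀ a, P (quasiRight K A (op a))) (hx : ∀ x, P (quasiLie K A x))
    (hadd : ∀ p q, P p → P q → P (p + q)) (hmul : ∀ p q, P p → P q → P (p * q))
    (q : QuasiEnv K A) : P q := by
  refine smash_induction (fun b => ?_) hx hadd hmul q
  induction b with
  | zero => simpa using hl 0
  | tmul a b => rw [← quasiLeft_mul_quasiRight]; exact hmul _ _ (hl a) (hr b.unop)
  | add b c hb hc => rw [map_add]; exact hadd _ _ hb hc

theorem IsQuasiHom.map_quasiHom {φ : M →ₗ[K] M'} (hφ : IsQuasiHom (A := A) φ) (q : QuasiEnv K A)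
    (m : M) : φ (quasiHom K A M q m) = quasiHom K A M' q (φ m) := by
  induction q using quasiEnv_induction generalizing m with
  | hl a => rw [quasiHom_quasiLeft, quasiHom_quasiLeft, hφ.map_smul]
  | hr a => rw [quasiHom_quasiRight, quasiHom_quasiRight, hφ.map_op_smul]
  | hx x => rw [quasiHom_quasiLie, quasiHom_quasiLie, hφ.map_lie]
  | hadd p q hp hq => rw [map_add, map_add, LinearMap.add_apply, LinearMap.add_apply, map_add, hp, hq]
  | hmul p q hp hq => rw [map_mul, map_mul, Module.End.mul_apply, Module.End.mul_apply, hp, hq]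

/-- Restricting to a quasi-Poisson module and extending back returns the original action, so nothing
is lost by working with the three separate actions of A, A^op and the Lie algebra. -/
theorem quasiHom_quasiRes {N : Type*} [AddCommGroup N] [Module (QuasiEnv K A) N]
    (q : QuasiEnv K A) (n : N) : quasiHom K A (QuasiRes K A N) q (toQuasiRes K A N n) =
      toQuasiRes K A N (q • n) := by
  induction q using quasiEnv_induction generalizing n with
  | hl a => rw [quasiHom_quasiLeft, quasiRes_smul]
  | hr a => rw [quasiHom_quasiRight, quasiRes_op_smul]
  | hx x => rw [quasiHom_quasiLie, quasiRes_lie]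
  | hadd p q hp hq => rw [map_add, LinearMap.add_apply, hp, hq, add_smul, map_add]
  | hmul p q hp hq => rw [map_mul, Module.End.mul_apply, hq, hp, mul_smul]

end Hom

end QuasiHoms

/-! ### Morphisms over A^e # U(A) as quasi-Poisson homomorphisms -/

section QuasiMod

variable {K A : Type u} [Field K] [Ring A] [Algebra K A] [PoissonAlgebra K A]

variable {M : Type u} [AddCommGroup M] [Module K M] [Module A M] [Module Aᵐᵒᵖ M]
  [SMulCommClass A Aᵐᵒᵖ M] [IsScalarTower K A M] [IsScalarTower K Aᵐᵒᵖ M]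
  [QuasiPoissonModule K A M]

/-- A homomorphism of quasi-Poisson modules, as a map of modules over `A^e # U(A)`. -/
noncomputable def toQuasiMod {N : ModuleCat.{u} (QuasiEnv K A)} (ψ : QuasiRes K A N →ₗ[K] M)
    (hψ : IsQuasiHom (A := A) ψ) : N ⟶ quasiMod K A M :=
  let f : N →ₗ[QuasiEnv K A] quasiMod K A M :=
    { toFun := fun n => ψ (toQuasiRes K A N n)
      map_add' := fun n n' => map_add ψ (toQuasiRes K A N n) (toQuasiRes K A N n')
      map_smul' := fun q n =>
        (congrArg ψ (quasiHom_quasiRes q n)).symm.trans (hψ.map_quasiHom q (toQuasiRes K A N n)) }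
  ModuleCat.ofHom (X := N) (Y := quasiMod K A M) f

/-- The homomorphism of quasi-Poisson modules given by a map of modules over `A^e # U(A)`. -/
noncomputable def quasiResMap {N N' : ModuleCat.{u} (QuasiEnv K A)} (φ : N ⟶ N') :
    QuasiRes K A N →ₗ[K] QuasiRes K A N' where
  toFun n := toQuasiRes K A N' (φ.hom ((toQuasiRes K A N).symm n))
  map_add' n n' := by simp
  map_smul' c n := congrArg (toQuasiRes K A N')
    (map_smul φ.hom (algebraMap K (QuasiEnv K A) c) ((toQuasiRes K A N).symm n))

theorem quasiResMap_isQuasiHom {N N' : ModuleCat.{u} (QuasiEnv K A)} (φ : N ⟶ N') :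
    IsQuasiHom (A := A) (quasiResMap φ) where
  map_smul a _ := map_smul φ.hom (quasiLeft K A a) _
  map_op_smul a _ := map_smul φ.hom (quasiRight K A (op a)) _
  map_lie x _ := map_smul φ.hom (quasiLie K A x) _

variable (K A M) in
/-- The identity map of a quasi-Poisson module. -/
noncomputable def quasiResObj : M ≃ₗ[K] QuasiRes K A (quasiMod K A M) where
  toFun m := m
  invFun m := m
  map_add' _ _ := rfl
  map_smul' c m := by
    change _ = quasiHom K A M (algebraMap K (QuasiEnv K A) c) m
    rw [← AlgHom.commutes (quasiLeft K A), quasiHom_quasiLeft, algebraMap_smul]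
  left_inv _ := rfl
  right_inv _ := rfl

theorem quasiResObj_isQuasiHom : IsQuasiHom (A := A) (quasiResObj K A M).toLinearMap where
  map_smul a m := (quasiHom_quasiLeft a m).symm
  map_op_smul a m := (quasiHom_quasiRight a m).symm
  map_lie x m := (quasiHom_quasiLie x m).symm

theorem quasiResObj_symm_isQuasiHom :
    IsQuasiHom (A := A) (quasiResObj K A M).symm.toLinearMap where
  map_smul a _ := quasiHom_quasiLeft (M := M) a _
  map_op_smul a _ := quasiHom_quasiRight (M := M) a _
  map_lie x _ := quasiHom_quasiLie (M := M) x _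

end QuasiMod

/-! ### Functoriality of the cochains of Hochschild degree at least two -/

section TailMaps

variable {K A M M' M'' : Type*} [Field K] [Ring A] [Algebra K A] [PoissonAlgebra K A]
  [AddCommGroup M] [Module K M] [AddCommGroup M'] [Module K M'] [AddCommGroup M''] [Module K M'']

/-- The map on cochains induced by a linear map of the coefficients. -/
def biMap (i j : ℕ) (φ : M →ₗ[K] M') : BiCochain K A M i j →ₗ[K] BiCochain K A M' i j :=
  LinearMap.compAlternatingMapₗ K (LinearMap.compMultilinearMapₗ K φ)

/-- The map on tail cochains induced by a linear map of the coefficients. -/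
def tailMap (n : ℕ) (φ : M →ₗ[K] M') : TailCochain K A M n →ₗ[K] TailCochain K A M' n where
  toFun f p := biMap _ _ φ (f p)
  map_add' f g := by funext p; exact map_add _ _ _
  map_smul' c f := by funext p; exact map_smul (biMap _ _ φ) c _

section

variable [Module A M] [Module Aᵐᵒᵖ M] [SMulCommClass A Aᵐᵒᵖ M] [IsScalarTower K A M]
  [IsScalarTower K Aᵐᵒᵖ M] [Module A M'] [Module Aᵐᵒᵖ M'] [SMulCommClass A Aᵐᵒᵖ M']
  [IsScalarTower K A M'] [IsScalarTower K Aᵐᵒᵖ M']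

theorem hochD_compMultilinearMap (φ : M →ₗ[K] M') (hl : ∀ (a : A) (m : M), φ (a • m) = a • φ m)
    (hr : ∀ (a : A) (m : M), φ (op a • m) = op a • φ m) (n : ℕ)
    (f : MultilinearMap K (fun _ : Fin n => A) M) :
    hochD n (φ.compMultilinearMap f) = φ.compMultilinearMap (hochD n f) := by
  ext a
  simp only [hochD, LinearMap.coe_mk, AddHom.coe_mk, MultilinearMap.coe_mk,
    LinearMap.compMultilinearMap_apply, map_add, map_sum, map_zsmul, hl, hr]

variable [QuasiPoissonModule K A M] [QuasiPoissonModule K A M']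

theorem lie_compMultilinearMap {V L N N' : Type*} [LieRing L] [LieAlgebra K L]
    [AddCommGroup V] [Module K V] [LieRingModule L V] [LieModule K L V]
    [AddCommGroup N] [Module K N] [LieRingModule L N] [LieModule K L N]
    [AddCommGroup N'] [Module K N'] [LieRingModule L N'] [LieModule K L N'] (φ : N →ₗ[K] N')
    (hφ : ∀ (x : L) (m : N), φ ⁅x, m⁆ = ⁅x, φ m⁆) (n : ℕ) (x : L)
    (f : MultilinearMap K (fun _ : Fin n => V) N) :
    φ.compMultilinearMap ⁅x, f⁆ = ⁅x, φ.compMultilinearMap f⁆ := by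
  ext v
  simp only [lie_multilinear, multilinearLie_apply, LinearMap.compMultilinearMap_apply, map_sub,
    map_sum, hφ]

theorem vertD_biMap {φ : M →ₗ[K] M'} (hφ : IsQuasiHom (A := A) φ) (i j : ℕ)
    (f : BiCochain K A M i j) : vertD i j (biMap i j φ f) = biMap (i + 1) j φ (vertD i j f) := by
  ext w : 1
  exact hochD_compMultilinearMap φ hφ.map_smul hφ.map_op_smul i (f w)

theorem ceD_biMap {φ : M →ₗ[K] M'} (hφ : IsQuasiHom (A := A) φ) (i j : ℕ)
    (f : BiCochain K A M i j) : ceD j (biMap i j φ f) = biMap i (j + 1) φ (ceD j f) :=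
  ceD_comp j (LinearMap.compMultilinearMapₗ K φ)
    (fun x m => lie_compMultilinearMap φ hφ.map_lie i x m) f

theorem tailD_tailMap {φ : M →ₗ[K] M'} (hφ : IsQuasiHom (A := A) φ) (n : ℕ)
    (f : TailCochain K A M n) : tailD n (tailMap n φ f) = tailMap (n + 1) φ (tailD n f) := by
  have hv : ∀ i j h, tailVert n (tailMap n φ f) i j h = biMap _ _ φ (tailVert n f i j h) := by
    rintro (_ | i) j h
    · exact (map_zero _).symm
    · exact vertD_biMap hφ _ _ _
  have hh : ∀ i j h, tailHoriz n (tailMap n φ f) i j h = biMap _ _ φ (tailHoriz n f i j h) := by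
    rintro i (_ | j) h
    · exact (map_zero _).symm
    · refine (congrArg _ (ceD_biMap hφ _ _ _)).trans (map_zsmul (biMap _ _ φ) _ _).symm
  funext ⟨⟨i, j⟩, h⟩
  exact (congrArg₂ (· + ·) (hv i j h) (hh i j h)).trans (map_add (biMap _ _ φ) _ _).symm

end

/-- The equation i + 2 + j = n has no solution for n < 2. This gives both the zero terms at the
start of the long exact sequence and the absence of coboundaries in degree two. -/
theorem subsingleton_tailCochain {n : ℕ} (hn : n < 2) : Subsingleton (TailCochain K A M n) :=
  ⟨fun f g => by funext ⟨⟨i, j⟩, h⟩; dsimp only at h; omega⟩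

end TailMaps

/-! ### The tail complex as an exact functor on modules over A^e # U(A) -/

section TailComplex

variable {K A : Type u} [Field K] [Ring A] [Algebra K A] [PoissonAlgebra K A]

section

variable {M M' : Type u} [AddCommGroup M] [Module K M] [Module A M] [Module Aᵐᵒᵖ M]
  [SMulCommClass A Aᵐᵒᵖ M] [IsScalarTower K A M] [IsScalarTower K Aᵐᵒᵖ M]
  [QuasiPoissonModule K A M] [AddCommGroup M'] [Module K M'] [Module A M'] [Module Aᵐᵒᵖ M']
  [SMulCommClass A Aᵐᵒᵖ M'] [IsScalarTower K A M'] [IsScalarTower K Aᵐᵒᵖ M']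
  [QuasiPoissonModule K A M']

theorem tailComplex_d (n : ℕ) (f : TailCochain K A M n) :
    (tailComplex K A M).d n (n + 1) f = tailD n f := by
  have h : (tailComplex K A M).d n (n + 1) = ModuleCat.ofHom (tailD n) := by
    simp only [tailComplex, CochainComplex.of_d]
  rw [h]
  rfl

/-- The map of complexes induced by a map of quasi-Poisson modules. -/
noncomputable def tailComplexMap (φ : M →ₗ[K] M') (hφ : IsQuasiHom (A := A) φ) :
    tailComplex K A M ⟶ tailComplex K A M' :=
  CochainComplex.ofHom (fun n => ModuleCat.ofHom (tailMap n φ)) (fun n => by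
    simp only [tailComplex, CochainComplex.of_d]
    apply ModuleCat.hom_ext
    refine LinearMap.ext fun f => ?_
    exact tailD_tailMap hφ n f)

/-- An equivalence of quasi-Poisson modules induces an isomorphism of complexes. -/
noncomputable def tailComplexIso (e : M ≃ₗ[K] M') (he : IsQuasiHom (A := A) e.toLinearMap)
    (he' : IsQuasiHom (A := A) e.symm.toLinearMap) : tailComplex K A M ≅ tailComplex K A M' where
  hom := tailComplexMap e.toLinearMap he
  inv := tailComplexMap e.symm.toLinearMap he'
  hom_inv_id := by
    ext n : 1
    apply ModuleCat.hom_ext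
    refine LinearMap.ext fun (f : TailCochain K A M n) => funext fun p =>
      AlternatingMap.ext fun w => MultilinearMap.ext fun a => ?_
    exact e.symm_apply_apply (f p w a)
  inv_hom_id := by
    ext n : 1
    apply ModuleCat.hom_ext
    refine LinearMap.ext fun (f : TailCochain K A M' n) => funext fun p =>
      AlternatingMap.ext fun w => MultilinearMap.ext fun a => ?_
    exact e.apply_symm_apply (f p w a)

end

variable (K A) in
/-- The complex `⊕ Hom(A^i ⊗ ⋀^j, -)`, `i ≥ 2`, as a functor on modules over `A^e # U(A)`. -/
noncomputable def tailFunctor :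
    ModuleCat.{u} (QuasiEnv K A) ⥤ CochainComplex (ModuleCat.{u} K) ℕ where
  obj N := tailComplex K A (QuasiRes K A N)
  map φ := tailComplexMap (quasiResMap φ) (quasiResMap_isQuasiHom φ)
  map_id _ := rfl
  map_comp _ _ := rfl

instance : (tailFunctor K A).PreservesZeroMorphisms where
  map_zero _ _ := rfl

/-- The K-linear splitting need not respect the actions of A. Exactness is checked degree by degree,
and there the cochain spaces depend only on the K-linear structure. -/
theorem tailFunctor_shortExact (S : ShortComplex (ModuleCat.{u} (QuasiEnv K A)))
    (hS : S.ShortExact) : (S.map (tailFunctor K A)).ShortExact := by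
  obtain ⟨r, s, h1, h2, h3⟩ := exists_splitting (quasiResMap S.f) (quasiResMap S.g)
    hS.moduleCat_injective_f hS.moduleCat_surjective_g
    ((ShortComplex.ShortExact.moduleCat_exact_iff_function_exact S).1 hS.exact)
  apply HomologicalComplex.shortExact_of_degreewise_shortExact
  intro n
  refine ShortComplex.Splitting.shortExact
    { r := ModuleCat.ofHom (tailMap n r)
      s := ModuleCat.ofHom (tailMap n s)
      f_r := ?_
      s_g := ?_
      id := ?_ }
  all_goals
    apply ModuleCat.hom_ext
    refine LinearMap.ext fun (f : TailCochain K A _ n) => funext fun p =>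
      AlternatingMap.ext fun w => MultilinearMap.ext fun a => ?_
  · exact congrArg (fun F => F (f p w a)) h1
  · exact congrArg (fun F => F (f p w a)) h2
  · exact congrArg (fun F => F (f p w a)) h3

end TailComplex

/-! ### Tail cochains of lowest degree -/

section DegreeTwo

variable {K A M M' : Type*} [Field K] [Ring A] [Algebra K A] [PoissonAlgebra K A]
  [AddCommGroup M] [Module K M] [AddCommGroup M'] [Module K M']

/-- The only nonzero component of a tail cochain of degree two. -/
def tailTwoComp (g : MultilinearMap K (fun _ : Fin 2 => A) M) :
    (i j : ℕ) → i + 2 + j = 2 → BiCochain K A M (i + 2) j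
  | 0, 0, _ => AlternatingMap.constOfIsEmpty K (PoissonLie K A) (Fin 0) g
  | 0, _ + 1, _ => 0
  | _ + 1, _, _ => 0

/-- A bilinear map as a tail cochain of degree two. -/
def tailTwo : MultilinearMap K (fun _ : Fin 2 => A) M →ₗ[K] TailCochain K A M 2 where
  toFun g := fun p => tailTwoComp g p.1.1 p.1.2 p.2
  map_add' f g := by
    funext ⟨⟨i, j⟩, h⟩
    obtain rfl : i = 0 := by dsimp only at h; omega
    obtain rfl : j = 0 := by dsimp only at h; omega
    rfl
  map_smul' c f := by
    funext ⟨⟨i, j⟩, h⟩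
    obtain rfl : i = 0 := by dsimp only at h; omega
    obtain rfl : j = 0 := by dsimp only at h; omega
    rfl

theorem tailTwo_apply (g : MultilinearMap K (fun _ : Fin 2 => A) M)
    (w : Fin 0 → PoissonLie K A) : tailTwo g ⟨(0, 0), rfl⟩ w = g := rfl

theorem tailTwo_injective : Function.Injective (tailTwo (K := K) (A := A) (M := M)) :=
  fun _ _ h => congrArg (fun F : TailCochain K A M 2 => F ⟨(0, 0), rfl⟩ 0) h

theorem tailTwo_self (f : TailCochain K A M 2) : tailTwo (f ⟨(0, 0), rfl⟩ 0) = f := by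
  funext ⟨⟨i, j⟩, h⟩
  obtain rfl : i = 0 := by dsimp only at h; omega
  obtain rfl : j = 0 := by dsimp only at h; omega
  refine AlternatingMap.ext fun w => ?_
  rw [Subsingleton.elim w 0]
  rfl

theorem tailMap_tailTwo (φ : M →ₗ[K] M') (g : MultilinearMap K (fun _ : Fin 2 => A) M) :
    tailMap 2 φ (tailTwo g) = tailTwo (φ.compMultilinearMap g) := by
  rw [← tailTwo_self (tailMap 2 φ (tailTwo g))]
  rfl

/-- The coboundary of `g` has one component in Hom(A^3, M), its Hochschild coboundary, and one in
Hom(A^2 ⊗ ⋀^1, M), the Lie action on `g`. The sign there is (-1)^2 = 1. -/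
theorem tailD_tailTwo_eq_zero_iff [Module A M] [Module Aᵐᵒᵖ M] [SMulCommClass A Aᵐᵒᵖ M]
    [IsScalarTower K A M] [IsScalarTower K Aᵐᵒᵖ M] [QuasiPoissonModule K A M]
    (g : MultilinearMap K (fun _ : Fin 2 => A) M) :
    tailD 2 (tailTwo g) = 0 ↔ hochD 2 g = 0 ∧ ∀ x : PoissonLie K A, ⁅x, g⁆ = 0 := by
  have h1 : tailD 2 (tailTwo g) ⟨(1, 0), rfl⟩ 0 = hochD 2 g := add_zero _
  have h2 : ∀ w : Fin 1 → PoissonLie K A, tailD 2 (tailTwo g) ⟨(0, 1), rfl⟩ w = ⁅w 0, g⁆ := by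
    intro w
    refine (zero_add ((-1 : ℤ) ^ 2 • ceD 0 (tailTwo g ⟨(0, 0), rfl⟩) w)).trans ?_
    rw [neg_one_sq, one_smul, ceD_zero_apply, tailTwo_apply]
  constructor
  · intro h
    rw [h] at h1 h2
    exact ⟨h1.symm, fun x => (h2 fun _ => x).symm⟩
  · rintro ⟨hv, hx⟩
    funext ⟨⟨i, j⟩, h⟩
    dsimp only at h
    obtain ⟨rfl, rfl⟩ | ⟨rfl, rfl⟩ : i = 1 ∧ j = 0 ∨ i = 0 ∧ j = 1 := by omega
    · refine AlternatingMap.ext fun w => ?_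
      rw [Subsingleton.elim w 0]
      exact h1.trans hv
    · exact AlternatingMap.ext fun w => (h2 w).trans (hx _)

/-- A bilinear map as a multilinear map. -/
def bilinMulti (B : A →ₗ[K] A →ₗ[K] M) : MultilinearMap K (fun _ : Fin 2 => A) M where
  toFun v := B (v 0) (v 1)
  map_update_add' v i x y := by fin_cases i <;> simp
  map_update_smul' v i c x := by fin_cases i <;> simp

theorem bilinMulti_apply (B : A →ₗ[K] A →ₗ[K] M) (v : Fin 2 → A) :
    bilinMulti B v = B (v 0) (v 1) := rfl

theorem hochD_two_apply [Module A M] [Module Aᵐᵒᵖ M] [SMulCommClass A Aᵐᵒᵖ M]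
    [IsScalarTower K A M] [IsScalarTower K Aᵐᵒᵖ M] (B : A →ₗ[K] A →ₗ[K] M) (v : Fin 3 → A) :
    hochD 2 (bilinMulti B) v = v 0 • B (v 1) (v 2) - B (v 0 * v 1) (v 2) + B (v 0) (v 1 * v 2) -
      op (v 2) • B (v 0) (v 1) := by
  simp [hochD, bilinMulti_apply, Fin.contractNth, Fin.tail, Fin.init, Fin.sum_univ_two]
  abel

theorem lie_bilinMulti {L : Type*} [LieRing L] [LieAlgebra K L] [LieRingModule L A]
    [LieModule K L A] [LieRingModule L M] [LieModule K L M] (B : A →ₗ[K] A →ₗ[K] M) (x : L)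
    (v : Fin 2 → A) : (⁅x, bilinMulti B⁆ : MultilinearMap K (fun _ : Fin 2 => A) M) v =
      ⁅x, B (v 0) (v 1)⁆ - (B ⁅x, v 0⁆ (v 1) + B (v 0) ⁅x, v 1⁆) := by
  simp [lie_multilinear, multilinearLie_apply, bilinMulti_apply, Fin.sum_univ_two]

theorem exists_bilinMulti_eq (g : MultilinearMap K (fun _ : Fin 2 => A) M) :
    ∃ B, bilinMulti B = g := by
  have hc : ∀ (v : Fin 2 → A), ![v 0, v 1] = v := fun v => by
    ext i; fin_cases i <;> rfl
  have h0 : ∀ a c x : A, Function.update ![a, c] 0 x = ![x, c] := fun a c x => by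
    ext i; fin_cases i <;> rfl
  have h1 : ∀ a c x : A, Function.update ![a, c] 1 x = ![a, x] := fun a c x => by
    ext i; fin_cases i <;> rfl
  refine ⟨LinearMap.mk₂ K (fun a b => g ![a, b]) ?_ ?_ ?_ ?_, ?_⟩
  · intro a b c
    have h := g.map_update_add ![a, c] 0 a b
    simpa only [h0] using h
  · intro k a c
    have h := g.map_update_smul ![a, c] 0 k a
    simpa only [h0] using h
  · intro a b c
    have h := g.map_update_add ![a, b] 1 b c
    simpa only [h1] using h
  · intro k a c
    have h := g.map_update_smul ![a, c] 1 k c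
    simpa only [h1] using h
  · ext v
    rw [bilinMulti_apply, LinearMap.mk₂_apply, hc]

end DegreeTwo

/-! ### Maps out of Ω²(A) are the invariant Hochschild two-cocycles -/

section Omega

variable {K A : Type u} [Field K] [Ring A] [Algebra K A] [PoissonAlgebra K A]

theorem smkLeft_tmul_smul {N : Type*} [AddCommGroup N] [Module (QuasiEnv K A) N] (a b : A) (n : N) :
    toQuasiRes K A N (smkLeft K (PoissonLie K A) (A ⊗[K] Aᵐᵒᵖ) (a ⊗ₜ op b) • n) =
      a • op b • toQuasiRes K A N n := by
  rw [quasiRes_op_smul, quasiRes_smul, ← mul_smul, quasiLeft_mul_quasiRight]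

theorem smashTensor_induction {B V : Type*} [Ring B] [Algebra K B] [AddCommGroup V] [Module K V]
    {P : SmashTensor K B V → Prop} (zero : P 0) (stmul : ∀ b v, P (stmul K b v))
    (add : ∀ p q, P p → P q → P (p + q)) (p : SmashTensor K B V) : P p :=
  TensorProduct.induction_on (motive := P) p zero stmul add

theorem stmul_add {B V : Type*} [Ring B] [Algebra K B] [AddCommGroup V] [Module K V] (b : B)
    (v v' : V) : stmul K b (v + v') = stmul K b v + stmul K b v' :=
  TensorProduct.tmul_add b v v'

theorem stmul_smul {B V : Type*} [Ring B] [Algebra K B] [AddCommGroup V] [Module K V] (c : K)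
    (v : V) : stmul K (1 : B) (c • v) = stmul K (algebraMap K B c) v := by
  rw [Algebra.algebraMap_eq_smul_one]
  exact (TensorProduct.smul_tmul c (1 : B) v).symm

variable (K A) in
/-- The projection of `A^4` onto `Ω²(A)`. -/
noncomputable def omegaMk : AFour K A →ₗ[QuasiEnv K A] omegaMod K A := (barRelations K A).mkQ

/-- The map `a ⊗ b ↦ 1 ⊗ a ⊗ b ⊗ 1` to `Ω²(A)`. -/
noncomputable def omegaGen : A ⊗[K] A →ₗ[K] QuasiRes K A (omegaMod K A) where
  toFun v := toQuasiRes K A (omegaMod K A) (omegaMk K A (stmul K 1 v))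
  map_add' v v' := by
    rw [stmul_add, map_add, map_add]
  map_smul' c v := by
    have h : stmul K (1 : A ⊗[K] Aᵐᵒᵖ) (c • v) = algebraMap K (QuasiEnv K A) c • stmul K 1 v := by
      rw [← AlgHom.commutes (smkLeft K (PoissonLie K A) (A ⊗[K] Aᵐᵒᵖ)), smkLeft_apply,
        smk_one_smul_stmul, mul_one, stmul_smul]
    rw [h, map_smul, RingHom.id_apply]
    rfl

theorem lie_omegaGen (x : PoissonLie K A) (v : A ⊗[K] A) :
    ⁅x, omegaGen (K := K) v⁆ = omegaGen ⁅x, v⁆ := by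
  have h : quasiLie K A x • stmul K (1 : A ⊗[K] Aᵐᵒᵖ) v = stmul K 1 ⁅x, v⁆ := by
    refine (smk_ι_smul_stmul K (PoissonLie K A) x 1 v).trans ?_
    have h1 : ⁅x, (1 : A ⊗[K] Aᵐᵒᵖ)⁆ = 0 := by
      have := LieActsByDerivations.lie_mul x (1 : A ⊗[K] Aᵐᵒᵖ) 1
      simpa using this
    rw [h1]
    exact (congrArg (· + stmul K 1 ⁅x, v⁆) (TensorProduct.zero_tmul _ _)).trans (zero_add _)
  refine congrArg (toQuasiRes K A (omegaMod K A)) ?_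
  rw [← h]
  exact (map_smul (omegaMk K A) _ _).symm

theorem omegaMk_four (a b c d : A) :
    toQuasiRes K A (omegaMod K A) (omegaMk K A (four K a b c d)) =
      a • op d • omegaGen (K := K) (b ⊗ₜ c) := by
  have h : four K a b c d = smkLeft K (PoissonLie K A) (A ⊗[K] Aᵐᵒᵖ) (a ⊗ₜ op d) •
      stmul K 1 (b ⊗ₜ[K] c) := by
    rw [smkLeft_apply, smk_one_smul_stmul, mul_one]
    rfl
  rw [h, map_smul]
  exact smkLeft_tmul_smul (N := omegaMod K A) a d _

/-- This is the defining relation of Ω²(A) read as a cocycle identity: `omegaGen` is a Hochschild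
two-cocycle, and the universal invariant one. -/
theorem omegaGen_relation (a b c : A) :
    a • omegaGen (K := K) (b ⊗ₜ c) - omegaGen (K := K) ((a * b) ⊗ₜ c) +
      omegaGen (K := K) (a ⊗ₜ (b * c)) - op c • omegaGen (K := K) (a ⊗ₜ b) = 0 := by
  have h : omegaMk K A (four K a b c 1 - four K 1 (a * b) c 1 + four K 1 a (b * c) 1 -
      four K 1 a b c) = 0 := (Submodule.Quotient.mk_eq_zero (barRelations K A)).2
    (Submodule.subset_span ⟨(a, b, c), rfl⟩)
  have h' := congrArg (toQuasiRes K A (omegaMod K A)) h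
  rw [map_sub, map_add, map_sub, map_sub, map_add, map_sub, map_zero] at h'
  have h2 := (omegaMk_four (K := K) a b c 1)
  have h3 := (omegaMk_four (K := K) 1 (a * b) c 1)
  have h4 := (omegaMk_four (K := K) 1 a (b * c) 1)
  have h5 := (omegaMk_four (K := K) 1 a b c)
  rw [op_one, one_smul] at h2 h3 h4
  rw [one_smul] at h3 h4 h5
  rw [← h2, ← h3, ← h4, ← h5]
  exact h'

/-- The two-cocycle of a map from `Ω²(A)`. -/
noncomputable def omegaCochain (N : ModuleCat.{u} (QuasiEnv K A)) :
    (omegaMod K A ⟶ N) →ₗ[K] TailCochain K A (QuasiRes K A N) 2 :=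
  tailTwo ∘ₗ
    { toFun := fun φ =>
        bilinMulti ((TensorProduct.mk K A A).compr₂ (quasiResMap φ ∘ₗ omegaGen))
      map_add' := fun _ _ => rfl
      map_smul' := fun _ _ => rfl }

theorem omegaCochain_apply (N : ModuleCat.{u} (QuasiEnv K A)) (φ : omegaMod K A ⟶ N) :
    omegaCochain N φ =
      tailTwo (bilinMulti ((TensorProduct.mk K A A).compr₂ (quasiResMap φ ∘ₗ omegaGen))) := rfl

/-- The cochain is the image under φ of the invariant cocycle `omegaGen`, and φ respects all three
actions. -/
theorem tailD_omegaCochain (N : ModuleCat.{u} (QuasiEnv K A)) (φ : omegaMod K A ⟶ N) :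
    tailD 2 (omegaCochain N φ) = 0 := by
  have hφ := quasiResMap_isQuasiHom φ
  rw [omegaCochain_apply, tailD_tailTwo_eq_zero_iff]
  refine ⟨MultilinearMap.ext fun v => ?_, fun x => MultilinearMap.ext fun v => ?_⟩
  · rw [hochD_two_apply]
    have h := congrArg (quasiResMap φ) (omegaGen_relation (K := K) (v 0) (v 1) (v 2))
    rw [map_sub, map_add, map_sub, hφ.map_smul, hφ.map_op_smul, map_zero] at h
    exact h
  · rw [lie_bilinMulti]
    have h := congrArg (quasiResMap φ) (lie_omegaGen (K := K) x (v 0 ⊗ₜ v 1))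
    rw [hφ.map_lie, TensorProduct.LieModule.lie_tmul_right, map_add, map_add] at h
    exact sub_eq_zero.2 h

/-- The map `b ⊗ v ↦ b • T v` on `A^e ⊗ A^2`. -/
noncomputable def fourLift {N : ModuleCat.{u} (QuasiEnv K A)}
    (T : A ⊗[K] A →ₗ[K] QuasiRes K A N) :
    (A ⊗[K] Aᵐᵒᵖ) ⊗[K] (A ⊗[K] A) →ₗ[K] QuasiRes K A N :=
  TensorProduct.lift (LinearMap.mk₂ K
    (fun b v => toQuasiRes K A N (smkLeft K (PoissonLie K A) (A ⊗[K] Aᵐᵒᵖ) b •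
      (toQuasiRes K A N).symm (T v)))
    (fun b b' v => by rw [map_add, add_smul, map_add])
    (fun c b v => by
      obtain ⟨n, hn⟩ := (toQuasiRes K A N).surjective (T v)
      have h : smkLeft K (PoissonLie K A) (A ⊗[K] Aᵐᵒᵖ) (c • b) =
          algebraMap K (QuasiEnv K A) c * smkLeft K _ _ b :=
        (map_smul (smkLeft K _ _) c b).trans (Algebra.smul_def _ _)
      rw [← hn, AddEquiv.symm_apply_apply, quasiRes_smul_field, ← mul_smul, h])
    (fun b v v' => by rw [map_add, map_add, smul_add, map_add])
    (fun c b v => by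
      obtain ⟨n, hn⟩ := (toQuasiRes K A N).surjective (T v)
      rw [map_smul T c v, ← hn, quasiRes_smul_field, AddEquiv.symm_apply_apply,
        AddEquiv.symm_apply_apply, quasiRes_smul_field, ← mul_smul, ← mul_smul,
        Algebra.commutes]))

theorem fourLift_stmul {N : ModuleCat.{u} (QuasiEnv K A)}
    (T : A ⊗[K] A →ₗ[K] QuasiRes K A N) (b : A ⊗[K] Aᵐᵒᵖ) (v : A ⊗[K] A) :
    fourLift T (stmul K b v) = toQuasiRes K A N (smkLeft K (PoissonLie K A) (A ⊗[K] Aᵐᵒᵖ) b •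
      (toQuasiRes K A N).symm (T v)) := rfl

/-- An equivariant map from `A^2` extends to a map of modules from `A^4`. -/
noncomputable def fourHom {N : ModuleCat.{u} (QuasiEnv K A)}
    (T : A ⊗[K] A →ₗ[K] QuasiRes K A N) (hT : ∀ (x : PoissonLie K A) v, T ⁅x, v⁆ = ⁅x, T v⁆) :
    AFour K A →ₗ[QuasiEnv K A] N where
  toFun p := (toQuasiRes K A N).symm (fourLift T p)
  map_add' p q := by
    rw [← map_add]
    exact congrArg _ (map_add (fourLift T) p q)
  map_smul' q p := by
    let F : AFour K A →+ N := (toQuasiRes K A N).symm.toAddMonoidHom.comp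
      (fourLift T).toAddMonoidHom
    have hF : ∀ b v, F (stmul K b v) = smkLeft K (PoissonLie K A) (A ⊗[K] Aᵐᵒᵖ) b •
      (toQuasiRes K A N).symm (T v) := fun _ _ => rfl
    refine map_smash_smul F (fun b p => ?_) (fun x p => ?_) q p
    · induction p using smashTensor_induction with
      | zero => rw [smul_zero, map_zero, smul_zero]
      | stmul c v =>
        have h := smk_one_smul_stmul K (PoissonLie K A) b c v
        refine (congrArg F h).trans ?_
        rw [hF, hF, map_mul, mul_smul]
      | add p q hp hq => rw [smul_add, map_add, hp, hq, map_add, smul_add]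
    · induction p using smashTensor_induction with
      | zero => rw [smul_zero, map_zero, smul_zero]
      | stmul c v =>
        have h := smk_ι_smul_stmul K (PoissonLie K A) x c v
        refine (congrArg F h).trans ?_
        -- The commutation rule x c = [x, c] + c x of the smash product; equivariance of `T` then
        -- turns the last summand into `T` of the Lie action on `v`.
        have h2 : quasiLie K A x • smkLeft K (PoissonLie K A) _ c • (toQuasiRes K A N).symm (T v) =
            smkLeft K (PoissonLie K A) _ ⁅x, c⁆ • (toQuasiRes K A N).symm (T v) +
              smkLeft K (PoissonLie K A) _ c • quasiLie K A x • (toQuasiRes K A N).symm (T v) := by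
          rw [← mul_smul, ← mul_smul, ← add_smul]
          exact congrArg (· • _) (smkRight_ι_mul_smkLeft x c)
        rw [map_add, hF, hF, hT]
        exact h2.symm
      | add p q hp hq => rw [smul_add, map_add, hp, hq, map_add, smul_add]

theorem fourHom_four {N : ModuleCat.{u} (QuasiEnv K A)}
    (T : A ⊗[K] A →ₗ[K] QuasiRes K A N) (hT : ∀ (x : PoissonLie K A) v, T ⁅x, v⁆ = ⁅x, T v⁆)
    (a b c d : A) : toQuasiRes K A N (fourHom T hT (four K a b c d)) = a • op d • T (b ⊗ₜ c) := by
  refine (fourLift_stmul T _ _).trans ?_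
  rw [smkLeft_tmul_smul, AddEquiv.apply_symm_apply]

theorem barRelations_le_ker {N : ModuleCat.{u} (QuasiEnv K A)}
    (T : A ⊗[K] A →ₗ[K] QuasiRes K A N) (hT : ∀ (x : PoissonLie K A) v, T ⁅x, v⁆ = ⁅x, T v⁆)
    (hT' : ∀ a b c : A, a • T (b ⊗ₜ c) - T ((a * b) ⊗ₜ c) + T (a ⊗ₜ (b * c)) -
      op c • T (a ⊗ₜ b) = 0) : barRelations K A ≤ LinearMap.ker (fourHom T hT) := by
  refine Submodule.span_le.2 ?_
  rintro _ ⟨⟨a, b, c⟩, rfl⟩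
  refine LinearMap.mem_ker.2 ((toQuasiRes K A N).injective ?_)
  simp only [map_sub, map_add, fourHom_four, op_one, one_smul, map_zero]
  exact hT' a b c

/-- The map from `Ω²(A)` given by an invariant two-cocycle. -/
noncomputable def omegaHom {N : ModuleCat.{u} (QuasiEnv K A)}
    (T : A ⊗[K] A →ₗ[K] QuasiRes K A N) (hT : ∀ (x : PoissonLie K A) v, T ⁅x, v⁆ = ⁅x, T v⁆)
    (hT' : ∀ a b c : A, a • T (b ⊗ₜ c) - T ((a * b) ⊗ₜ c) + T (a ⊗ₜ (b * c)) -
      op c • T (a ⊗ₜ b) = 0) : omegaMod K A ⟶ N :=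
  ModuleCat.ofHom (X := OmegaTwo K A) (Y := N)
    ((barRelations K A).liftQ (fourHom T hT) (barRelations_le_ker T hT hT'))

theorem quasiResMap_omegaHom {N : ModuleCat.{u} (QuasiEnv K A)}
    (T : A ⊗[K] A →ₗ[K] QuasiRes K A N) (hT : ∀ (x : PoissonLie K A) v, T ⁅x, v⁆ = ⁅x, T v⁆)
    (hT' : ∀ a b c : A, a • T (b ⊗ₜ c) - T ((a * b) ⊗ₜ c) + T (a ⊗ₜ (b * c)) -
      op c • T (a ⊗ₜ b) = 0) : quasiResMap (omegaHom T hT hT') ∘ₗ omegaGen = T := by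
  apply TensorProduct.ext'
  intro a b
  refine (fourHom_four T hT 1 a b 1).trans ?_
  rw [op_one, one_smul, one_smul]

/-- The two halves of the cocycle condition play different roles: invariance lets the bilinear map
extend A^e-linearly to a module map on A^4, and the Hochschild identity makes this extension kill
`barRelations`. -/
theorem exists_omegaCochain_eq (N : ModuleCat.{u} (QuasiEnv K A))
    (f : TailCochain K A (QuasiRes K A N) 2) (hf : tailD 2 f = 0) :
    ∃ φ, omegaCochain N φ = f := by
  rw [← tailTwo_self f] at hf ⊢
  generalize f ⟨(0, 0), rfl⟩ 0 = g at hf ⊢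
  obtain ⟨B, rfl⟩ := exists_bilinMulti_eq g
  rw [tailD_tailTwo_eq_zero_iff] at hf
  obtain ⟨h1, h2⟩ := hf
  have hT : ∀ (x : PoissonLie K A) v, TensorProduct.lift B ⁅x, v⁆ = ⁅x, TensorProduct.lift B v⁆ := by
    intro x v
    have h : TensorProduct.lift B ∘ₗ LieModule.toEnd K (PoissonLie K A) (A ⊗[K] A) x =
        LieModule.toEnd K (PoissonLie K A) (QuasiRes K A N) x ∘ₗ TensorProduct.lift B := by
      apply TensorProduct.ext'
      intro a b
      have := congrArg (fun F => F ![a, b]) (h2 x)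
      rw [lie_bilinMulti] at this
      change TensorProduct.lift B ⁅x, a ⊗ₜ[K] b⁆ = ⁅x, B a b⁆
      rw [TensorProduct.LieModule.lie_tmul_right, map_add]
      exact (sub_eq_zero.1 this).symm
    exact congrArg (fun F => F v) h
  have hT' : ∀ a b c : A, a • TensorProduct.lift B (b ⊗ₜ c) -
      TensorProduct.lift B ((a * b) ⊗ₜ c) + TensorProduct.lift B (a ⊗ₜ (b * c)) -
      op c • TensorProduct.lift B (a ⊗ₜ b) = 0 := by
    intro a b c
    have := congrArg (fun F => F ![a, b, c]) h1
    rw [hochD_two_apply] at this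
    exact this
  refine ⟨omegaHom (TensorProduct.lift B) hT hT', (omegaCochain_apply _ _).trans
    (congrArg tailTwo (MultilinearMap.ext fun v => ?_))⟩
  exact congrArg (fun F => F (v 0 ⊗ₜ v 1)) (quasiResMap_omegaHom (TensorProduct.lift B) hT hT')

/-- Over A^e alone, A^4 is generated by the tensors 1 ⊗ a ⊗ b ⊗ 1, and the cochain records the
values of the map on their classes. -/
theorem omegaCochain_injective (N : ModuleCat.{u} (QuasiEnv K A)) :
    Function.Injective (omegaCochain N) := by
  intro φ ψ h
  have h1 := tailTwo_injective h
  have h2 : quasiResMap φ ∘ₗ omegaGen = quasiResMap ψ ∘ₗ omegaGen := by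
    apply TensorProduct.ext'
    intro a b
    exact congrArg (fun F => F ![a, b]) h1
  apply ModuleCat.hom_ext
  refine LinearMap.ext fun z => ?_
  obtain ⟨p, hp⟩ : ∃ p, omegaMk K A p = z := (barRelations K A).mkQ_surjective z
  rw [← hp]
  clear hp
  induction p using smashTensor_induction with
  | zero => rw [map_zero, map_zero, map_zero]
  | stmul b v =>
    have h3 : stmul K b v = smkLeft K (PoissonLie K A) _ b • stmul K 1 v := by
      rw [smkLeft_apply, smk_one_smul_stmul, mul_one]
    rw [h3, map_smul, map_smul, map_smul]
    exact congrArg _ (congrArg (fun F => F v) h2)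
  | add p q hp hq => rw [map_add, map_add, map_add, hp, hq]

theorem omegaCochain_naturality {N N' : ModuleCat.{u} (QuasiEnv K A)} (ψ : N ⟶ N')
    (φ : omegaMod K A ⟶ N) :
    tailMap 2 (quasiResMap ψ) (omegaCochain N φ) = omegaCochain N' (φ ≫ ψ) := by
  rw [omegaCochain_apply, tailMap_tailTwo]
  rfl

end Omega

/-! ### The coinduced module Hom(A, Hom(S, M)) and its Hochschild homotopy -/

section Coinduced

variable (K A S M : Type*) [Field K] [Ring A] [Algebra K A] [PoissonAlgebra K A]
  [AddCommGroup S] [Module K S] [LieRingModule (PoissonLie K A) S]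
  [LieModule K (PoissonLie K A) S]
  [AddCommGroup M] [Module K M] [Module A M] [Module Aᵐᵒᵖ M]
  [SMulCommClass A Aᵐᵒᵖ M] [IsScalarTower K A M] [IsScalarTower K Aᵐᵒᵖ M]
  [QuasiPoissonModule K A M]

/-- The coinduced module `Hom(A, Hom(S, M))`, with `(a f b)(c) = f(c a) b`. -/
def CoMod : Type _ := A →ₗ[K] S →ₗ[K] M

noncomputable instance : AddCommGroup (CoMod K A S M) :=
  inferInstanceAs (AddCommGroup (A →ₗ[K] S →ₗ[K] M))

noncomputable instance : Module K (CoMod K A S M) :=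
  inferInstanceAs (Module K (A →ₗ[K] S →ₗ[K] M))

/-- The value of an element of the coinduced module. -/
noncomputable def coEval : A →ₗ[K] CoMod K A S M →ₗ[K] S →ₗ[K] M :=
  (LinearMap.id : (A →ₗ[K] S →ₗ[K] M) →ₗ[K] A →ₗ[K] S →ₗ[K] M).flip

variable {K A S M}

theorem coMod_ext {f g : CoMod K A S M} (h : ∀ c z, coEval K A S M c f z = coEval K A S M c g z) :
    f = g :=
  LinearMap.ext fun c => LinearMap.ext fun z => h c z

/-- Construct an element of the coinduced module. -/
def coMk (f : A →ₗ[K] S →ₗ[K] M) : CoMod K A S M := f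

noncomputable instance : Module A (CoMod K A S M) where
  smul a f := coMk ((coEval K A S M).flip f ∘ₗ LinearMap.mulRight K a)
  one_smul f := coMod_ext fun c z => by
    change coEval K A S M (c * 1) f z = _
    rw [mul_one]
  mul_smul a b f := coMod_ext fun c z => by
    change coEval K A S M (c * (a * b)) f z = coEval K A S M (c * a * b) f z
    rw [mul_assoc]
  smul_zero a := rfl
  smul_add a f g := rfl
  add_smul a b f := coMod_ext fun c z => by
    change coEval K A S M (c * (a + b)) f z = coEval K A S M (c * a) f z + coEval K A S M (c * b) f z
    rw [mul_add, map_add]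
    rfl
  zero_smul f := coMod_ext fun c z => by
    change coEval K A S M (c * 0) f z = 0
    rw [mul_zero, map_zero]
    rfl

theorem coEval_smul (a c : A) (f : CoMod K A S M) :
    coEval K A S M c (a • f) = coEval K A S M (c * a) f := rfl

noncomputable instance : Module Aᵐᵒᵖ (CoMod K A S M) :=
  inferInstanceAs (Module Aᵐᵒᵖ (A →ₗ[K] S →ₗ[K] M))

theorem coEval_op_smul (b : Aᵐᵒᵖ) (c : A) (f : CoMod K A S M) :
    coEval K A S M c (b • f) = b • coEval K A S M c f := rfl

instance : SMulCommClass A Aᵐᵒᵖ (CoMod K A S M) where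
  smul_comm _ _ _ := rfl

instance : IsScalarTower K A (CoMod K A S M) where
  smul_assoc k a f := coMod_ext fun c z => by
    rw [coEval_smul, map_smul, coEval_smul, mul_smul_comm, map_smul]
    rfl

instance : IsScalarTower K Aᵐᵒᵖ (CoMod K A S M) :=
  inferInstanceAs (IsScalarTower K Aᵐᵒᵖ (A →ₗ[K] S →ₗ[K] M))

variable (K A S M) in
/-- The Lie action on the coinduced module. -/
noncomputable def coAct : A →ₗ[K] CoMod K A S M →ₗ[K] CoMod K A S M :=
  let B : A →ₗ[K] (A →ₗ[K] S →ₗ[K] M) →ₗ[K] A →ₗ[K] S →ₗ[K] M :=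
    LinearMap.mk₂ K (fun a f => ⁅toLie K a, f⁆)
      (fun a b f => by rw [map_add, add_lie]) (fun c a f => by rw [map_smul, smul_lie])
      (fun a f g => lie_add _ f g) (fun c a f => lie_smul c _ f)
  B

theorem coEval_coAct (a c : A) (f : CoMod K A S M) (z : S) :
    coEval K A S M c (coAct K A S M a f) z = ⁅toLie K a, coEval K A S M c f z⁆ -
      coEval K A S M c f ⁅toLie K a, z⁆ - coEval K A S M ⁅toLie K a, c⁆ f z := rfl

noncomputable instance : QuasiPoissonModule K A (CoMod K A S M) where
  act := coAct K A S M
  act_bracket a b f := by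
    exact lie_lie (M := A →ₗ[K] S →ₗ[K] M) (toLie K a) (toLie K b) f
  act_smul a b f := coMod_ext fun c z => by
    have h : ⁅toLie K a, c * b⁆ = ⁅toLie K a, c⁆ * b + c * ⁅toLie K a, b⁆ := lie_alg_mul _ _ _
    rw [coEval_coAct, map_add, LinearMap.add_apply, coEval_smul, coEval_smul, coEval_smul,
      coEval_smul, coEval_coAct, h, map_add, LinearMap.add_apply, LinearMap.add_apply]
    change _ = coEval K A S M (c * ⁅toLie K a, b⁆) f z + _
    abel
  act_op_smul a b f := coMod_ext fun c z => by
    rw [coEval_coAct, map_add, LinearMap.add_apply, coEval_op_smul, coEval_op_smul, coEval_op_smul,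
      coEval_op_smul, LinearMap.smul_apply, LinearMap.smul_apply, LinearMap.smul_apply,
      LinearMap.smul_apply, LinearMap.smul_apply, coEval_coAct, lie_mod_op_smul, smul_sub, smul_sub]
    change _ = op ⁅toLie K a, b⁆ • coEval K A S M c f z + _
    abel

theorem coEval_lie (x : PoissonLie K A) (c : A) (f : CoMod K A S M) (z : S) :
    coEval K A S M c ⁅x, f⁆ z = ⁅x, coEval K A S M c f z⁆ -
      coEval K A S M c f ⁅x, z⁆ - coEval K A S M ⁅x, c⁆ f z := rfl

theorem coEval_lie' (x : PoissonLie K A) (c : A) (f : CoMod K A S M) :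
    coEval K A S M c ⁅x, f⁆ = ⁅x, coEval K A S M c f⁆ - coEval K A S M ⁅x, c⁆ f := rfl

section Homotopy

/-- The contracting homotopy `(s f)(v)(c) = f(c, v)(1)` of the Hochschild complex with
coefficients in the coinduced module. -/
noncomputable def coHtpy (n : ℕ) :
    MultilinearMap K (fun _ : Fin (n + 1) => A) (CoMod K A S M) →ₗ[K]
      MultilinearMap K (fun _ : Fin n => A) (CoMod K A S M) where
  toFun F :=
    { toFun := fun v => coMk
        { toFun := fun c => coEval K A S M 1 (F.curryLeft c v)
          map_add' := fun c c' => by rw [map_add, add_apply, map_add]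
          map_smul' := fun k c => by
            rw [map_smul, smul_apply, map_smul, RingHom.id_apply] }
      map_update_add' := fun v i a b => coMod_ext fun c z => by
        change coEval K A S M 1 (F.curryLeft c _) z = coEval K A S M 1 (F.curryLeft c _) z +
          coEval K A S M 1 (F.curryLeft c _) z
        rw [MultilinearMap.map_update_add, map_add]
        rfl
      map_update_smul' := fun v i k a => coMod_ext fun c z => by
        change coEval K A S M 1 (F.curryLeft c _) z = k • coEval K A S M 1 (F.curryLeft c _) z
        rw [MultilinearMap.map_update_smul, map_smul]
        rfl }
  map_add' F G := rfl
  map_smul' k F := rfl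

theorem coEval_coHtpy (n : ℕ) (F : MultilinearMap K (fun _ : Fin (n + 1) => A) (CoMod K A S M))
    (v : Fin n → A) (c : A) :
    coEval K A S M c (coHtpy n F v) = coEval K A S M 1 (F.curryLeft c v) := rfl

theorem coEval_comp_coHtpy (n : ℕ)
    (F : MultilinearMap K (fun _ : Fin (n + 1) => A) (CoMod K A S M)) (c : A) :
    (coEval K A S M c).compMultilinearMap (coHtpy n F) =
      (coEval K A S M 1).compMultilinearMap (F.curryLeft c) := rfl

/-- The homotopy moves an argument of `F` into the coinduced variable and evaluates at 1. Since {x,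
1} = 0, evaluation at 1 is equivariant. -/
theorem lie_coHtpy (n : ℕ) (x : PoissonLie K A)
    (F : MultilinearMap K (fun _ : Fin (n + 1) => A) (CoMod K A S M)) :
    coHtpy n ⁅x, F⁆ = ⁅x, coHtpy n F⁆ := by
  refine MultilinearMap.ext fun v => coMod_ext fun c z => ?_
  rw [coEval_coHtpy, lie_curryLeft, lie_multilinear, lie_multilinear, multilinearLie_apply,
    sub_apply, multilinearLie_apply, map_sub, map_sub, map_sub, coEval_lie', coEval_lie',
    lie_one_alg, map_zero, LinearMap.zero_apply, sub_zero, map_sum, map_sum, coEval_coHtpy,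
    coEval_coHtpy]
  simp only [coEval_coHtpy]
  rw [sub_right_comm]

/-- `hochT` omits the term with the left action, so compatibility with the right action is enough.
It is applied to evaluation at a point of A, which need not respect the left action. -/
theorem hochT_compMultilinearMap {N N' : Type*} [AddCommGroup N] [Module K N] [Module A N]
    [Module Aᵐᵒᵖ N] [SMulCommClass A Aᵐᵒᵖ N] [IsScalarTower K A N] [IsScalarTower K Aᵐᵒᵖ N]
    [AddCommGroup N'] [Module K N'] [Module A N'] [Module Aᵐᵒᵖ N'] [SMulCommClass A Aᵐᵒᵖ N']
    [IsScalarTower K A N'] [IsScalarTower K Aᵐᵒᵖ N'] (φ : N →ₗ[K] N')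
    (hr : ∀ (a : A) (m : N), φ (op a • m) = op a • φ m) (n : ℕ)
    (f : MultilinearMap K (fun _ : Fin n => A) N) :
    hochT n (φ.compMultilinearMap f) = φ.compMultilinearMap (hochT n f) := by
  have hc : ∀ (m : ℕ) (g : MultilinearMap K (fun _ : Fin (m + 1) => A) N) (e : A),
      (φ.compMultilinearMap g).curryLeft e = φ.compMultilinearMap (g.curryLeft e) :=
    fun _ _ _ => rfl
  induction n with
  | zero =>
    apply multilinear_ext_curryLeft
    intro e
    rw [hc, hochT_zero_curryLeft, hochT_zero_curryLeft]
    ext v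
    simp [hochR_zero_apply, hr]
  | succ n ih =>
    apply multilinear_ext_curryLeft
    intro e
    rw [hc, hochT_succ_curryLeft, hochT_succ_curryLeft, hc, ih]
    ext v
    refine Eq.trans ?_ (map_sub φ _ _).symm
    refine congrArg₂ (· - ·) (Eq.trans ?_ (map_neg φ _).symm) rfl
    rfl

/-- With b the coboundary and s the homotopy, (s b F)(v)(c) = (b F)(c, v)(1). Its first term is (c
F(v))(1) = F(v)(c), which recovers F. The first term of b s F is (s F)(v₁, …)(c v₀) = F(c v₀, v₁,
…)(1), which cancels the term multiplying c and v₀ together; the remaining terms cancel in pairs. -/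
theorem coHtpy_hochD (n : ℕ)
    (F : MultilinearMap K (fun _ : Fin (n + 1) => A) (CoMod K A S M)) :
    coHtpy (n + 1) (hochD (n + 1) F) + hochD n (coHtpy n F) = F := by
  refine MultilinearMap.ext fun v => coMod_ext fun c z => ?_
  have h1 : coEval K A S M c (coHtpy (n + 1) (hochD (n + 1) F) v) =
      coEval K A S M c (F v) - coEval K A S M 1 (hochR (n + 1) c F v) -
        coEval K A S M 1 (hochT n (F.curryLeft c) v) := by
    rw [coEval_coHtpy, hochD_eq]
    have h : (hochL (n + 1) F + hochT (n + 1) F).curryLeft c =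
        (Algebra.lsmul K K (CoMod K A S M) c).compMultilinearMap F +
          (-hochR (n + 1) c F - hochT n (F.curryLeft c)) := rfl
    rw [h, add_apply, sub_apply, neg_apply, map_add, map_sub, map_neg,
      LinearMap.compMultilinearMap_apply, Algebra.lsmul_coe, coEval_smul, one_mul]
    abel
  have h2 : coEval K A S M c (hochD n (coHtpy n F) v) =
      coEval K A S M 1 (hochR (n + 1) c F v) + coEval K A S M 1 (hochT n (F.curryLeft c) v) := by
    rw [hochD_eq, add_apply, map_add]
    congr 1
    rw [← LinearMap.compMultilinearMap_apply, ← hochT_compMultilinearMap _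
      (fun a m => coEval_op_smul (op a) c m), coEval_comp_coHtpy, hochT_compMultilinearMap _
      (fun a m => coEval_op_smul (op a) 1 m)]
    rfl
  rw [add_apply, map_add, h1, h2]
  simp

end Homotopy

end Coinduced

/-! ### Acyclicity of the coinduced module for the tail complex -/

section Vanishing

variable {K A : Type u} {S M : Type*} [Field K] [Ring A] [Algebra K A] [PoissonAlgebra K A]
  [AddCommGroup S] [Module K S] [LieRingModule (PoissonLie K A) S]
  [LieModule K (PoissonLie K A) S]
  [AddCommGroup M] [Module K M] [Module A M] [Module Aᵐᵒᵖ M]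
  [SMulCommClass A Aᵐᵒᵖ M] [IsScalarTower K A M] [IsScalarTower K Aᵐᵒᵖ M]
  [QuasiPoissonModule K A M]

/-- Evaluation of an element of the coinduced module at `z`. -/
noncomputable def coFlip (z : S) : CoMod K A S M →ₗ[K] A →ₗ[K] M where
  toFun f := (LinearMap.flip ((coEval K A S M).flip f)) z
  map_add' _ _ := rfl
  map_smul' _ _ := rfl

/-- Multilinear maps with values in the coinduced module, as maps on `S`. -/
noncomputable def coSwap (n : ℕ) : MultilinearMap K (fun _ : Fin n => A) (CoMod K A S M) →ₗ[K]
    S →ₗ[K] MultilinearMap K (fun _ : Fin n => A) (A →ₗ[K] M) where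
  toFun F :=
    { toFun := fun z => (coFlip z).compMultilinearMap F
      map_add' := fun z z' => MultilinearMap.ext fun v => LinearMap.ext fun c =>
        map_add (coEval K A S M c (F v)) z z'
      map_smul' := fun k z => MultilinearMap.ext fun v => LinearMap.ext fun c =>
        map_smul (coEval K A S M c (F v)) k z }
  map_add' _ _ := rfl
  map_smul' _ _ := rfl

theorem coSwap_apply (n : ℕ) (F : MultilinearMap K (fun _ : Fin n => A) (CoMod K A S M)) (z : S)
    (v : Fin n → A) (c : A) : coSwap n F z v c = coEval K A S M c (F v) z := rfl

/-- The inverse of `coSwap`. -/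
noncomputable def coUnswap (n : ℕ) :
    (S →ₗ[K] MultilinearMap K (fun _ : Fin n => A) (A →ₗ[K] M)) →ₗ[K]
      MultilinearMap K (fun _ : Fin n => A) (CoMod K A S M) where
  toFun g :=
    { toFun := fun v => coMk (LinearMap.flip
        { toFun := fun z => g z v
          map_add' := fun z z' => by rw [map_add, add_apply]
          map_smul' := fun k z => by rw [map_smul, smul_apply, RingHom.id_apply] })
      map_update_add' := fun v i a b => coMod_ext fun c z =>
        congrArg (fun F => F c) ((g z).map_update_add v i a b)
      map_update_smul' := fun v i k a => coMod_ext fun c z =>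
        congrArg (fun F => F c) ((g z).map_update_smul v i k a) }
  map_add' _ _ := rfl
  map_smul' _ _ := rfl

theorem coUnswap_coSwap (n : ℕ) (F : MultilinearMap K (fun _ : Fin n => A) (CoMod K A S M)) :
    coUnswap n (coSwap n F) = F := rfl

theorem coSwap_coUnswap (n : ℕ)
    (g : S →ₗ[K] MultilinearMap K (fun _ : Fin n => A) (A →ₗ[K] M)) :
    coSwap n (coUnswap n g) = g := rfl

theorem coSwap_lie (n : ℕ) (x : PoissonLie K A)
    (F : MultilinearMap K (fun _ : Fin n => A) (CoMod K A S M)) :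
    coSwap n ⁅x, F⁆ = ⁅x, coSwap n F⁆ := by
  refine LinearMap.ext fun z => MultilinearMap.ext fun v => LinearMap.ext fun c => ?_
  rw [coSwap_apply, LieHom.lie_apply, sub_apply, LinearMap.sub_apply, lie_multilinear,
    lie_multilinear, multilinearLie_apply, multilinearLie_apply, LinearMap.sub_apply,
    LieHom.lie_apply, map_sub, LinearMap.sub_apply, map_sum, LinearMap.sum_apply, coEval_lie,
    LinearMap.sum_apply]
  simp only [coSwap_apply]
  abel

theorem coUnswap_lie (n : ℕ) (x : PoissonLie K A)
    (g : S →ₗ[K] MultilinearMap K (fun _ : Fin n => A) (A →ₗ[K] M)) :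
    coUnswap n ⁅x, g⁆ = ⁅x, coUnswap n g⁆ := by
  rw [← coUnswap_coSwap n ⁅x, coUnswap n g⁆, coSwap_lie, coSwap_coUnswap]

/-- The coefficient module of multilinear maps into the coinduced module is equivariantly Hom(S, W),
where W consists of multilinear maps into Hom(A, M). The Euler argument therefore applies in every
Hochschild degree. -/
theorem exists_ceD_eq_coMod [CharZero K] (E : EulerFiltration K (PoissonLie K A) S) (i j : ℕ)
    (f : BiCochain K A (CoMod K A S M) i (j + 1)) (hf : ceD (j + 1) f = 0) :
    ∃ g, ceD j g = f :=
  exists_ceD_eq_of_retract (W := S →ₗ[K] MultilinearMap K (fun _ : Fin i => A) (A →ₗ[K] M))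
    (coSwap i) (coSwap_lie i) (coUnswap i) (coUnswap_lie i) (coUnswap_coSwap i) j
    (fun f hf => exists_ceD_eq E j f hf) f hf

/-- The contracting homotopy on cochains. -/
noncomputable def biHtpy (i j : ℕ) : BiCochain K A (CoMod K A S M) (i + 1) j →ₗ[K]
    BiCochain K A (CoMod K A S M) i j :=
  LinearMap.compAlternatingMapₗ K (coHtpy i)

theorem ceD_biHtpy (i j : ℕ) (f : BiCochain K A (CoMod K A S M) (i + 1) j) :
    ceD j (biHtpy i j f) = biHtpy i (j + 1) (ceD j f) :=
  ceD_comp j (coHtpy i) (lie_coHtpy i) f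

theorem biHtpy_vertD (i j : ℕ) (f : BiCochain K A (CoMod K A S M) (i + 1) j) :
    biHtpy (i + 1) j (vertD (i + 1) j f) + vertD i j (biHtpy i j f) = f :=
  AlternatingMap.ext fun w => coHtpy_hochD i (f w)

/-- The contracting homotopy on tail cochains. -/
noncomputable def tailHtpy (n : ℕ) (f : TailCochain K A (CoMod K A S M) (n + 1)) :
    TailCochain K A (CoMod K A S M) n :=
  fun p => biHtpy _ _ (f ⟨(p.1.1 + 1, p.1.2), by have := p.2; dsimp only; omega⟩)

/-- Lowering the Hochschild degree by one flips the sign (-1)^i, so the homotopy anticommutes with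
the signed Lie part of the coboundary. -/
theorem tailHoriz_tailHtpy (n : ℕ) (f : TailCochain K A (CoMod K A S M) (n + 1)) (i j : ℕ)
    (h : i + 2 + j = n + 1) (h' : i + 1 + 2 + j = n + 1 + 1) :
    tailHoriz n (tailHtpy n f) i j h = -biHtpy (i + 2) j (tailHoriz (n + 1) f (i + 1) j h') := by
  cases j with
  | zero => exact (neg_eq_zero.2 (map_zero (biHtpy (i + 2) 0))).symm
  | succ j =>
    have h1 : ∀ g : BiCochain K A (CoMod K A S M) (i + 3) j,
        (-1 : ℤ) ^ (i + 2) • ceD j (biHtpy (i + 2) j g) =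
          -biHtpy (i + 2) (j + 1) ((-1 : ℤ) ^ (i + 3) • ceD j g) := fun g => by
      rw [ceD_biHtpy, map_zsmul, pow_succ (-1 : ℤ) (i + 2), mul_neg_one, neg_smul, neg_neg]
    exact h1 _

/-- For a cocycle the Lie part of the coboundary is minus the Hochschild part, and the homotopy
identity recovers `f`. Hochschild degree two is excluded: there the identity would need a term of
Hochschild degree one, which the tail complex does not contain. -/
theorem tailD_tailHtpy (n : ℕ) (f : TailCochain K A (CoMod K A S M) (n + 1))
    (hf : tailD (n + 1) f = 0) (i j : ℕ) (h : i + 1 + 2 + j = n + 1) :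
    tailD n (tailHtpy n f) ⟨(i + 1, j), h⟩ = f ⟨(i + 1, j), h⟩ := by
  obtain ⟨g, hg⟩ : ∃ g : BiCochain K A (CoMod K A S M) (i + 3) j, g = f ⟨(i + 1, j), h⟩ :=
    ⟨_, rfl⟩
  have h' : i + 1 + 1 + 2 + j = n + 1 + 1 := by omega
  have h0 : vertD (i + 3) j g + tailHoriz (n + 1) f (i + 1 + 1) j h' = 0 := by
    rw [hg]
    exact congrArg (fun F : TailCochain K A (CoMod K A S M) (n + 1 + 1) => F ⟨(i + 2, j), h'⟩) hf
  have h1 := tailHoriz_tailHtpy n f (i + 1) j h h'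
  rw [← hg]
  have h2 : tailD n (tailHtpy n f) ⟨(i + 1, j), h⟩ =
      vertD (i + 2) j (biHtpy (i + 2) j g) + tailHoriz n (tailHtpy n f) (i + 1) j h := by
    rw [hg]
    rfl
  refine h2.trans ?_
  rw [h1, eq_neg_of_add_eq_zero_right h0, map_neg, neg_neg]
  exact (add_comm _ _).trans (biHtpy_vertD (i + 2) j g)

theorem tailHoriz_zero_succ {N : Type*} [AddCommGroup N] [Module K N] [Module A N]
    [Module Aᵐᵒᵖ N] [SMulCommClass A Aᵐᵒᵖ N] [IsScalarTower K A N] [IsScalarTower K Aᵐᵒᵖ N]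
    [QuasiPoissonModule K A N] (n : ℕ) (f : TailCochain K A N n) (j : ℕ)
    (h : 0 + 2 + (j + 1) = n + 1) (h' : 0 + 2 + j = n) (g : BiCochain K A N 2 j)
    (hg : f ⟨(0, j), h'⟩ = g) : tailHoriz n f 0 (j + 1) h = ceD j g := by
  subst hg
  exact (congrArg (· • ceD j (f ⟨(0, j), h'⟩)) (neg_one_sq (R := ℤ))).trans (one_smul ℤ _)

theorem tailHoriz_eq_zero {N : Type*} [AddCommGroup N] [Module K N] [Module A N]
    [Module Aᵐᵒᵖ N] [SMulCommClass A Aᵐᵒᵖ N] [IsScalarTower K A N] [IsScalarTower K Aᵐᵒᵖ N]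
    [QuasiPoissonModule K A N] (n : ℕ) (f : TailCochain K A N n) (i j : ℕ)
    (h : i + 2 + j = n + 1) (hf : ∀ j h, f ⟨(i, j), h⟩ = 0) : tailHoriz n f i j h = 0 := by
  cases j with
  | zero => rfl
  | succ j =>
    change (-1 : ℤ) ^ (i + 2) • ceD j (f ⟨(i, j), _⟩) = 0
    rw [hf, map_zero, smul_zero]

/-- A tail cochain concentrated in Hochschild degree two. -/
def tailBottomComp {N : Type*} [AddCommGroup N] [Module K N] (n : ℕ) (g : BiCochain K A N 2 n) :
    (i j : ℕ) → i + 2 + j = n + 2 → BiCochain K A N (i + 2) j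
  | 0, j, h => g.domDomCongr (finCongr (by omega : n = j))
  | _ + 1, _, _ => 0

/-- The tail cohomology of a coinduced module vanishes in degrees greater than two. -/
theorem exists_tailD_eq_coMod [CharZero K] (E : EulerFiltration K (PoissonLie K A) S) (n : ℕ)
    (f : TailCochain K A (CoMod K A S M) (n + 3)) (hf : tailD (n + 3) f = 0) :
    ∃ g, tailD (n + 2) g = f := by
  -- Subtracting the coboundary of the homotopy leaves a cocycle concentrated in Hochschild degree
  -- two. Its single component `F` is closed in both directions.
  obtain ⟨f', hf'⟩ : ∃ f', f' = f - tailD (n + 2) (tailHtpy (n + 2) f) := ⟨_, rfl⟩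
  have h0 : ∀ i j h, f' ⟨(i + 1, j), h⟩ = 0 := fun i j h => by
    rw [hf']
    exact sub_eq_zero.2 (tailD_tailHtpy (n + 2) f hf i j h).symm
  have hc : tailD (n + 3) f' = 0 := by
    rw [hf', map_sub, hf, tailD_tailD, sub_zero]
  suffices ∃ g, tailD (n + 2) g = f' by
    obtain ⟨g, hg⟩ := this
    exact ⟨g + tailHtpy (n + 2) f, by rw [map_add, hg, hf', sub_add_cancel]⟩
  have hi : 0 + 2 + (n + 1) = n + 3 := by omega
  obtain ⟨F, hF⟩ : ∃ F : BiCochain K A (CoMod K A S M) 2 (n + 1), f' ⟨(0, n + 1), hi⟩ = F :=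
    ⟨_, rfl⟩
  have hv : vertD 2 (n + 1) F = 0 := by
    have h1 : 0 + 1 + 2 + (n + 1) = n + 3 + 1 := by omega
    have h2 : vertD 2 (n + 1) F + tailHoriz (n + 3) f' (0 + 1) (n + 1) h1 = 0 := by
      rw [← hF]
      exact congrArg (fun G : TailCochain K A (CoMod K A S M) (n + 3 + 1) =>
        G ⟨(1, n + 1), h1⟩) hc
    rwa [tailHoriz_eq_zero _ _ _ _ _ (h0 0), add_zero] at h2
  have hx : ceD (n + 1) F = 0 := by
    have h1 : 0 + 2 + (n + 1 + 1) = n + 3 + 1 := by omega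
    rw [← tailHoriz_zero_succ (n + 3) f' (n + 1) h1 hi F hF, ← zero_add (tailHoriz _ _ _ _ _)]
    exact congrArg (fun G : TailCochain K A (CoMod K A S M) (n + 3 + 1) =>
        G ⟨(0, n + 2), h1⟩) hc
  -- A Lie primitive of `F` exists because its exterior degree n + 1 is positive; it need not be a
  -- Hochschild cocycle.
  obtain ⟨g', hg'⟩ := exists_ceD_eq_coMod E 2 n F hx
  have hs : vertD 1 (n + 1) (biHtpy 1 (n + 1) F) = F := by
    have := biHtpy_vertD 1 (n + 1) F
    rwa [hv, map_zero, zero_add] at this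
  -- The primitive is projected to Hochschild coboundaries by b s, passing through Hochschild degree
  -- one outside the tail. This projection commutes with the Lie differential and fixes `F`, because
  -- b `F` = 0, so the result is still a primitive.
  obtain ⟨g, hg, hgv⟩ : ∃ g, ceD n g = F ∧ vertD 2 n g = 0 :=
    ⟨vertD 1 n (biHtpy 1 n g'), by rw [ceD_vertD, ceD_biHtpy, hg', hs], vertD_vertD 1 n _⟩
  obtain ⟨G, hG⟩ : ∃ G : TailCochain K A (CoMod K A S M) (n + 2),
      ∀ p, G p = tailBottomComp n g p.1.1 p.1.2 p.2 := ⟨fun p => tailBottomComp n g _ _ p.2, fun _ => rfl⟩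
  have hG0 : ∀ h, G ⟨(0, n), h⟩ = g := fun h => by rw [hG]; rfl
  have hG1 : ∀ i j h, G ⟨(i + 1, j), h⟩ = 0 := fun i j h => by rw [hG]; rfl
  refine ⟨G, ?_⟩
  funext ⟨⟨i, j⟩, h⟩
  rcases i with _ | _ | i
  · obtain rfl : j = n + 1 := by dsimp only at h; omega
    refine (zero_add (tailHoriz (n + 2) G 0 (n + 1) h)).trans ?_
    rw [tailHoriz_zero_succ (n + 2) G n h (by omega) g (hG0 _), hg, hF]
  · obtain rfl : j = n := by dsimp only at h; omega
    rw [h0]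
    refine (congrArg₂ (· + ·) ((congrArg (vertD 2 j) (hG0 _)).trans hgv)
      (tailHoriz_eq_zero (j + 2) G 1 j h (hG1 0))).trans (add_zero _)
  · rw [h0]
    exact (congrArg₂ (· + ·) ((congrArg (vertD (i + 3) j) (hG1 _ _ _)).trans (map_zero _))
      (tailHoriz_eq_zero (n + 2) G (i + 2) j h (hG1 (i + 1)))).trans (add_zero _)

/-- The embedding `m ↦ (c ↦ (z ↦ ε(z) c m))` in the coinduced module. -/
noncomputable def coEmb (E : EulerFiltration K (PoissonLie K A) S) : M →ₗ[K] CoMod K A S M where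
  toFun m := coMk (constCoind E ∘ₗ (Algebra.lsmul K K M).toLinearMap.flip m)
  map_add' m m' := coMod_ext fun c z => by
    change E.ε z • c • (m + m') = E.ε z • c • m + E.ε z • c • m'
    rw [smul_add, smul_add]
  map_smul' k m := coMod_ext fun c z => by
    change E.ε z • c • k • m = k • E.ε z • c • m
    rw [smul_comm c k, smul_comm _ k]

theorem coEval_coEmb (E : EulerFiltration K (PoissonLie K A) S) (m : M) (c : A) (z : S) :
    coEval K A S M c (coEmb E m) z = E.ε z • c • m := rfl

/-- Compatibility with the Lie action is [x, c m] - [x, c] m = c [x, m] together with invariance of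
ε. -/
theorem coEmb_isQuasiHom (E : EulerFiltration K (PoissonLie K A) S) :
    IsQuasiHom (A := A) (coEmb (M := M) E) where
  map_smul a m := coMod_ext fun c z => by
    rw [coEval_smul, coEval_coEmb, coEval_coEmb, mul_smul]
  map_op_smul a m := coMod_ext fun c z => by
    rw [coEval_op_smul, coEval_coEmb, LinearMap.smul_apply, coEval_coEmb, smul_comm c,
      smul_comm (E.ε z)]
  map_lie x m := coMod_ext fun c z => by
    rw [coEval_lie, coEval_coEmb, coEval_coEmb, coEval_coEmb, coEval_coEmb, E.ε_lie, zero_smul,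
      sub_zero, lie_smul, lie_mod_smul, smul_add, add_sub_cancel_left]

theorem coEmb_injective (E : EulerFiltration K (PoissonLie K A) S) :
    Function.Injective (coEmb (M := M) E) := by
  intro m m' h
  have := congrArg (fun F => coEval K A S M 1 F E.one) h
  simpa [coEval_coEmb, E.ε_one] using this

end Vanishing

/-! ### Tail cohomology as `Ext` over A^e # U(A) -/

section Final

variable {K A : Type u} [Field K] [Ring A] [Algebra K A] [PoissonAlgebra K A]

/-- The tail cohomology of a retract of a module with vanishing tail cohomology vanishes. -/
theorem exists_tailD_eq_of_retract {N W : Type*} [AddCommGroup N] [Module K N] [Module A N]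
    [Module Aᵐᵒᵖ N] [SMulCommClass A Aᵐᵒᵖ N] [IsScalarTower K A N] [IsScalarTower K Aᵐᵒᵖ N]
    [QuasiPoissonModule K A N] [AddCommGroup W] [Module K W] [Module A W]
    [Module Aᵐᵒᵖ W] [SMulCommClass A Aᵐᵒᵖ W] [IsScalarTower K A W] [IsScalarTower K Aᵐᵒᵖ W]
    [QuasiPoissonModule K A W] (i : N →ₗ[K] W) (hi : IsQuasiHom (A := A) i) (r : W →ₗ[K] N)
    (hr : IsQuasiHom (A := A) r) (hri : ∀ n, r (i n) = n) (n : ℕ)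
    (hW : ∀ f : TailCochain K A W (n + 1), tailD (n + 1) f = 0 → ∃ g, tailD n g = f)
    (f : TailCochain K A N (n + 1)) (hf : tailD (n + 1) f = 0) : ∃ g, tailD n g = f := by
  obtain ⟨g, hg⟩ := hW (tailMap (n + 1) i f) (by rw [tailD_tailMap hi, hf, map_zero])
  refine ⟨tailMap n r g, ?_⟩
  rw [tailD_tailMap hr, hg]
  funext p
  refine AlternatingMap.ext fun w => MultilinearMap.ext fun a => ?_
  exact hri (f p w a)

theorem IsQuasiHom.comp {M₁ M₂ M₃ : Type*} [AddCommGroup M₁] [Module K M₁] [Module A M₁]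
    [Module Aᵐᵒᵖ M₁] [SMulCommClass A Aᵐᵒᵖ M₁] [IsScalarTower K A M₁] [IsScalarTower K Aᵐᵒᵖ M₁]
    [QuasiPoissonModule K A M₁] [AddCommGroup M₂] [Module K M₂] [Module A M₂]
    [Module Aᵐᵒᵖ M₂] [SMulCommClass A Aᵐᵒᵖ M₂] [IsScalarTower K A M₂] [IsScalarTower K Aᵐᵒᵖ M₂]
    [QuasiPoissonModule K A M₂] [AddCommGroup M₃] [Module K M₃] [Module A M₃]
    [Module Aᵐᵒᵖ M₃] [SMulCommClass A Aᵐᵒᵖ M₃] [IsScalarTower K A M₃] [IsScalarTower K Aᵐᵒᵖ M₃]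
    [QuasiPoissonModule K A M₃] {ψ : M₂ →ₗ[K] M₃} {φ : M₁ →ₗ[K] M₂} (hψ : IsQuasiHom (A := A) ψ)
    (hφ : IsQuasiHom (A := A) φ) : IsQuasiHom (A := A) (ψ ∘ₗ φ) where
  map_smul a m := (congrArg ψ (hφ.map_smul a m)).trans (hψ.map_smul a (φ m))
  map_op_smul a m := (congrArg ψ (hφ.map_op_smul a m)).trans (hψ.map_op_smul a (φ m))
  map_lie x m := (congrArg ψ (hφ.map_lie x m)).trans (hψ.map_lie x (φ m))

/-- An embedding of an injective module in a quasi-Poisson module splits. -/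
theorem exists_retraction_of_injective (J : ModuleCat.{u} (QuasiEnv K A)) [Injective J]
    {W : Type u} [AddCommGroup W] [Module K W] [Module A W]
    [Module Aᵐᵒᵖ W] [SMulCommClass A Aᵐᵒᵖ W] [IsScalarTower K A W] [IsScalarTower K Aᵐᵒᵖ W]
    [QuasiPoissonModule K A W] (i : QuasiRes K A J →ₗ[K] W) (hi : IsQuasiHom (A := A) i)
    (hinj : Function.Injective i) :
    ∃ r : W →ₗ[K] QuasiRes K A J, IsQuasiHom (A := A) r ∧ ∀ n, r (i n) = n := by
  have : Mono (toQuasiMod i hi) := (ModuleCat.mono_iff_injective _).2 hinj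
  have hr := Injective.comp_factorThru (𝟙 J) (toQuasiMod i hi)
  exact ⟨quasiResMap (Injective.factorThru (𝟙 J) (toQuasiMod i hi)) ∘ₗ
    (quasiResObj K A W).toLinearMap, (quasiResMap_isQuasiHom _).comp quasiResObj_isQuasiHom,
    fun n => ConcreteCategory.congr_hom hr ((toQuasiRes K A J).symm n)⟩

/-- The tail cohomology of an injective module vanishes in degrees greater than two. -/
theorem exists_tailD_eq_of_injective [CharZero K] (J : ModuleCat.{u} (QuasiEnv K A)) [Injective J]
    (n : ℕ) (f : TailCochain K A (QuasiRes K A J) (n + 3)) (hf : tailD (n + 3) f = 0) :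
    ∃ g, tailD (n + 2) g = f := by
  obtain ⟨S, _, _, _, _, ⟨E⟩⟩ := exists_eulerFiltration K (PoissonLie K A)
  obtain ⟨r, hr, hri⟩ := exists_retraction_of_injective J (coEmb (M := QuasiRes K A J) E)
    (coEmb_isQuasiHom E) (coEmb_injective E)
  exact exists_tailD_eq_of_retract (coEmb E) (coEmb_isQuasiHom E) r hr hri (n + 2)
    (exists_tailD_eq_coMod E n) f hf

/-- Dimension shifting with k = 2 and X = Ω²(A), the lowest cohomology being the invariant
Hochschild two-cocycles. -/
theorem nonempty_tailFunctor_homology_equiv_ext [CharZero K] (n : ℕ)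
    (N : ModuleCat.{u} (QuasiEnv K A)) :
    Nonempty (((tailFunctor K A).obj N).homology (n + 2) ≃ₗ[K]
      Abelian.Ext (omegaMod K A) N n) := by
  have h := nonempty_homology_equiv_ext (tailFunctor K A) tailFunctor_shortExact
    (omegaMod K A) 2 (fun N i => ?_) omegaCochain
    (fun N x => (tailComplex_d 2 _).trans (tailD_omegaCochain N x))
    (fun φ x => omegaCochain_naturality φ x) omegaCochain_injective
    (fun N f hf => exists_omegaCochain_eq N f ((tailComplex_d 2 f).symm.trans hf))
    (fun J _ m => isZero_homology _ _ (fun f hf => ?_)) n N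
  · rw [add_comm] at h
    exact h
  -- The differential from degree one vanishes because there are no tail cochains in that degree;
  -- every other one with target degree two is zero by the shape of the complex.
  · by_cases hi : i + 1 = 2
    · obtain rfl : i = 1 := by omega
      apply ModuleCat.hom_ext
      refine LinearMap.ext fun (f : TailCochain K A (QuasiRes K A N) 1) => ?_
      have := subsingleton_tailCochain (K := K) (A := A) (M := QuasiRes K A N) (n := 1) (by omega)
      rw [Subsingleton.elim f 0]
      exact map_zero _
    · exact HomologicalComplex.shape _ _ _ (by simpa using hi)
  · have key : ∀ l, l = m + 2 → ∀ f : TailCochain K A (QuasiRes K A J) (l + 1),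
        tailD (l + 1) f = 0 → ∃ g, tailD l g = f := by
      rintro _ rfl f hf
      exact exists_tailD_eq_of_injective J m f hf
    obtain ⟨g, hg⟩ := key (2 + m) (by omega) f ((tailComplex_d _ f).symm.trans hf)
    exact ⟨g, (tailComplex_d _ g).trans hg⟩

/-- The tail cohomology is `Ext` of `Ω²(A)` over the quasi-Poisson enveloping algebra. -/
theorem nonempty_tailComplex_homology_equiv_ext [CharZero K] (M : Type u) [AddCommGroup M]
    [Module K M] [Module A M] [Module Aᵐᵒᵖ M] [SMulCommClass A Aᵐᵒᵖ M] [IsScalarTower K A M]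
    [IsScalarTower K Aᵐᵒᵖ M] [QuasiPoissonModule K A M] (n : ℕ) :
    Nonempty ((tailComplex K A M).homology (n + 2) ≃ₗ[K]
      Abelian.Ext (omegaMod K A) (quasiMod K A M) n) := by
  obtain ⟨e⟩ := nonempty_tailFunctor_homology_equiv_ext n (quasiMod K A M)
  have i : tailComplex K A M ≅ (tailFunctor K A).obj (quasiMod K A M) :=
    tailComplexIso (quasiResObj K A M) quasiResObj_isQuasiHom quasiResObj_symm_isQuasiHom
  exact ⟨((HomologicalComplex.homologyFunctor _ _ (n + 2)).mapIso i).toLinearEquiv ≪≫ₗ e⟩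

end Final

/-! ### The long exact cohomology sequence -/

section LongExact

theorem exact_conj {R V₁ V₂ V₃ W₁ W₂ W₃ : Type*} [Field R] [AddCommGroup V₁] [Module R V₁]
    [AddCommGroup V₂] [Module R V₂] [AddCommGroup V₃] [Module R V₃] [AddCommGroup W₁]
    [Module R W₁] [AddCommGroup W₂] [Module R W₂] [AddCommGroup W₃] [Module R W₃]
    {f : V₁ →ₗ[R] V₂} {g : V₂ →ₗ[R] V₃} (h : Function.Exact f g) (e₁ : V₁ ≃ₗ[R] W₁)
    (e₂ : V₂ ≃ₗ[R] W₂) (e₃ : V₃ ≃ₗ[R] W₃) :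
    Function.Exact (e₂.toLinearMap ∘ₗ f ∘ₗ e₁.symm.toLinearMap)
      (e₃.toLinearMap ∘ₗ g ∘ₗ e₂.symm.toLinearMap) :=
  Function.Exact.of_ladder_linearEquiv_of_exact (e₁ := e₁) (e₂ := e₂) (e₃ := e₃)
    (by ext; simp) (by ext; simp) h

variable (K A M : Type u) [Field K] [Ring A] [Algebra K A]
    [PoissonAlgebra K A] [AddCommGroup M] [Module K M] [Module A M] [Module Aᵐᵒᵖ M]
    [SMulCommClass A Aᵐᵒᵖ M] [IsScalarTower K A M] [IsScalarTower K Aᵐᵒᵖ M]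

theorem subsingleton_tailComplex_homology [QuasiPoissonModule K A M] {n : ℕ} (hn : n < 2) :
    Subsingleton ((tailComplex K A M).homology n) := by
  refine ModuleCat.subsingleton_of_isZero ?_
  rw [← HomologicalComplex.exactAt_iff_isZero_homology]
  refine ShortComplex.exact_of_isZero_X₂ _ ?_
  have := subsingleton_tailCochain (K := K) (A := A) (M := M) hn
  exact ModuleCat.isZero_of_subsingleton (ModuleCat.of K (TailCochain K A M n))

variable [PoissonModule K A M]

theorem exact_tailInclusion_ceProjection (n : ℕ) :
    Function.Exact (HomologicalComplex.homologyMap (tailInclusion K A M) n).hom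
      (HomologicalComplex.homologyMap (ceProjection K A M) n).hom :=
  (ShortComplex.ShortExact.moduleCat_exact_iff_function_exact _).1
    ((poissonSES_shortExact K A M).homology_exact₂ n)

theorem exact_ceProjection_δ (n : ℕ) :
    Function.Exact (HomologicalComplex.homologyMap (ceProjection K A M) n).hom
      ((poissonSES_shortExact K A M).δ n (n + 1) rfl).hom :=
  (ShortComplex.ShortExact.moduleCat_exact_iff_function_exact _).1
    ((poissonSES_shortExact K A M).homology_exact₃ n (n + 1) rfl)

theorem exact_δ_tailInclusion (n : ℕ) :
    Function.Exact ((poissonSES_shortExact K A M).δ n (n + 1) rfl).hom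
      (HomologicalComplex.homologyMap (tailInclusion K A M) (n + 1)).hom :=
  (ShortComplex.ShortExact.moduleCat_exact_iff_function_exact _).1
    ((poissonSES_shortExact K A M).homology_exact₁ n (n + 1) rfl)

/-- The kernel is the image of the tail cohomology, which is zero in degrees 0 and 1. -/
theorem injective_homologyMap_ceProjection {n : ℕ} (hn : n < 2) :
    Function.Injective (HomologicalComplex.homologyMap (ceProjection K A M) n).hom := by
  have := subsingleton_tailComplex_homology K A M hn
  rw [injective_iff_map_eq_zero]
  intro x hx
  obtain ⟨y, rfl⟩ := (exact_tailInclusion_ceProjection K A M n x).1 hx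
  rw [Subsingleton.elim y 0, map_zero]

/-- The obstruction to lifting a class lies in the tail cohomology of degree one, which is zero. -/
theorem surjective_homologyMap_ceProjection_zero :
    Function.Surjective (HomologicalComplex.homologyMap (ceProjection K A M) 0).hom := by
  have h : Subsingleton ((tailComplex K A M).homology 1) :=
    subsingleton_tailComplex_homology K A M one_lt_two
  exact fun x => (exact_ceProjection_δ K A M 0 x).1 (h.elim _ _)

end LongExact

end FGVPoisson

-- The subscript 0 marks maps rewritten with Hom in place of `Ext` of degree 0. The opening 0 → HP⁰
-- → Hom → 0 → HP¹ → Ext¹ is recorded as bijectivity of `α₀` and injectivity of `α 1`; the other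
-- exactness statements cover each later position once.
open FGVPoisson CategoryTheory in
theorem mainTheorem1 {K A M : Type u} [Field K] [CharZero K] [Ring A] [Algebra K A]
    [PoissonAlgebra K A] [AddCommGroup M] [Module K M] [Module A M] [Module Aᵐᵒᵖ M]
    [SMulCommClass A Aᵐᵒᵖ M] [IsScalarTower K A M] [IsScalarTower K Aᵐᵒᵖ M]
    [PoissonModule K A M] :
    ∃ (e : ∀ n, (ceComplex K A M).homology n ≃ₗ[K] Abelian.Ext (trivialMod K A) (lieMod K A M) n)
      (f : ∀ n, (tailComplex K A M).homology (n + 2) ≃ₗ[K]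
        Abelian.Ext (omegaMod K A) (quasiMod K A M) n),
      let α : ∀ n, HP K A M n →ₗ[K] Abelian.Ext (trivialMod K A) (lieMod K A M) n := fun n =>
        (e n).toLinearMap ∘ₗ (HomologicalComplex.homologyMap (ceProjection K A M) n).hom
      let β : ∀ n, Abelian.Ext (omegaMod K A) (quasiMod K A M) n →ₗ[K] HP K A M (n + 2) := fun n =>
        (HomologicalComplex.homologyMap (tailInclusion K A M) (n + 2)).hom ∘ₗ (f n).symm.toLinearMap
      let γ : ∀ n, Abelian.Ext (trivialMod K A) (lieMod K A M) (n + 1) →ₗ[K]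
          Abelian.Ext (omegaMod K A) (quasiMod K A M) n := fun n =>
        (f n).toLinearMap ∘ₗ ((poissonSES_shortExact K A M).δ (n + 1) (n + 2) rfl).hom ∘ₗ
          (e (n + 1)).symm.toLinearMap
      let α₀ : HP K A M 0 →ₗ[K] (trivialMod K A ⟶ lieMod K A M) :=
        Abelian.Ext.linearEquiv₀.toLinearMap ∘ₗ α 0
      let γ₀ : Abelian.Ext (trivialMod K A) (lieMod K A M) 1 →ₗ[K]
          (omegaMod K A ⟶ quasiMod K A M) :=
        Abelian.Ext.linearEquiv₀.toLinearMap ∘ₗ γ 0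
      let β₀ : (omegaMod K A ⟶ quasiMod K A M) →ₗ[K] HP K A M 2 :=
        β 0 ∘ₗ Abelian.Ext.linearEquiv₀.symm.toLinearMap
      Function.Bijective α₀ ∧ Function.Injective (α 1) ∧
        Function.Exact (α 1) γ₀ ∧ Function.Exact γ₀ β₀ ∧ Function.Exact β₀ (α 2) ∧
        ∀ n, Function.Exact (α (n + 2)) (γ (n + 1)) ∧ Function.Exact (γ (n + 1)) (β (n + 1)) ∧
          Function.Exact (β (n + 1)) (α (n + 3)) := by
  -- The isomorphisms are chosen separately in each degree. No compatibility between them is needed,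
  -- since α, β and γ are defined by conjugating the maps of the cohomology sequence of (*).
  obtain e := fun n => (nonempty_ceComplex_homology_equiv_ext (K := K) (A := A) M n).some
  obtain f := fun n => (nonempty_tailComplex_homology_equiv_ext (K := K) (A := A) M n).some
  refine ⟨e, f, ?_⟩
  intro α β γ α₀ γ₀ β₀
  let l := Abelian.Ext.linearEquiv₀ (R := K) (X := omegaMod K A) (Y := quasiMod K A M)
  have h1 : ∀ n, Function.Exact (α (n + 1)) (γ n) := fun n =>
    exact_conj (exact_ceProjection_δ K A M (n + 1)) (LinearEquiv.refl K _) (e (n + 1)) (f n)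
  have h2 : ∀ n, Function.Exact (γ n) (β n) := fun n =>
    exact_conj (exact_δ_tailInclusion K A M (n + 1)) (e (n + 1)) (f n) (LinearEquiv.refl K _)
  have h3 : ∀ n, Function.Exact (β n) (α (n + 2)) := fun n =>
    exact_conj (exact_tailInclusion_ceProjection K A M (n + 2)) (f n) (LinearEquiv.refl K _)
      (e (n + 2))
  refine ⟨?_, ?_, exact_conj (h1 0) (LinearEquiv.refl K _) (LinearEquiv.refl K _) l,
    exact_conj (h2 0) (LinearEquiv.refl K _) l (LinearEquiv.refl K _),
    exact_conj (h3 0) l (LinearEquiv.refl K _) (LinearEquiv.refl K _),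
    fun n => ⟨h1 (n + 1), h2 (n + 1), h3 (n + 1)⟩⟩
  · exact (Abelian.Ext.linearEquiv₀ (R := K)).bijective.comp ((e 0).bijective.comp
      ⟨injective_homologyMap_ceProjection K A M two_pos,
        surjective_homologyMap_ceProjection_zero K A M⟩)
  · exact (e 1).injective.comp (injective_homologyMap_ceProjection K A M one_lt_two)
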